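/- **Conventions.** A manifold is a $C^\infty$ manifold (finite dimensional, of locally constant dimension, not necessarily Hausdorff); $\mathfrak S$ is the category of manifolds and $C^\infty$ maps. A submersion is a $C^\infty$ map whose derivative is surjective at every point. A *Lie groupoid* $\Gamma_\bullet=(\Gamma_1\rightrightarrows \Gamma_0)$ is a groupoid in $\mathfrak S$ whose source and target maps $s,t:\Gamma_1\to\Gamma_0$ are submersions; the product $\gamma\cdot\delta$ is defined when $t(\gamma)=s(\delta)$. It is second countable if the manifolds $\Gamma_0$ and $\Gamma_1$ are. A (right) *action* of $\Gamma_\bullet$ on a manifold $P$ consists of a $C^\infty$ anchor map $a:P\to\Gamma_0$ and a $C^\infty$ map $P\times_{a,\Gamma_0,s}\Gamma_1\to P$, $(p,\gamma)\mapsto p\cdot\gamma$, with $a(p\cdot\gamma)=t(\gamma)$, $p\cdot 1_{a(p)}=p$ and $p\cdot(\gamma\cdot\delta)=(p\cdot\gamma)\cdot\delta$. A *$\Gamma_\bullet$-torsor over a manifold $S$* is a manifold $P$ with a surjective submersion $\pi:P\to S$ and a right action of $\Gamma_\bullet$ on $P$ with $\pi(p\cdot\gamma)=\pi(p)$, such that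 for all $p,p'\in P$ with $\pi(p)=\pi(p')$ there is a unique $\gamma\in\Gamma_1$ for which $p\cdot\gamma$ is defined and equal to $p'$. A morphism from a torsor $Q\to T$ to a torsor $P\to S$ is a pair of $C^\infty$ maps $Q\to P$, $T\to S$ commuting with the structure maps, such that $Q\to P$ commutes with the anchor maps and the actions. The *stack of $\Gamma_\bullet$-torsors* is the category of all $\Gamma_\bullet$-torsors, over all manifolds, with the functor to $\mathfrak S$ that sends a torsor over $S$ to $S$. Two stacks $\mathfrak X,\mathfrak Y$ over $\mathfrak S$ are *isomorphic* if there are functors $f:\mathfrak X\to\mathfrak Y$ and $g:\mathfrak Y\to\mathfrak X$ over $\mathfrak S$ and natural isomorphisms $f\circ g\cong\mathrm{id}_{\mathfrak Y}$ and $g\circ f\cong\mathrm{id}_{\mathfrak X}$ over $\mathfrak S$. A morphism of Lie groupoids $\phi_\bullet:Z_\bullet\to X_\bullet$ (a $C^\infty$ functor) is a *Morita morphism* if $\phi_0:Z_0\to X_0$ is a surjective submersion and the square $$\begin{array}{ccc} Z_1&\xrightarrow{(s,t)}&Z_0\times Z_0\\ \downarrow&&\downarrow\\ X_1&\xrightarrow{(s,t)}&X_0\times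 X_0\end{array}$$ is cartesian in $\mathfrak S$. **Theorem.** Let $X_\bullet$ and $Y_\bullet$ be second countable Lie groupoids, and let $\mathfrak X$ and $\mathfrak Y$ be the stacks of $X_\bullet$-torsors and of $Y_\bullet$-torsors. The following are equivalent: 1. the stacks $\mathfrak X$ and $\mathfrak Y$ are isomorphic; 2. $X_\bullet$ and $Y_\bullet$ are Morita equivalent: there are a Lie groupoid $Z_\bullet$ and Morita morphisms $Z_\bullet\to X_\bullet$ and $Z_\bullet\to Y_\bullet$; 3. there is an $X_\bullet$-$Y_\bullet$-bitorsor: a manifold $Q$ with $C^\infty$ maps $f:Q\to X_0$ and $g:Q\to Y_0$ and commuting actions of $X_\bullet$ (with anchor $f$) and of $Y_\bullet$ (with anchor $g$) on $Q$, such that $Q$ is at the same time an $X_\bullet$-torsor over $Y_0$ via $g$ and a $Y_\bullet$-torsor over $X_0$ via $f$. -/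

import Mathlib

open CategoryTheory

open scoped ContDiff

universe u

namespace DiffStack

/-! ### Manifolds

A smooth manifold is a topological space with a smooth atlas. It is not required to be Hausdorff,
second countable, or of constant dimension: the dimension is only locally constant, so each chart
carries its own dimension. (`IsManifold` fixes one model space, hence one dimension, for the whole
manifold.) -/

/-- A chart: a dimension `n` and a homeomorphism of an open subset onto an open subset of `ℝⁿ`. -/
abbrev Chart (M : Type u) [TopologicalSpace M] : Type u :=
  Σ n : ℕ, OpenPartialHomeomorph M (EuclideanSpace ℝ (Fin n))

/-- The expression of a map `f` in a chart `e` of the source and a chart `e'` of the target. -/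
def coordExpr {M N : Type u} [TopologicalSpace M] [TopologicalSpace N] (f : M → N)
    (e : Chart M) (e' : Chart N) :
    EuclideanSpace ℝ (Fin e.1) → EuclideanSpace ℝ (Fin e'.1) :=
  fun v => e'.2 (f (e.2.symm v))

/-- `C^∞` manifolds (finite dimensional, not necessarily Hausdorff). -/
structure SmoothManifold : Type (u + 1) where
  carrier : Type u
  [topology : TopologicalSpace carrier]
  atlas : Set (Chart carrier)
  exists_chart : ∀ x : carrier, ∃ e ∈ atlas, x ∈ e.2.source
  compatible : ∀ e ∈ atlas, ∀ e' ∈ atlas,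
    ContDiffOn ℝ ∞ (coordExpr id e e') (e.2.symm.trans e'.2).source

instance : CoeSort SmoothManifold.{u} (Type u) := ⟨SmoothManifold.carrier⟩

instance (M : SmoothManifold.{u}) : TopologicalSpace M := M.topology

/-- `C^∞` maps: continuous, and `C^∞` in charts. -/
structure IsSmooth {M N : SmoothManifold.{u}} (f : M → N) : Prop where
  continuous : Continuous f
  contDiffAt : ∀ e ∈ M.atlas, ∀ e' ∈ N.atlas, ∀ x ∈ e.2.source, f x ∈ e'.2.source →
    ContDiffAt ℝ ∞ (coordExpr f e e') (e.2 x)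

/-- Submersions: smooth maps whose derivative (computed in charts) is surjective at every point. -/
structure IsSubmersion {M N : SmoothManifold.{u}} (f : M → N) : Prop extends IsSmooth f where
  surjective_fderiv : ∀ e ∈ M.atlas, ∀ e' ∈ N.atlas, ∀ x ∈ e.2.source, f x ∈ e'.2.source →
    Function.Surjective (fderiv ℝ (coordExpr f e e') (e.2 x))

theorem IsSmooth.id (M : SmoothManifold.{u}) : IsSmooth (fun x : M => x) where
  continuous := continuous_id
  contDiffAt e he e' he' x hx hx' := by
    refine (M.compatible e he e' he').contDiffAt
      ((e.2.symm.trans e'.2).open_source.mem_nhds ?_)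
    simp [hx, hx']

theorem IsSmooth.comp {M N P : SmoothManifold.{u}} {g : N → P} {f : M → N}
    (hg : IsSmooth g) (hf : IsSmooth f) : IsSmooth (fun x => g (f x)) where
  continuous := hg.continuous.comp hf.continuous
  contDiffAt e he e' he' x hx hx' := by
    obtain ⟨d, hd, hxd⟩ := N.exists_chart (f x)
    have h1 := hf.contDiffAt e he d hd x hx hxd
    have h2 := hg.contDiffAt d hd e' he' (f x) hxd hx'
    have hval : coordExpr f e d (e.2 x) = d.2 (f x) := by
      simp [coordExpr, hx]
    rw [← hval] at h2
    refine (h2.comp (e.2 x) h1).congr_of_eventuallyEq ?_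
    have hc : Filter.Tendsto (fun v => f (e.2.symm v)) (nhds (e.2 x)) (nhds (f x)) := by
      have := hf.continuous.continuousAt.tendsto.comp (e.2.tendsto_symm hx)
      exact this
    filter_upwards [hc (d.2.open_source.mem_nhds hxd)] with v hv
    have hv' : f (e.2.symm v) ∈ d.2.source := hv
    simp [coordExpr, hv']

/-- Bundled `C^∞` maps. -/
@[ext]
structure SmoothMap (M N : SmoothManifold.{u}) : Type u where
  toFun : M → N
  smooth : IsSmooth toFun

instance (M N : SmoothManifold.{u}) : CoeFun (SmoothMap M N) (fun _ => M → N) := ⟨SmoothMap.toFun⟩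

/-- The category of `C^∞` manifolds and `C^∞` maps. -/
instance : Category.{u} SmoothManifold.{u} where
  Hom := SmoothMap
  id M := ⟨fun x => x, IsSmooth.id M⟩
  comp f g := ⟨fun x => g (f x), g.smooth.comp f.smooth⟩

/-! ### Lie groupoids -/

/-- A Lie groupoid `Mor ⇉ Obj`: a groupoid in the category of manifolds whose source and target
maps are submersions. The product `mul g h` is defined when `tgt g = src h`.

Smoothness of the multiplication on the manifold `Mor ×_{tgt, Obj, src} Mor` is expressed through
the universal property of that fibered product (which exists because `tgt` is a submersion): the
product of any two smooth families of composable arrows is smooth. -/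
structure LieGroupoid : Type (u + 1) where
  Obj : SmoothManifold.{u}
  Mor : SmoothManifold.{u}
  src : SmoothMap Mor Obj
  tgt : SmoothMap Mor Obj
  one : SmoothMap Obj Mor
  inv : SmoothMap Mor Mor
  mul : ∀ g h : Mor, tgt g = src h → Mor
  submersion_src : IsSubmersion src.toFun
  submersion_tgt : IsSubmersion tgt.toFun
  src_one : ∀ x, src (one x) = x
  tgt_one : ∀ x, tgt (one x) = x
  src_inv : ∀ g, src (inv g) = tgt g
  tgt_inv : ∀ g, tgt (inv g) = src g
  src_mul : ∀ g h w, src (mul g h w) = src g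
  tgt_mul : ∀ g h w, tgt (mul g h w) = tgt h
  one_mul : ∀ g, mul (one (src g)) g (tgt_one _) = g
  mul_one : ∀ g, mul g (one (tgt g)) (src_one _).symm = g
  mul_inv : ∀ g, mul g (inv g) (src_inv g).symm = one (src g)
  inv_mul : ∀ g, mul (inv g) g (tgt_inv g) = one (tgt g)
  mul_assoc : ∀ g h k (w : tgt g = src h) (w' : tgt h = src k),
    mul (mul g h w) k ((tgt_mul g h w).trans w') = mul g (mul h k w') (w.trans (src_mul h k w').symm)
  smooth_mul : ∀ (W : SmoothManifold.{u}) (a b : SmoothMap W Mor) (w : ∀ p, tgt (a p) = src (b p)),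
    IsSmooth (fun p => mul (a p) (b p) (w p))

/-- Morphisms of Lie groupoids: smooth functors. -/
structure LieGroupoid.Hom (X Y : LieGroupoid.{u}) : Type u where
  obj : SmoothMap X.Obj Y.Obj
  mor : SmoothMap X.Mor Y.Mor
  src_mor : ∀ g, Y.src (mor g) = obj (X.src g)
  tgt_mor : ∀ g, Y.tgt (mor g) = obj (X.tgt g)
  mor_one : ∀ x, mor (X.one x) = Y.one (obj x)
  mor_mul : ∀ g h (w : X.tgt g = X.src h),
    mor (X.mul g h w) =
      Y.mul (mor g) (mor h) ((tgt_mor g).trans ((congrArg obj.toFun w).trans (src_mor h).symm))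

/-- A Morita morphism: it is a surjective submersion on objects, and the square
`X₁ → X₀ × X₀`, `Y₁ → Y₀ × Y₀` is cartesian in the category of manifolds. -/
structure LieGroupoid.Hom.IsMorita {X Y : LieGroupoid.{u}} (φ : X.Hom Y) : Prop where
  surjective_obj : Function.Surjective φ.obj.toFun
  submersion_obj : IsSubmersion φ.obj.toFun
  cartesian : ∀ (W : SmoothManifold.{u}) (a b : SmoothMap W X.Obj) (c : SmoothMap W Y.Mor),
    (∀ p, Y.src (c p) = φ.obj (a p)) → (∀ p, Y.tgt (c p) = φ.obj (b p)) →
      ∃! d : SmoothMap W X.Mor,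
        (∀ p, X.src (d p) = a p) ∧ (∀ p, X.tgt (d p) = b p) ∧ ∀ p, φ.mor (d p) = c p

/-- Morita equivalence: there are Morita morphisms from a third Lie groupoid to both. -/
def MoritaEquivalent (X Y : LieGroupoid.{u}) : Prop :=
  ∃ (Z : LieGroupoid.{u}) (φ : Z.Hom X) (ψ : Z.Hom Y), φ.IsMorita ∧ ψ.IsMorita

/-! ### Torsors -/

/-- A smooth right action of a Lie groupoid `Γ` on a manifold `P`: `act p g` is defined when
`anchor p = src g`. Smoothness on the fibered product `P ×_{anchor, src} Γ₁` is expressed through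
its universal property, as for the multiplication of a Lie groupoid. -/
structure RightAction (Γ : LieGroupoid.{u}) (P : SmoothManifold.{u}) : Type u where
  anchor : SmoothMap P Γ.Obj
  act : ∀ (p : P) (g : Γ.Mor), anchor p = Γ.src g → P
  anchor_act : ∀ p g w, anchor (act p g w) = Γ.tgt g
  act_one : ∀ p, act p (Γ.one (anchor p)) (Γ.src_one _).symm = p
  act_mul : ∀ p g h (w : anchor p = Γ.src g) (w' : Γ.tgt g = Γ.src h),
    act p (Γ.mul g h w') (w.trans (Γ.src_mul g h w').symm) =
      act (act p g w) h ((anchor_act p g w).trans w')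
  smooth_act : ∀ (W : SmoothManifold.{u}) (a : SmoothMap W P) (b : SmoothMap W Γ.Mor)
    (w : ∀ x, anchor (a x) = Γ.src (b x)), IsSmooth (fun x => act (a x) (b x) (w x))

/-- The structure of a `Γ`-torsor over `S` on a manifold `P`: a surjective submersion `P → S` and a
right action of `Γ` on `P` over `S` that is simply transitive on the fibers. -/
structure TorsorStructure (Γ : LieGroupoid.{u}) (S P : SmoothManifold.{u}) : Type u
    extends RightAction Γ P where
  proj : SmoothMap P S
  surjective_proj : Function.Surjective proj.toFun
  submersion_proj : IsSubmersion proj.toFun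
  proj_act : ∀ p g w, proj (act p g w) = proj p
  existsUnique_act : ∀ p p', proj p = proj p' → ∃! g : Γ.Mor, ∃ w : anchor p = Γ.src g, act p g w = p'

/-- A `Γ`-torsor `total → base`. -/
structure Torsor (Γ : LieGroupoid.{u}) : Type (u + 1) where
  base : SmoothManifold.{u}
  total : SmoothManifold.{u}
  str : TorsorStructure Γ base total

/-- Morphisms of `Γ`-torsors: commutative squares of smooth maps, equivariant on total spaces. -/
@[ext]
structure Torsor.Hom {Γ : LieGroupoid.{u}} (Q P : Torsor Γ) : Type u where
  base : SmoothMap Q.base P.base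
  total : SmoothMap Q.total P.total
  comm : ∀ q, P.str.proj (total q) = base (Q.str.proj q)
  anchor_total : ∀ q, P.str.anchor (total q) = Q.str.anchor q
  total_act : ∀ q g (w : Q.str.anchor q = Γ.src g),
    total (Q.str.act q g w) = P.str.act (total q) g ((anchor_total q).trans w)

/-- The category of `Γ`-torsors. -/
instance (Γ : LieGroupoid.{u}) : Category.{u} (Torsor Γ) where
  Hom := Torsor.Hom
  id P :=
    { base := ⟨fun x => x, IsSmooth.id _⟩
      total := ⟨fun x => x, IsSmooth.id _⟩
      comm := fun _ => rfl
      anchor_total := fun _ => rfl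
      total_act := fun _ _ _ => rfl }
  comp f g :=
    { base := ⟨fun x => g.base (f.base x), g.base.smooth.comp f.base.smooth⟩
      total := ⟨fun x => g.total (f.total x), g.total.smooth.comp f.total.smooth⟩
      comm := fun q => (g.comm _).trans (congrArg g.base.toFun (f.comm q))
      anchor_total := fun q => (g.anchor_total _).trans (f.anchor_total q)
      total_act := fun q k w =>
        (congrArg g.total.toFun (f.total_act q k w)).trans (g.total_act _ _ _) }

/-- The stack of `Γ`-torsors: the category of `Γ`-torsors, together with the functor to the
category of manifolds that sends a torsor to its base. -/
def torsorStack (Γ : LieGroupoid.{u}) : BasedCategory.{u, u + 1} SmoothManifold.{u} where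
  obj := Torsor Γ
  category := inferInstance
  p :=
    { obj := fun P => P.base
      map := fun f => f.base
      map_id := fun _ => rfl
      map_comp := fun _ _ => rfl }

/-- Two categories over the category of manifolds are isomorphic (as stacks) if they are equivalent
over it: there are functors over the base in both directions, both of whose composites are
isomorphic, over the base, to the identity. -/
def StackIsomorphic (𝒳 𝒴 : BasedCategory.{u, u + 1} SmoothManifold.{u}) : Prop :=
  ∃ (F : BasedFunctor 𝒳 𝒴) (G : BasedFunctor 𝒴 𝒳),
    Nonempty (BasedFunctor.comp G F ≅ BasedFunctor.id 𝒴) ∧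
      Nonempty (BasedFunctor.comp F G ≅ BasedFunctor.id 𝒳)

/-- An `X`-`Y`-bitorsor: a manifold `Q` with maps `f : Q → X₀`, `g : Q → Y₀` and commuting actions of
`X` (with anchor `f`) and of `Y` (with anchor `g`), such that `Q` is an `X`-torsor over `Y₀` via `g`
and a `Y`-torsor over `X₀` via `f`. -/
structure Bitorsor (X Y : LieGroupoid.{u}) : Type (u + 1) where
  Q : SmoothManifold.{u}
  f : SmoothMap Q X.Obj
  g : SmoothMap Q Y.Obj
  left : TorsorStructure X Y.Obj Q
  right : TorsorStructure Y X.Obj Q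
  left_anchor : left.anchor = f
  left_proj : left.proj = g
  right_anchor : right.anchor = g
  right_proj : right.proj = f
  commute : ∀ (q : Q) (x : X.Mor) (y : Y.Mor) (hx : left.anchor q = X.src x)
    (hy : right.anchor q = Y.src y),
    ∃ (hy' : right.anchor (left.act q x hx) = Y.src y)
      (hx' : left.anchor (right.act q y hy) = X.src x),
      right.act (left.act q x hx) y hy' = left.act (right.act q y hy) x hx'

end DiffStack

/-! The definition of a torsor only asks for a set-theoretically unique arrow between two points of
a fiber, while every construction needs this arrow to depend smoothly on the points. Second
countability is used for exactly this (`TorsorStructure.smoothDiv`). Fix p and consider the orbit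
map γ ↦ p·γ from the source fiber over the anchor of p to the fiber of the torsor through p: a
smooth bijection. In charts it is a smooth injection, so the source dimension is at most the target
dimension (`finrank_le_of_injOn`), and where the derivative is nowhere surjective the image is a
null set (`volume_image_eq_zero_of_injOn`). Countably many charts cover the source fiber, so if the
derivative were never surjective, a nonempty open set would be null. Hence (γ, p) ↦ (p·γ, p) is a
submersion somewhere over p, its local sections give smooth families of arrows, and the action
spreads this to all pairs of points of the fiber.

From 2 to 3: a Morita morphism Z → X gives a bitorsor on X₁ ×_{X₀} Z₀ (`LieGroupoid.Hom.bitorsor`).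
Its division by Z is smooth because of the cartesian square, so no countability of Z is needed.
Bitorsors compose by dividing a fiber product by the diagonal action; the quotient is a manifold,
glued from pieces given by local sections of a torsor (`exists_assocQuotient`).

From 3 to 2: pull X back along f : Q → X₀. An arrow is a triple (q, x, q'), where q·x and q' lie
over the same point of X₀ and so differ by a unique arrow y of Y. Sending (q, x, q') to y is a
Morita morphism to Y (`Bitorsor.isMorita_pullHomRight`).

From 3 to 1: the functor sends P to (P ×_{X₀} Q)/X, and the opposite bitorsor gives an inverse,
through the natural isomorphism p ↦ [[p, q], q] (`Bitorsor.unitMap`).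

From 1 to 3: an equivalence F with inverse G yields the X-torsor Q → Y₀ given by G on the unit
Y-torsor U_Y. A map W → Q with anchor a is a morphism a^*U_X → Q, that is, by full faithfulness, a
morphism F(a^*U_X) → U_Y; this is a section of F(a^*U_X), that is, a lift of a to F(U_X). So Q is
diffeomorphic to F(U_X), a Y-torsor over X₀ (`TorsorFunctor.IsComparison`), and naturality in left
translations makes the two actions commute. -/

namespace DiffStack

/-! ### Calculus: normal form of submersions, and an injective case of Sard's theorem. -/

section Calculus

open Module

variable {E F : Type*} [NormedAddCommGroup E] [NormedSpace ℝ E] [FiniteDimensional ℝ E]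
  [NormedAddCommGroup F] [NormedSpace ℝ F] [FiniteDimensional ℝ F]

/-- A linear retraction onto the kernel of A supplies the missing coordinates: it is injective on
the kernel, and the dimensions agree by rank-nullity. -/
theorem exists_complement_of_surjective (A : E →L[ℝ] F) (hA : Function.Surjective A) :
    ∃ (k : ℕ) (_ : k + finrank ℝ F = finrank ℝ E) (κ : E →L[ℝ] EuclideanSpace ℝ (Fin k)),
      ∃ B : E ≃L[ℝ] F × EuclideanSpace ℝ (Fin k), (B : E →L[ℝ] _) = A.prod κ := by
  let K := LinearMap.ker (A : E →ₗ[ℝ] F)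
  obtain ⟨p, hp⟩ := K.subtype.exists_leftInverse_of_injective (by simp)
  let k := finrank ℝ K
  have hk : k + finrank ℝ F = finrank ℝ E := by
    have := LinearMap.finrank_range_add_finrank_ker (A : E →ₗ[ℝ] F)
    rw [LinearMap.range_eq_top.2 hA, finrank_top] at this
    rw [add_comm]; exact this
  let L : K ≃ₗ[ℝ] EuclideanSpace ℝ (Fin k) :=
    LinearEquiv.ofFinrankEq _ _ (by simp [k])
  let κ : E →L[ℝ] EuclideanSpace ℝ (Fin k) := LinearMap.toContinuousLinearMap (L.toLinearMap ∘ₗ p)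
  refine ⟨k, hk, κ, ?_⟩
  have hinj : Function.Injective (A.prod κ : E →ₗ[ℝ] F × EuclideanSpace ℝ (Fin k)) := by
    rw [← LinearMap.ker_eq_bot, LinearMap.ker_eq_bot']
    intro v hv
    have h1 : A v = 0 := congrArg Prod.fst hv
    have h2 : L (p v) = 0 := congrArg Prod.snd hv
    have h3 : p v = 0 := by simpa using h2
    have h4 : p v = (⟨v, h1⟩ : K) := LinearMap.congr_fun hp ⟨v, h1⟩
    rw [h3] at h4
    exact (congrArg Subtype.val h4).symm
  refine ⟨(LinearMap.linearEquivOfInjective _ hinj ?_).toContinuousLinearEquiv, ?_⟩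
  · simp [← hk, add_comm]
  · ext v <;> rfl

/-- Local normal form of a submersion: it is a projection in suitable coordinates. -/
theorem exists_submersion_normal_form {f : E → F} {U : Set E} (hU : IsOpen U)
    (hf : ∀ y ∈ U, ContDiffAt ℝ ∞ f y) {x : E} (hx : x ∈ U)
    (hs : Function.Surjective (fderiv ℝ f x)) :
    ∃ (k : ℕ) (_ : k + finrank ℝ F = finrank ℝ E) (κ : E →L[ℝ] EuclideanSpace ℝ (Fin k))
      (Φ : OpenPartialHomeomorph E (F × EuclideanSpace ℝ (Fin k))),
      x ∈ Φ.source ∧ Φ.source ⊆ U ∧ (∀ y, Φ y = (f y, κ y)) ∧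
        ∀ z ∈ Φ.target, ContDiffAt ℝ ∞ Φ.symm z := by
  obtain ⟨k, hk, κ, B, hB⟩ := exists_complement_of_surjective (fderiv ℝ f x) hs
  let g : E → F × EuclideanSpace ℝ (Fin k) := fun y => (f y, κ y)
  have hg : ∀ y ∈ U, ContDiffAt ℝ ∞ g y := fun y hy => (hf y hy).prodMk κ.contDiff.contDiffAt
  have hgx : HasFDerivAt g (B : E →L[ℝ] F × EuclideanSpace ℝ (Fin k)) x := by
    rw [hB]
    exact ((hf x hx).differentiableAt (by simp)).hasFDerivAt.prodMk κ.hasFDerivAt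
  let Φ₀ := (hg x hx).toOpenPartialHomeomorph g hgx (by simp)
  -- Invertibility of the derivative is an open condition. Shrinking the source to where it holds
  -- makes the inverse smooth on the whole target and not only at the image of `x`.
  have hV : {y | fderiv ℝ g y ∈ Set.range
      ((↑) : (E ≃L[ℝ] F × EuclideanSpace ℝ (Fin k)) → E →L[ℝ] F × EuclideanSpace ℝ (Fin k))} ∈
      nhds x := by
    have hc : ContinuousAt (fderiv ℝ g) x :=
      (((hg x hx).fderiv_right (m := 0) (by simp)).continuousAt)
    refine hc.preimage_mem_nhds ?_
    rw [hgx.fderiv]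
    exact ContinuousLinearEquiv.nhds B
  obtain ⟨V, hVs, hVo, hxV⟩ := mem_nhds_iff.1 hV
  refine ⟨k, hk, κ, Φ₀.restrOpen (U ∩ V) (hU.inter hVo), ⟨?_, hx, hxV⟩, fun y hy => hy.2.1,
    fun y => rfl, fun z hz => ?_⟩
  · exact (hg x hx).mem_toOpenPartialHomeomorph_source hgx (by simp)
  · have hz' := (Φ₀.restrOpen (U ∩ V) (hU.inter hVo)).map_target hz
    obtain ⟨B', hB'⟩ := hVs hz'.2.2
    refine OpenPartialHomeomorph.contDiffAt_symm (f₀' := B') _ hz ?_ (hg _ hz'.2.1)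
    rw [hB']
    exact ((hg _ hz'.2.1).differentiableAt (by simp)).hasFDerivAt

/-- There is no smooth injection from a nonempty open set to a space of smaller dimension. -/
theorem finrank_le_of_injOn {h : E → F} {D : Set E} (hD : IsOpen D) (hne : D.Nonempty)
    (hh : ∀ y ∈ D, ContDiffAt ℝ ∞ h y) (hinj : Set.InjOn h D) : finrank ℝ E ≤ finrank ℝ F := by
  by_contra! hlt
  let r : E → ℕ := fun y => finrank ℝ (LinearMap.range (fderiv ℝ h y : E →ₗ[ℝ] F))
  have hr : ∀ y, r y ≤ finrank ℝ F := fun y => Submodule.finrank_le _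
  -- The rank takes finitely many values, so it is maximal somewhere; near such a point it is
  -- constant, which makes `h` factor locally through its projection to the range `V` of the
  -- derivative.
  obtain ⟨x, hx, hmax⟩ : ∃ x ∈ D, ∀ y ∈ D, r y ≤ r x := by
    have hfin : (r '' D).Finite := (Set.finite_le_nat (finrank ℝ F)).subset (by
      rintro _ ⟨y, -, rfl⟩; exact hr y)
    obtain ⟨m, ⟨x, hx, rfl⟩, hm⟩ := hfin.exists_maximal (hne.image r)
    refine ⟨x, hx, fun y hy => ?_⟩
    by_contra! hc
    exact absurd (hm ⟨y, hy, rfl⟩ hc.le) (not_le.2 hc)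
  let V := LinearMap.range (fderiv ℝ h x : E →ₗ[ℝ] F)
  obtain ⟨p, hp⟩ := V.subtype.exists_leftInverse_of_injective (by simp)
  let A : F →L[ℝ] V := LinearMap.toContinuousLinearMap p
  have hA : ∀ v : V, A v = v := fun v => LinearMap.congr_fun hp v
  have hG : ∀ y ∈ D, ContDiffAt ℝ ∞ (fun y => A (h y)) y := fun y hy =>
    A.contDiff.contDiffAt.comp y (hh y hy)
  have hdG : ∀ y ∈ D, HasFDerivAt (fun y => A (h y)) (A.comp (fderiv ℝ h y)) y := fun y hy =>
    A.hasFDerivAt.comp y ((hh y hy).differentiableAt (by simp)).hasFDerivAt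
  have hsurj : Function.Surjective (fderiv ℝ (fun y => A (h y)) x) := by
    rw [(hdG x hx).fderiv]
    rintro ⟨_, ⟨v, rfl⟩⟩
    exact ⟨v, hA ⟨_, ⟨v, rfl⟩⟩⟩
  obtain ⟨k, hk, κ, Φ, hxΦ, hΦD, hΦ, hΦs⟩ := exists_submersion_normal_form hD hG hx hsurj
  -- The rank is at most dim F < dim E, so the fibers of `A ∘ h` contain a direction `w` along which
  -- to move.
  have hkpos : 0 < k := by
    have := hr x
    change finrank ℝ V ≤ _ at this
    omega
  let w : EuclideanSpace ℝ (Fin k) := EuclideanSpace.single ⟨0, hkpos⟩ 1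
  have hw : w ≠ 0 := by simp [w]
  -- the differential of `h` and of `A ∘ h` have the same kernel near `x`
  have hker : ∀ y ∈ Φ.source, ∀ v, A (fderiv ℝ h y v) = 0 → fderiv ℝ h y v = 0 := by
    intro y hy v hv
    have hyD := hΦD hy
    have hsy : Function.Surjective (A.comp (fderiv ℝ h y)) := by
      have hΦd : HasFDerivAt (fun z => (Φ (Φ.symm z)).1)
          (ContinuousLinearMap.fst ℝ V (EuclideanSpace ℝ (Fin k))) (Φ y) := by
        refine (ContinuousLinearMap.fst ℝ V (EuclideanSpace ℝ (Fin k))).hasFDerivAt.congr_of_eventuallyEq ?_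
        filter_upwards [Φ.open_target.mem_nhds (Φ.map_source hy)] with z hz
        rw [Φ.right_inv hz]; rfl
      have h2 := (hΦs _ (Φ.map_source hy)).differentiableAt (by simp) |>.hasFDerivAt
      have h1 : HasFDerivAt (fun y => A (h y)) (A.comp (fderiv ℝ h y)) (Φ.symm (Φ y)) := by
        rw [Φ.left_inv hy]; exact hdG y hyD
      have h3 := h1.comp _ h2
      have h4 : (fun z => (Φ (Φ.symm z)).1) = (fun y => A (h y)) ∘ Φ.symm := by
        ext z; simp [hΦ]
      rw [h4] at hΦd
      have h5 := h3.unique hΦd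
      intro v
      refine ⟨fderiv ℝ Φ.symm (Φ y) (v, 0), ?_⟩
      exact DFunLike.congr_fun h5 (v, 0)
    let Vy := LinearMap.range (fderiv ℝ h y : E →ₗ[ℝ] F)
    have hs' : Function.Surjective (p ∘ₗ Vy.subtype) := by
      intro v
      obtain ⟨u, hu⟩ := hsy v
      exact ⟨⟨_, ⟨u, rfl⟩⟩, hu⟩
    -- The projection from the range at `y` onto `V` is surjective, and by maximality of the rank at
    -- `x` it cannot lower the dimension.
    have hi : Function.Injective (p ∘ₗ Vy.subtype) := by
      have h1 : finrank ℝ V ≤ finrank ℝ Vy := LinearMap.finrank_le_finrank_of_surjective hs'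
      exact (LinearMap.injective_iff_surjective_of_finrank_eq_finrank
        (le_antisymm (hmax y hyD) h1)).2 hs'
    have h6 := hi (a₁ := ⟨_, ⟨v, rfl⟩⟩) (a₂ := 0) (by rw [map_zero]; exact hv)
    exact congrArg Subtype.val h6
  -- A curve in the fiber of `A ∘ h` through `x`. Its velocity lies in the kernel of d(A ∘ h), hence
  -- of dh, so `h` is constant along it, against injectivity.
  let c : ℝ → E := fun t => Φ.symm ((Φ x).1, (Φ x).2 + t • w)
  have hline : Continuous fun t : ℝ => ((Φ x).1, (Φ x).2 + t • w) := by fun_prop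
  have h0 : ((Φ x).1, (Φ x).2 + (0 : ℝ) • w) ∈ Φ.target := by
    simpa using Φ.map_source hxΦ
  obtain ⟨ε, hε, hball⟩ := Metric.isOpen_iff.1 (Φ.open_target.preimage hline) 0 h0
  have hconst : ∀ t ∈ Metric.ball (0 : ℝ) ε, HasFDerivAt (h ∘ c) (0 : ℝ →L[ℝ] F) t := by
    intro t ht
    have htt := hball ht
    have hc : DifferentiableAt ℝ c t := by
      refine ((hΦs _ htt).differentiableAt (by simp)).comp t ?_
      fun_prop
    have hcs : c t ∈ Φ.source := Φ.map_target htt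
    have h1 := ((hh _ (hΦD hcs)).differentiableAt (by simp)).hasFDerivAt.comp t hc.hasFDerivAt
    have h10 : (fderiv ℝ h (c t)).comp (fderiv ℝ c t) = 0 := by
      ext
      refine hker _ hcs _ ?_
      have h2 := (hdG _ (hΦD hcs)).comp t hc.hasFDerivAt
      have h3 : HasFDerivAt ((fun y => A (h y)) ∘ c) (0 : ℝ →L[ℝ] V) t := by
        refine (hasFDerivAt_const ((Φ x).1) t).congr_of_eventuallyEq ?_
        filter_upwards [Metric.isOpen_ball.mem_nhds ht] with s hs
        have := hΦ (c s)
        rw [Φ.right_inv (hball hs)] at this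
        exact (congrArg Prod.fst this).symm
      exact DFunLike.congr_fun (h2.unique h3) 1
    rwa [h10] at h1
  have hcc : h (c (ε / 2)) = h (c 0) := by
    have hm1 : (ε / 2 : ℝ) ∈ Metric.ball (0 : ℝ) ε := by
      simp [abs_of_pos hε]; linarith
    have hm0 : (0 : ℝ) ∈ Metric.ball (0 : ℝ) ε := by simpa using hε
    refine Metric.isOpen_ball.is_const_of_fderiv_eq_zero (𝕜 := ℝ) (f := h ∘ c)
      (convex_ball (0 : ℝ) ε).isPreconnected
      (fun t ht => (hconst t ht).differentiableAt.differentiableWithinAt)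
      (fun t ht => (hconst t ht).fderiv) hm1 hm0
  have hm1 : (ε / 2 : ℝ) ∈ Metric.ball (0 : ℝ) ε := by
    simp [abs_of_pos hε]; linarith
  have hm0 : (0 : ℝ) ∈ Metric.ball (0 : ℝ) ε := by simpa using hε
  have h7 := hinj (hΦD (Φ.map_target (hball hm1))) (hΦD (Φ.map_target (hball hm0))) hcc
  have h8 := Φ.symm.injOn (hball hm1) (hball hm0) h7
  have h9 := congrArg Prod.snd h8
  simp only [add_right_inj, zero_smul, smul_eq_zero] at h9
  rcases h9 with h9 | h9
  · linarith
  · exact hw h9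

open MeasureTheory in
/-- A case of Sard's theorem: the image of a smooth injection without regular points is a null
set. -/
theorem volume_image_eq_zero_of_injOn {l k : ℕ}
    {h : EuclideanSpace ℝ (Fin l) → EuclideanSpace ℝ (Fin k)}
    {D : Set (EuclideanSpace ℝ (Fin l))} (hD : IsOpen D)
    (hh : ∀ y ∈ D, ContDiffAt ℝ ∞ h y) (hinj : Set.InjOn h D)
    (hns : ∀ y ∈ D, ¬ Function.Surjective (fderiv ℝ h y)) : volume (h '' D) = 0 := by
  rcases D.eq_empty_or_nonempty with rfl | hne
  · simp
  have hlk : l ≤ k := by simpa using finrank_le_of_injOn hD hne hh hinj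
  -- Precomposition with a linear surjection turns `h` into a self-map of ℝᵏ with the same image, to
  -- which the statement on vanishing Jacobian determinants applies.
  obtain ⟨L, hL⟩ : ∃ L : EuclideanSpace ℝ (Fin k) →L[ℝ] EuclideanSpace ℝ (Fin l),
      Function.Surjective L := by
    obtain ⟨m, rfl⟩ := Nat.exists_eq_add_of_le hlk
    refine ⟨(ContinuousLinearMap.fst ℝ _ _).comp
      (EuclideanSpace.finAddEquivProd (𝕜 := ℝ) (n := l) (m := m)).toContinuousLinearMap, fun v => ?_⟩
    exact ⟨EuclideanSpace.finAddEquivProd.symm (v, 0), by simp⟩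
  have himg : h '' D = (h ∘ L) '' (L ⁻¹' D) := by
    rw [Set.image_comp, Set.image_preimage_eq _ hL]
  rw [himg]
  refine addHaar_image_eq_zero_of_det_fderivWithin_eq_zero volume
    (f' := fun y => (fderiv ℝ h (L y)).comp L) (fun y hy => ?_) (fun y hy => ?_)
  · exact (((hh _ hy).differentiableAt (by simp)).hasFDerivAt.comp y
      L.hasFDerivAt).hasFDerivWithinAt
  · by_contra hdet
    refine hns _ hy fun v => ?_
    have hu : IsUnit (((fderiv ℝ h (L y)).comp L : EuclideanSpace ℝ (Fin k) →L[ℝ] _) :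
        EuclideanSpace ℝ (Fin k) →ₗ[ℝ] _) :=
      (LinearMap.isUnit_iff_isUnit_det _).2 (Ne.isUnit hdet)
    obtain ⟨u, hu⟩ := ((Module.End.isUnit_iff _).1 hu).2 v
    exact ⟨L u, hu⟩

end Calculus

noncomputable section

section

/-! ### Smoothness at a point, for maps between manifolds and normed spaces. -/

section Pointwise

open Filter Topology

variable {M N P : SmoothManifold.{u}} {E F : Type*} [NormedAddCommGroup E] [NormedSpace ℝ E]
  [NormedAddCommGroup F] [NormedSpace ℝ F]

/-- Smoothness at a point of a map from a manifold to a normed space. -/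
def SmoothInto (f : M → E) (x : M) : Prop :=
  ∃ e ∈ M.atlas, x ∈ e.2.source ∧ ContDiffAt ℝ ∞ (f ∘ e.2.symm) (e.2 x)

/-- Smoothness at a point of a map from a normed space to a manifold. -/
def SmoothFrom (γ : E → M) (v : E) : Prop :=
  ContinuousAt γ v ∧ ∃ e ∈ M.atlas, γ v ∈ e.2.source ∧ ContDiffAt ℝ ∞ (e.2 ∘ γ) v

/-- Smoothness at a point of a map between manifolds. -/
def SmoothAt (f : M → N) (x : M) : Prop :=
  ContinuousAt f x ∧ ∃ e ∈ N.atlas, f x ∈ e.2.source ∧ SmoothInto (e.2 ∘ f) x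

theorem SmoothManifold.contDiffAt_transition {e e' : Chart M} (he : e ∈ M.atlas)
    (he' : e' ∈ M.atlas) {x : M} (hx : x ∈ e.2.source) (hx' : x ∈ e'.2.source) :
    ContDiffAt ℝ ∞ (e'.2 ∘ e.2.symm) (e.2 x) :=
  (M.compatible e he e' he').contDiffAt
    ((e.2.symm.trans e'.2).open_source.mem_nhds (by simp [hx, hx']))

/-- Transition maps are smooth, so the chart chosen in the definition may be replaced by any other
chart at the point. -/
theorem smoothInto_iff {f : M → E} {x : M} {e : Chart M} (he : e ∈ M.atlas)
    (hx : x ∈ e.2.source) : SmoothInto f x ↔ ContDiffAt ℝ ∞ (f ∘ e.2.symm) (e.2 x) := by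
  refine ⟨?_, fun h => ⟨e, he, hx, h⟩⟩
  rintro ⟨d, hd, hxd, h⟩
  have h1 := M.contDiffAt_transition he hd hx hxd
  have h2 : (d.2 ∘ e.2.symm) (e.2 x) = d.2 x := by simp [hx]
  rw [← h2] at h
  refine (h.comp _ h1).congr_of_eventuallyEq ?_
  have h3 := e.2.tendsto_symm hx (d.2.open_source.mem_nhds hxd)
  filter_upwards [h3] with v hv
  have hv' : e.2.symm v ∈ d.2.source := hv
  simp [hv']

theorem SmoothInto.congr {f g : M → E} {x : M} (hf : SmoothInto f x) (h : g =ᶠ[𝓝 x] f) :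
    SmoothInto g x := by
  obtain ⟨e, he, hx, hc⟩ := hf
  refine ⟨e, he, hx, hc.congr_of_eventuallyEq ?_⟩
  exact e.2.tendsto_symm hx h

theorem SmoothInto.continuousAt {f : M → E} {x : M} (hf : SmoothInto f x) : ContinuousAt f x := by
  obtain ⟨e, he, hx, hc⟩ := hf
  have h1 : ContinuousAt ((f ∘ e.2.symm) ∘ e.2) x :=
    ContinuousAt.comp hc.continuousAt (e.2.continuousAt hx)
  refine h1.congr ?_
  filter_upwards [e.2.open_source.mem_nhds hx] with y hy
  simp [hy]

theorem ContDiffAt.comp_smoothInto {h : E → F} {f : M → E} {x : M}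
    (hh : ContDiffAt ℝ ∞ h (f x)) (hf : SmoothInto f x) : SmoothInto (fun y => h (f y)) x := by
  obtain ⟨e, he, hx, hc⟩ := hf
  refine ⟨e, he, hx, ContDiffAt.comp (g := h) (f := f ∘ e.2.symm) (e.2 x) ?_ hc⟩
  simpa [hx] using hh

theorem SmoothInto.prodMk {f : M → E} {g : M → F} {x : M} (hf : SmoothInto f x)
    (hg : SmoothInto g x) : SmoothInto (fun y => (f y, g y)) x := by
  obtain ⟨e, he, hx, hc⟩ := hf
  exact ⟨e, he, hx, hc.prodMk ((smoothInto_iff he hx).1 hg)⟩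

theorem smoothInto_chart {e : Chart M} (he : e ∈ M.atlas) {x : M} (hx : x ∈ e.2.source) :
    SmoothInto e.2 x :=
  ⟨e, he, hx, M.contDiffAt_transition he he hx hx⟩

theorem SmoothFrom.chart_comp {γ : E → M} {v : E} (h : SmoothFrom γ v) {e : Chart M}
    (he : e ∈ M.atlas) (hx : γ v ∈ e.2.source) : ContDiffAt ℝ ∞ (e.2 ∘ γ) v := by
  obtain ⟨hc, d, hd, hxd, h⟩ := h
  have h1 := M.contDiffAt_transition hd he hxd hx
  refine (ContDiffAt.comp v h1 h).congr_of_eventuallyEq ?_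
  filter_upwards [hc (d.2.open_source.mem_nhds hxd)] with w hw
  have hw' : γ w ∈ d.2.source := hw
  simp [hw']

theorem SmoothInto.comp_smoothFrom {f : M → F} {γ : E → M} {v : E} (hf : SmoothInto f (γ v))
    (hγ : SmoothFrom γ v) : ContDiffAt ℝ ∞ (fun w => f (γ w)) v := by
  obtain ⟨e, he, hx, hc⟩ := hf
  refine (ContDiffAt.comp v hc (hγ.chart_comp he hx)).congr_of_eventuallyEq ?_
  filter_upwards [hγ.1 (e.2.open_source.mem_nhds hx)] with w hw
  have hw' : γ w ∈ e.2.source := hw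
  simp [hw']

theorem SmoothFrom.comp_contDiffAt {γ : F → M} {h : E → F} {v : E} (hγ : SmoothFrom γ (h v))
    (hh : ContDiffAt ℝ ∞ h v) : SmoothFrom (fun w => γ (h w)) v := by
  obtain ⟨hc, d, hd, hxd, h1⟩ := hγ
  exact ⟨hc.comp hh.continuousAt, d, hd, hxd, h1.comp v hh⟩

theorem SmoothFrom.comp_smoothInto {γ : E → N} {f : M → E} {x : M} (hγ : SmoothFrom γ (f x))
    (hf : SmoothInto f x) : SmoothAt (fun y => γ (f y)) x := by
  obtain ⟨hc, d, hd, hxd, h1⟩ := hγ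
  exact ⟨hc.comp hf.continuousAt, d, hd, hxd, ContDiffAt.comp_smoothInto (h := d.2 ∘ γ) h1 hf⟩

theorem smoothFrom_chart_symm {e : Chart M} (he : e ∈ M.atlas) {v : EuclideanSpace ℝ (Fin e.1)}
    (hv : v ∈ e.2.target) : SmoothFrom e.2.symm v := by
  refine ⟨e.2.continuousAt_symm hv, e, he, e.2.map_target hv, ?_⟩
  refine contDiffAt_id.congr_of_eventuallyEq ?_
  filter_upwards [e.2.open_target.mem_nhds hv] with w hw
  simp [hw]

theorem SmoothAt.chart_comp {f : M → N} {x : M} (h : SmoothAt f x) {e : Chart N}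
    (he : e ∈ N.atlas) (hx : f x ∈ e.2.source) : SmoothInto (e.2 ∘ f) x := by
  obtain ⟨hc, d, hd, hxd, h⟩ := h
  have h1 := N.contDiffAt_transition hd he hxd hx
  refine (ContDiffAt.comp_smoothInto (f := d.2 ∘ f) h1 h).congr ?_
  filter_upwards [hc (d.2.open_source.mem_nhds hxd)] with w hw
  have hw' : f w ∈ d.2.source := hw
  simp [hw']

theorem SmoothInto.comp_smoothAt {g : N → E} {f : M → N} {x : M} (hg : SmoothInto g (f x))
    (hf : SmoothAt f x) : SmoothInto (fun y => g (f y)) x := by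
  obtain ⟨e, he, hx, hc⟩ := hg
  refine (ContDiffAt.comp_smoothInto (h := g ∘ e.2.symm) (f := e.2 ∘ f) hc (hf.chart_comp he hx)).congr ?_
  filter_upwards [hf.1 (e.2.open_source.mem_nhds hx)] with w hw
  have hw' : f w ∈ e.2.source := hw
  simp [hw']

theorem SmoothAt.comp {g : N → P} {f : M → N} {x : M} (hg : SmoothAt g (f x))
    (hf : SmoothAt f x) : SmoothAt (fun y => g (f y)) x := by
  obtain ⟨hc, d, hd, hxd, h1⟩ := hg
  exact ⟨hc.comp hf.1, d, hd, hxd, h1.comp_smoothAt hf⟩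

theorem SmoothAt.comp_smoothFrom {g : M → N} {γ : E → M} {v : E} (hg : SmoothAt g (γ v))
    (hγ : SmoothFrom γ v) : SmoothFrom (fun w => g (γ w)) v := by
  obtain ⟨hc, d, hd, hxd, h1⟩ := hg
  exact ⟨hc.comp hγ.1, d, hd, hxd, h1.comp_smoothFrom hγ⟩

theorem SmoothAt.congr {f g : M → N} {x : M} (hf : SmoothAt f x) (h : g =ᶠ[𝓝 x] f) :
    SmoothAt g x := by
  obtain ⟨hc, d, hd, hxd, h1⟩ := hf
  refine ⟨hc.congr h.symm, d, hd, ?_, h1.congr ?_⟩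
  · rwa [h.eq_of_nhds]
  · filter_upwards [h] with y hy
    simp [hy]

theorem SmoothFrom.congr {f g : E → N} {x : E} (hf : SmoothFrom f x) (h : g =ᶠ[𝓝 x] f) :
    SmoothFrom g x := by
  obtain ⟨hc, d, hd, hxd, h1⟩ := hf
  refine ⟨hc.congr h.symm, d, hd, ?_, h1.congr_of_eventuallyEq ?_⟩
  · rwa [h.eq_of_nhds]
  · filter_upwards [h] with y hy
    simp [hy]

theorem isSmooth_iff_smoothAt {f : M → N} : IsSmooth f ↔ ∀ x, SmoothAt f x := by
  constructor
  · intro h x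
    obtain ⟨e, he, hx⟩ := M.exists_chart x
    obtain ⟨e', he', hx'⟩ := N.exists_chart (f x)
    exact ⟨h.continuous.continuousAt, e', he', hx', e, he, hx, h.contDiffAt e he e' he' x hx hx'⟩
  · intro h
    refine ⟨continuous_iff_continuousAt.2 fun x => (h x).1, fun e he e' he' x hx hx' => ?_⟩
    exact (smoothInto_iff he hx).1 ((h x).chart_comp he' hx')

theorem IsSmooth.smoothAt {f : M → N} (h : IsSmooth f) (x : M) : SmoothAt f x :=
  isSmooth_iff_smoothAt.1 h x

theorem isSmooth_const (y : N) : IsSmooth (fun _ : M => y) := by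
  refine isSmooth_iff_smoothAt.2 fun x => ⟨continuousAt_const, ?_⟩
  obtain ⟨e, he, hx⟩ := M.exists_chart x
  obtain ⟨e', he', hx'⟩ := N.exists_chart y
  exact ⟨e', he', hx', e, he, hx, contDiffAt_const⟩

end Pointwise

/-! ### Manifolds from local homeomorphisms -/

section OfLocalHomeos

variable (T : Type u) [TopologicalSpace T] {ι : Type*} (M : ι → SmoothManifold.{u})
  (φ : ∀ i, OpenPartialHomeomorph T (M i))

/-- The manifold structure on a space covered by the domains of local homeomorphisms to manifolds,
with smooth transition maps. -/
def SmoothManifold.ofLocalHomeos (hcover : ∀ x, ∃ i, x ∈ (φ i).source)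
    (htrans : ∀ i j x, x ∈ (φ i).source → x ∈ (φ j).source →
      SmoothAt (fun y => φ j ((φ i).symm y)) (φ i x)) : SmoothManifold.{u} where
  carrier := T
  atlas := {c | ∃ i, ∃ e ∈ (M i).atlas, c = ⟨e.1, (φ i).trans e.2⟩}
  exists_chart x := by
    obtain ⟨i, hi⟩ := hcover x
    obtain ⟨e, he, hx⟩ := (M i).exists_chart (φ i x)
    exact ⟨_, ⟨i, e, he, rfl⟩, by simp [hi, hx]⟩
  compatible := by
    rintro _ ⟨i, e, he, rfl⟩ _ ⟨j, e', he', rfl⟩ v hv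
    simp only [OpenPartialHomeomorph.trans_source, OpenPartialHomeomorph.symm_source,
      OpenPartialHomeomorph.trans_target, Set.mem_inter_iff, Set.mem_preimage,
      OpenPartialHomeomorph.coe_trans_symm, Function.comp_apply] at hv
    obtain ⟨⟨h1, h2⟩, h3, h4⟩ := hv
    have hx := (φ i).map_target h2
    have h := htrans i j _ hx h3
    rw [(φ i).right_inv h2] at h
    have h5 := (h.comp_smoothFrom (smoothFrom_chart_symm he h1)).chart_comp he' h4
    exact h5.contDiffWithinAt

variable {T M φ} (hcover : ∀ x, ∃ i, x ∈ (φ i).source)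
    (htrans : ∀ i j x, x ∈ (φ i).source → x ∈ (φ j).source →
      SmoothAt (fun y => φ j ((φ i).symm y)) (φ i x))

theorem SmoothManifold.ofLocalHomeos_smoothAt (i : ι) {x : T} (hx : x ∈ (φ i).source) :
    SmoothAt (M := SmoothManifold.ofLocalHomeos T M φ hcover htrans) (φ i) x := by
  obtain ⟨e, he, hxe⟩ := (M i).exists_chart (φ i x)
  refine ⟨(φ i).continuousAt hx, e, he, hxe, ⟨e.1, (φ i).trans e.2⟩, ⟨i, e, he, rfl⟩, ?_, ?_⟩
  · exact ⟨hx, hxe⟩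
  · refine contDiffAt_id.congr_of_eventuallyEq ?_
    have : ((φ i).trans e.2) x ∈ ((φ i).trans e.2).target :=
      ((φ i).trans e.2).map_source (by simp [hx, hxe])
    filter_upwards [((φ i).trans e.2).open_target.mem_nhds this] with v hv
    exact ((φ i).trans e.2).right_inv hv

theorem SmoothManifold.ofLocalHomeos_smoothAt_symm (i : ι) {y : M i} (hy : y ∈ (φ i).target) :
    SmoothAt (N := SmoothManifold.ofLocalHomeos T M φ hcover htrans) (φ i).symm y := by
  obtain ⟨e, he, hye⟩ := (M i).exists_chart y
  refine ⟨(φ i).continuousAt_symm hy, ⟨e.1, (φ i).trans e.2⟩, ⟨i, e, he, rfl⟩, ?_, ?_⟩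
  · refine ⟨(φ i).map_target hy, ?_⟩
    change φ i ((φ i).symm y) ∈ e.2.source
    rwa [(φ i).right_inv hy]
  · refine (smoothInto_chart he hye).congr ?_
    filter_upwards [(φ i).open_target.mem_nhds hy] with z hz
    exact congrArg e.2 ((φ i).right_inv hz)

end OfLocalHomeos

/-! ### Open submanifolds -/

section Restrict

open TopologicalSpace

variable {M N : SmoothManifold.{u}}

/-- The manifold structure on an open subset. -/
def SmoothManifold.restrict (M : SmoothManifold.{u}) (U : Opens M) : SmoothManifold.{u} :=
  SmoothManifold.ofLocalHomeos U (fun _ : U => M)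
    (fun x => U.openPartialHomeomorphSubtypeCoe ⟨x⟩)
    (fun x => ⟨x, Set.mem_univ _⟩)
    (fun i j x _ _ => by
      refine (IsSmooth.id M).smoothAt _ |>.congr ?_
      have : U.openPartialHomeomorphSubtypeCoe ⟨i⟩ x ∈ U := x.2
      filter_upwards [U.2.mem_nhds this] with y hy
      exact (U.openPartialHomeomorphSubtypeCoe ⟨i⟩).right_inv (by simpa using hy))

/-- The inclusion of an open submanifold. -/
def SmoothManifold.incl (M : SmoothManifold.{u}) (U : Opens M) : SmoothMap (M.restrict U) M :=
  ⟨Subtype.val, isSmooth_iff_smoothAt.2 fun x =>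
    SmoothManifold.ofLocalHomeos_smoothAt _ _ (φ := fun x => U.openPartialHomeomorphSubtypeCoe ⟨x⟩)
      x (Set.mem_univ _)⟩

/-- One direction composes with the inclusion of `U`, the other with its local inverse, which is
smooth into the open submanifold. -/
theorem smoothAt_restrict_iff {U : Opens M} {f : M → N} (x : U) :
    SmoothAt (M := M.restrict U) (fun y : U => f y) x ↔ SmoothAt f x := by
  refine ⟨fun h => ?_, fun h => SmoothAt.comp (g := f) h ((M.incl U).smooth.smoothAt x)⟩
  let φ := U.openPartialHomeomorphSubtypeCoe ⟨x⟩
  have hx : (x : M) ∈ φ.target := by simp [φ]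
  have h1 : SmoothAt (N := M.restrict U) φ.symm (x : M) :=
    SmoothManifold.ofLocalHomeos_smoothAt_symm _ _
      (φ := fun x => U.openPartialHomeomorphSubtypeCoe ⟨x⟩) x hx
  have h2 : φ.symm (x : M) = x := φ.left_inv (Set.mem_univ x)
  rw [← h2] at h
  refine (SmoothAt.comp h h1).congr ?_
  filter_upwards [φ.open_target.mem_nhds hx] with y hy
  exact congrArg f (φ.right_inv hy).symm

theorem smoothAt_codRestrict {U : Opens N} {f : M → N} {x : M} (hf : SmoothAt f x)
    (h : ∀ y, f y ∈ U) : SmoothAt (N := N.restrict U) (fun y => (⟨f y, h y⟩ : U)) x := by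
  let φ := U.openPartialHomeomorphSubtypeCoe ⟨⟨f x, h x⟩⟩
  have h1 : SmoothAt (N := N.restrict U) φ.symm (f x) :=
    SmoothManifold.ofLocalHomeos_smoothAt_symm _ _
      (φ := fun x => U.openPartialHomeomorphSubtypeCoe ⟨x⟩) ⟨f x, h x⟩ (by simp [h x])
  have h2 : (fun y => (⟨f y, h y⟩ : U)) = fun y => φ.symm (f y) := by
    ext y
    exact congrArg _ (φ.left_inv (Set.mem_univ (⟨f y, h y⟩ : U))).symm
  exact h2 ▸ SmoothAt.comp h1 hf

/-- A smooth map with values in an open subset, as a map to the open submanifold. -/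
def SmoothMap.codRestrict (f : SmoothMap M N) (U : Opens N) (h : ∀ y, f y ∈ U) :
    SmoothMap M (N.restrict U) :=
  ⟨fun y => ⟨f y, h y⟩, isSmooth_iff_smoothAt.2 fun x => smoothAt_codRestrict (f.smooth.smoothAt x) h⟩

/-- Smoothness is local. -/
theorem IsSmooth.of_local {f : M → N}
    (h : ∀ x, ∃ U : Opens M, x ∈ U ∧ IsSmooth (M := M.restrict U) (fun y : U => f y)) :
    IsSmooth f := by
  refine isSmooth_iff_smoothAt.2 fun x => ?_
  obtain ⟨U, hx, hU⟩ := h x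
  exact (smoothAt_restrict_iff ⟨x, hx⟩).1 (hU.smoothAt ⟨x, hx⟩)

/-- The preimage of an open subset under a smooth map. -/
def SmoothMap.preimage (f : SmoothMap M N) (U : Opens N) : Opens M :=
  ⟨f.toFun ⁻¹' U, U.2.preimage f.smooth.continuous⟩

@[simp]
theorem SmoothMap.mem_preimage {f : SmoothMap M N} {U : Opens N} {x : M} :
    x ∈ f.preimage U ↔ f x ∈ U := Iff.rfl

/-- The composition of smooth maps. -/
def SmoothMap.comp {P : SmoothManifold.{u}} (g : SmoothMap N P) (f : SmoothMap M N) :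
    SmoothMap M P := ⟨fun x => g (f x), g.smooth.comp f.smooth⟩

@[simp]
theorem SmoothMap.comp_apply {P : SmoothManifold.{u}} (g : SmoothMap N P) (f : SmoothMap M N)
    (x : M) : g.comp f x = g (f x) := rfl

/-- The identity map. -/
def SmoothMap.id (M : SmoothManifold.{u}) : SmoothMap M M := ⟨fun x => x, IsSmooth.id M⟩

/-- The restriction of a smooth map to the preimage of an open subset. -/
def SmoothMap.restrictPreimage (f : SmoothMap M N) (U : Opens N) :
    SmoothMap (M.restrict (f.preimage U)) (N.restrict U) :=
  (f.comp (M.incl _)).codRestrict U fun y => y.2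

end Restrict

end

section

open TopologicalSpace Filter Topology

variable {M N W : SmoothManifold.{u}}

/-! ### Submersions and local sections -/

/-- Coordinates in which a map is a projection. -/
structure SubmersionChart (f : M → N) where
  chart : Chart N
  chart_mem : chart ∈ N.atlas
  dim : ℕ
  homeo : OpenPartialHomeomorph M (EuclideanSpace ℝ (Fin chart.1) × EuclideanSpace ℝ (Fin dim))
  mem_source : ∀ y ∈ homeo.source, f y ∈ chart.2.source
  homeo_fst : ∀ y ∈ homeo.source, (homeo y).1 = chart.2 (f y)
  smoothInto : ∀ y ∈ homeo.source, SmoothInto homeo y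
  smoothFrom : ∀ z ∈ homeo.target, SmoothFrom homeo.symm z

/-- Surjectivity is assumed at a single point, in one pair of charts. This generality matters for
the translation map of a torsor, which is not known in advance to be a submersion. -/
theorem SubmersionChart.exists_of_surjective {f : M → N} (hf : IsSmooth f) {m : M} {e : Chart M}
    (he : e ∈ M.atlas) {e' : Chart N} (he' : e' ∈ N.atlas) (hm : m ∈ e.2.source)
    (hm' : f m ∈ e'.2.source) (hs : Function.Surjective (fderiv ℝ (coordExpr f e e') (e.2 m))) :
    ∃ c : SubmersionChart f, m ∈ c.homeo.source := by
  let U := e.2.target ∩ e.2.symm ⁻¹' (f ⁻¹' e'.2.source)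
  have hU : IsOpen U :=
    e.2.isOpen_inter_preimage_symm (e'.2.open_source.preimage hf.continuous)
  have hfU : ∀ y ∈ U, ContDiffAt ℝ ∞ (coordExpr f e e') y := by
    intro y hy
    have := hf.contDiffAt e he e' he' (e.2.symm y) (e.2.map_target hy.1) hy.2
    rwa [e.2.right_inv hy.1] at this
  obtain ⟨k, -, κ, Φ, hx, hΦU, hΦ, hΦs⟩ := exists_submersion_normal_form hU hfU
    (x := e.2 m) ⟨e.2.map_source hm, by simpa [hm] using hm'⟩ hs
  refine ⟨⟨e', he', k, e.2.trans Φ, ?_, ?_, ?_, ?_⟩, ?_⟩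
  · rintro y ⟨hy, hy'⟩
    have := (hΦU hy').2
    simpa [show y ∈ e.2.source from hy] using this
  · rintro y ⟨hy, hy'⟩
    change (Φ (e.2 y)).1 = _
    rw [hΦ]
    simp [coordExpr, show y ∈ e.2.source from hy]
  · rintro y ⟨hy, hy'⟩
    refine ContDiffAt.comp_smoothInto (h := Φ) (f := e.2) ?_ (smoothInto_chart he hy)
    have : (Φ : EuclideanSpace ℝ (Fin e.1) → _) = fun y => (coordExpr f e e' y, κ y) := funext hΦ
    rw [this]
    exact (hfU _ (hΦU hy')).prodMk κ.contDiff.contDiffAt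
  · rintro z ⟨hz, hz'⟩
    exact SmoothFrom.comp_contDiffAt (γ := e.2.symm) (h := Φ.symm)
      (smoothFrom_chart_symm he hz') (hΦs z hz)
  · exact ⟨hm, hx⟩

theorem SubmersionChart.apply_symm {f : M → N} (c : SubmersionChart f) {y : N}
    {v : EuclideanSpace ℝ (Fin c.dim)} (hy : y ∈ c.chart.2.source)
    (hv : (c.chart.2 y, v) ∈ c.homeo.target) : f (c.homeo.symm (c.chart.2 y, v)) = y := by
  have h1 := c.homeo.map_target hv
  refine c.chart.2.injOn (c.mem_source _ h1) hy ?_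
  rw [← c.homeo_fst _ h1, c.homeo.right_inv hv]

/-- In the coordinates of the chart, the section keeps the fiber coordinate constant, equal to its
value at `m`. -/
theorem SubmersionChart.exists_section {f : M → N} (c : SubmersionChart f) {m : M}
    (hm : m ∈ c.homeo.source) :
    ∃ (U : Opens N) (σ : SmoothMap (N.restrict U) M) (h : f m ∈ U), σ.toFun ⟨f m, h⟩ = m ∧
      ∀ y : U, f (σ.toFun y) = y := by
  let U : Opens N := ⟨c.chart.2.source ∩ c.chart.2 ⁻¹' {u | (u, (c.homeo m).2) ∈ c.homeo.target},
    c.chart.2.isOpen_inter_preimage (c.homeo.open_target.preimage (by fun_prop))⟩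
  have hval : (c.chart.2 (f m), (c.homeo m).2) = c.homeo m :=
    Prod.ext (c.homeo_fst m hm).symm rfl
  have hU : f m ∈ U := by
    refine ⟨c.mem_source m hm, ?_⟩
    change (_, _) ∈ c.homeo.target
    rw [hval]
    exact c.homeo.map_source hm
  refine ⟨U, ⟨fun y => c.homeo.symm (c.chart.2 (y : U).1, (c.homeo m).2), ?_⟩, hU, ?_, ?_⟩
  · refine isSmooth_iff_smoothAt.2 fun y => (smoothAt_restrict_iff
      (f := fun y => c.homeo.symm (c.chart.2 y, (c.homeo m).2)) y).2 ?_
    refine SmoothFrom.comp_smoothInto (γ := c.homeo.symm)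
      (f := fun y => (c.chart.2 y, (c.homeo m).2)) (c.smoothFrom _ y.2.2) ?_
    have h1 := smoothInto_chart c.chart_mem y.2.1
    exact ContDiffAt.comp_smoothInto (h := fun v => (v, (c.homeo m).2)) (by fun_prop) h1
  · change c.homeo.symm (c.chart.2 (f m), (c.homeo m).2) = m
    rw [hval, c.homeo.left_inv hm]
  · intro y
    exact c.apply_symm y.2.1 y.2.2

theorem IsSubmersion.exists_chart {f : M → N} (hf : IsSubmersion f) (m : M) :
    ∃ c : SubmersionChart f, m ∈ c.homeo.source := by
  obtain ⟨e, he, hx⟩ := M.exists_chart m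
  obtain ⟨e', he', hx'⟩ := N.exists_chart (f m)
  exact SubmersionChart.exists_of_surjective hf.toIsSmooth he he' hx hx'
    (hf.surjective_fderiv e he e' he' m hx hx')

theorem IsSubmersion.exists_section {f : M → N} (hf : IsSubmersion f) (m : M) :
    ∃ (U : Opens N) (σ : SmoothMap (N.restrict U) M) (h : f m ∈ U), σ.toFun ⟨f m, h⟩ = m ∧
      ∀ y : U, f (σ.toFun y) = y := by
  obtain ⟨c, hc⟩ := hf.exists_chart m
  exact c.exists_section hc

/-- A smooth map with local sections through all points is a submersion. -/
theorem IsSubmersion.of_section {f : M → N} (hf : IsSmooth f)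
    (h : ∀ m, ∃ (U : Opens N) (σ : SmoothMap (N.restrict U) M) (h : f m ∈ U),
      σ.toFun ⟨f m, h⟩ = m ∧ ∀ y : U, f (σ.toFun y) = y) : IsSubmersion f where
  toIsSmooth := hf
  surjective_fderiv e he e' he' m hm hm' := by
    classical
    obtain ⟨U, σ, hU, hσm, hσ⟩ := h m
    -- The value `m` outside `U` is a default; it only turns the section into a function on all of
    -- `N`, so that its coordinate expression can be differentiated.
    let s : N → M := fun y => if h : y ∈ U then σ.toFun ⟨y, h⟩ else m
    have hs : SmoothAt s (f m) := by
      refine (smoothAt_restrict_iff (f := s) ⟨f m, hU⟩).1 ?_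
      have : (fun y : U => s y) = σ.toFun := by
        ext y
        exact dif_pos y.2
      rw [this]
      exact σ.smooth.smoothAt _
    have hsm : s (f m) = m := by simp [s, hU, hσm]
    have hfs : ∀ y ∈ U, f (s y) = y := fun y hy => by simp only [s, hy, dif_pos]; exact hσ ⟨y, hy⟩
    have hv : e'.2.symm (e'.2 (f m)) = f m := e'.2.left_inv hm'
    have h1 : SmoothFrom (fun v => s (e'.2.symm v)) (e'.2 (f m)) :=
      SmoothAt.comp_smoothFrom (by rwa [hv]) (smoothFrom_chart_symm he' (e'.2.map_source hm'))
    have h2 : ContDiffAt ℝ ∞ (e.2 ∘ fun v => s (e'.2.symm v)) (e'.2 (f m)) :=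
      h1.chart_comp he (by simpa [hv, hsm] using hm)
    have h2m : (e.2 ∘ fun v => s (e'.2.symm v)) (e'.2 (f m)) = e.2 m := by
      simp only [Function.comp_apply, hv, hsm]
    have h3 := (hf.contDiffAt e he e' he' m hm hm').differentiableAt (by simp) |>.hasFDerivAt
    rw [← h2m] at h3 ⊢
    have h4 := h3.comp _ (h2.differentiableAt (by simp)).hasFDerivAt
    -- In coordinates the section is a right inverse near the point, so by the chain rule the
    -- derivative of `f` has a right inverse.
    have h5 : HasFDerivAt (coordExpr f e e' ∘ (e.2 ∘ fun v => s (e'.2.symm v)))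
        (ContinuousLinearMap.id ℝ _) (e'.2 (f m)) := by
      refine (hasFDerivAt_id _).congr_of_eventuallyEq ?_
      have h6 : ∀ᶠ v in 𝓝 (e'.2 (f m)), s (e'.2.symm v) ∈ e.2.source :=
        h1.1 (e.2.open_source.mem_nhds (by change s _ ∈ _; rwa [hv, hsm]))
      have h7 : ∀ᶠ v in 𝓝 (e'.2 (f m)), e'.2.symm v ∈ U :=
        e'.2.tendsto_symm hm' (U.2.mem_nhds hU)
      filter_upwards [h6, h7, e'.2.open_target.mem_nhds (e'.2.map_source hm')] with v h6 h7 h8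
      simp [coordExpr, h6, hfs _ h7, h8]
    intro v
    exact ⟨_, DFunLike.congr_fun (h4.unique h5) v⟩

/-- Local lifts along a submersion. -/
theorem IsSubmersion.exists_lift {f : M → N} (hf : IsSubmersion f) (a : SmoothMap W N) (w : W)
    (m : M) (hm : f m = a w) :
    ∃ (U : Opens W) (σ : SmoothMap (W.restrict U) M) (h : w ∈ U), σ.toFun ⟨w, h⟩ = m ∧
      ∀ y : U, f (σ.toFun y) = a y := by
  obtain ⟨U, σ, hU, hσm, hσ⟩ := hf.exists_section m
  refine ⟨a.preimage U, σ.comp (a.restrictPreimage U), by simpa [← hm] using hU, ?_, ?_⟩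
  · exact (congrArg σ.toFun (Subtype.ext hm.symm)).trans hσm
  · intro y
    exact hσ ⟨a y, y.2⟩

theorem IsSubmersion.of_lift {f : M → N} (hf : IsSmooth f)
    (h : ∀ m (W : SmoothManifold.{u}) (a : SmoothMap W N) (w : W), f m = a w →
      ∃ (U : Opens W) (σ : SmoothMap (W.restrict U) M) (h : w ∈ U),
      σ.toFun ⟨w, h⟩ = m ∧ ∀ y : U, f (σ.toFun y) = a y) : IsSubmersion f :=
  .of_section hf fun m => h m N (SmoothMap.id N) (f m) rfl

/-- Local lifts characterize submersions, and a family is lifted first along `g`, then along `f`. -/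
theorem IsSubmersion.comp {P : SmoothManifold.{u}} {g : N → P} {f : M → N} (hg : IsSubmersion g)
    (hf : IsSubmersion f) : IsSubmersion (fun x => g (f x)) := by
  refine .of_lift (hg.toIsSmooth.comp hf.toIsSmooth) fun m W a w hw => ?_
  obtain ⟨U, σ, hU, hσm, hσ⟩ := hg.exists_lift a w (f m) hw
  obtain ⟨V, τ, hV, hτm, hτ⟩ := hf.exists_lift σ ⟨w, hU⟩ m hσm.symm
  -- The second lift lives on an open subset of the open submanifold `U`; this is the same set
  -- inside `W`.
  let V' : Opens W := ⟨(W.incl U).toFun '' V, U.2.isOpenMap_subtype_val _ V.2⟩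
  have hV' : ∀ y : V', (y : W) ∈ U := by rintro ⟨_, ⟨z, hz, rfl⟩⟩; exact z.2
  have hV'' : ∀ y : V', (⟨y, hV' y⟩ : U) ∈ V := by rintro ⟨_, ⟨z, hz, rfl⟩⟩; exact hz
  let ρ : SmoothMap (W.restrict V') ((W.restrict U).restrict V) :=
    ((W.incl V').codRestrict U hV').codRestrict V hV''
  refine ⟨V', τ.comp ρ, ⟨_, hV, rfl⟩, hτm, fun y => ?_⟩
  change g (f (τ.toFun ⟨⟨y, _⟩, _⟩)) = _
  rw [hτ ⟨⟨y, _⟩, hV'' y⟩, hσ]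

end

section

open TopologicalSpace Filter Topology

/-! ### Fiber products along submersions -/

section FiberProd

variable {M M' N : SmoothManifold.{u}} (f : SmoothMap M N) (g : SmoothMap M' N)

/-- The set-theoretic fiber product. -/
abbrev FiberSet : Type u := {p : M × M' // f p.1 = g p.2}

variable {f g}

open Classical in
/-- The coordinates on a fiber product given by coordinates of the first factor along the first map
and coordinates of the second factor. -/
def fiberHomeo (c : SubmersionChart f.toFun) (d : Chart M') (t : FiberSet f g) :
    OpenPartialHomeomorph (FiberSet f g)
      (EuclideanSpace ℝ (Fin d.1) × EuclideanSpace ℝ (Fin c.dim)) where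
  toFun p := (d.2 p.1.2, (c.homeo p.1.1).2)
  invFun w :=
    -- The condition holds on the target, by `SubmersionChart.apply_symm`; elsewhere `t` is a
    -- default value.
    if h : f (c.homeo.symm (c.chart.2 (g (d.2.symm w.1)), w.2)) = g (d.2.symm w.1) then
      ⟨(c.homeo.symm (c.chart.2 (g (d.2.symm w.1)), w.2), d.2.symm w.1), h⟩ else t
  source := {p | p.1.1 ∈ c.homeo.source ∧ p.1.2 ∈ d.2.source}
  target := {w | (w.1 ∈ d.2.target ∧ g (d.2.symm w.1) ∈ c.chart.2.source) ∧
    (c.chart.2 (g (d.2.symm w.1)), w.2) ∈ c.homeo.target}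
  map_source' := by
    rintro ⟨⟨x, y⟩, hxy⟩ ⟨hx, hy⟩
    simp only at hx hy hxy
    have h1 : c.chart.2 (g y) = (c.homeo x).1 := by rw [c.homeo_fst x hx, hxy]
    refine ⟨⟨d.2.map_source hy, ?_⟩, ?_⟩
    · simp only [hy, OpenPartialHomeomorph.left_inv]
      rw [← hxy]; exact c.mem_source x hx
    · simp only [hy, OpenPartialHomeomorph.left_inv, h1]
      exact c.homeo.map_source hx
  map_target' := by
    rintro ⟨u, v⟩ ⟨⟨h1, h2⟩, h3⟩
    simp only at h1 h2 h3 ⊢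
    rw [dif_pos (c.apply_symm h2 h3)]
    exact ⟨c.homeo.map_target h3, d.2.map_target h1⟩
  left_inv' := by
    rintro ⟨⟨x, y⟩, hxy⟩ ⟨hx, hy⟩
    simp only at hx hy hxy
    have h1 : c.chart.2 (g y) = (c.homeo x).1 := by rw [c.homeo_fst x hx, hxy]
    have h2 : c.homeo.symm (c.chart.2 (g y), (c.homeo x).2) = x := by
      rw [h1]; exact c.homeo.left_inv hx
    simp only [hy, OpenPartialHomeomorph.left_inv, h2]
    rw [dif_pos hxy]
  right_inv' := by
    rintro ⟨u, v⟩ ⟨⟨h1, h2⟩, h3⟩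
    simp only at h1 h2 h3 ⊢
    rw [dif_pos (c.apply_symm h2 h3)]
    simp [h1, c.homeo.right_inv h3]
  open_source := (c.homeo.open_source.preimage (by fun_prop)).inter
    (d.2.open_source.preimage (by fun_prop))
  open_target := by
    have h1 : IsOpen (d.2.target ∩ d.2.symm ⁻¹' (g.toFun ⁻¹' c.chart.2.source)) :=
      d.2.isOpen_inter_preimage_symm (c.chart.2.open_source.preimage g.smooth.continuous)
    refine ContinuousOn.isOpen_inter_preimage (f := fun w : EuclideanSpace ℝ (Fin d.1) ×
      EuclideanSpace ℝ (Fin c.dim) => (c.chart.2 (g (d.2.symm w.1)), w.2)) ?_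
      (h1.preimage continuous_fst) c.homeo.open_target
    refine ContinuousOn.prodMk ?_ continuous_snd.continuousOn
    refine c.chart.2.continuousOn.comp (t := c.chart.2.source) ?_ (fun w hw => hw.2)
    refine g.smooth.continuous.comp_continuousOn ?_
    exact d.2.symm.continuousOn.comp continuous_fst.continuousOn (fun w hw => hw.1)
  continuousOn_toFun := by
    refine ContinuousOn.prodMk ?_ ?_
    · exact d.2.continuousOn.comp (by fun_prop) (fun p hp => hp.2)
    · exact continuous_snd.comp_continuousOn
        (c.homeo.continuousOn.comp (by fun_prop) (fun p hp => hp.1))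
  continuousOn_invFun := by
    refine (Topology.IsInducing.subtypeVal
      (t := {p : M × M' | f p.1 = g p.2})).continuousOn_iff.2 ?_
    have h1 : ContinuousOn (fun w : EuclideanSpace ℝ (Fin d.1) × EuclideanSpace ℝ (Fin c.dim) =>
        (c.homeo.symm (c.chart.2 (g (d.2.symm w.1)), w.2), d.2.symm w.1))
        {w | (w.1 ∈ d.2.target ∧ g (d.2.symm w.1) ∈ c.chart.2.source) ∧
          (c.chart.2 (g (d.2.symm w.1)), w.2) ∈ c.homeo.target} := by
      have h2 : ContinuousOn (fun w : EuclideanSpace ℝ (Fin d.1) × EuclideanSpace ℝ (Fin c.dim) =>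
        d.2.symm w.1) {w | (w.1 ∈ d.2.target ∧ g (d.2.symm w.1) ∈ c.chart.2.source) ∧
          (c.chart.2 (g (d.2.symm w.1)), w.2) ∈ c.homeo.target} :=
        d.2.symm.continuousOn.comp continuous_fst.continuousOn (fun w hw => hw.1.1)
      refine ContinuousOn.prodMk ?_ h2
      refine c.homeo.symm.continuousOn.comp (t := c.homeo.target) ?_ (fun w hw => hw.2)
      refine ContinuousOn.prodMk ?_ continuous_snd.continuousOn
      exact c.chart.2.continuousOn.comp (t := c.chart.2.source)
        (g.smooth.continuous.comp_continuousOn h2) (fun w hw => hw.1.2)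
    refine h1.congr fun w hw => ?_
    simp only [Function.comp_apply]
    rw [dif_pos (c.apply_symm hw.1.2 hw.2)]

theorem fiberHomeo_symm_val (c : SubmersionChart f.toFun) (d : Chart M') (t : FiberSet f g)
    {w : EuclideanSpace ℝ (Fin d.1) × EuclideanSpace ℝ (Fin c.dim)}
    (hw : w ∈ (fiberHomeo c d t).target) : ((fiberHomeo c d t).symm w).1 =
      (c.homeo.symm (c.chart.2 (g (d.2.symm w.1)), w.2), d.2.symm w.1) := by
  exact congrArg Subtype.val (dif_pos (c.apply_symm hw.1.2 hw.2))

theorem fiberHomeo_symm_smooth (c : SubmersionChart f.toFun) {d : Chart M'} (hd : d ∈ M'.atlas)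
    (t : FiberSet f g) {w : EuclideanSpace ℝ (Fin d.1) × EuclideanSpace ℝ (Fin c.dim)}
    (hw : w ∈ (fiberHomeo c d t).target) :
    SmoothFrom (fun w => ((fiberHomeo c d t).symm w).1.1) w ∧
      SmoothFrom (fun w => ((fiberHomeo c d t).symm w).1.2) w := by
  have hev := (fiberHomeo c d t).open_target.mem_nhds hw
  have h2 : SmoothFrom (fun w : EuclideanSpace ℝ (Fin d.1) × EuclideanSpace ℝ (Fin c.dim) =>
      d.2.symm w.1) w :=
    SmoothFrom.comp_contDiffAt (h := Prod.fst) (smoothFrom_chart_symm hd hw.1.1) contDiffAt_fst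
  constructor
  · refine SmoothFrom.congr (f := fun w => c.homeo.symm (c.chart.2 (g (d.2.symm w.1)), w.2)) ?_ ?_
    · refine SmoothFrom.comp_contDiffAt
        (h := fun w : EuclideanSpace ℝ (Fin d.1) × EuclideanSpace ℝ (Fin c.dim) =>
          (c.chart.2 (g (d.2.symm w.1)), w.2)) (c.smoothFrom _ hw.2) ?_
      refine ContDiffAt.prodMk ?_ contDiffAt_snd
      exact SmoothInto.comp_smoothFrom (f := fun y => c.chart.2 (g y))
        ((g.smooth.smoothAt _).chart_comp c.chart_mem hw.1.2) h2
    · filter_upwards [hev] with w hw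
      rw [fiberHomeo_symm_val c d t hw]
  · refine h2.congr ?_
    filter_upwards [hev] with w hw
    rw [fiberHomeo_symm_val c d t hw]

variable (f g)

/-- The chart of a fiber product with coordinates `fiberHomeo`. -/
def fiberChart {f : SmoothMap M N} {g : SmoothMap M' N} (c : SubmersionChart f.toFun)
    (d : Chart M') (t : FiberSet f g) : Chart (FiberSet f g) :=
  ⟨d.1 + c.dim, (fiberHomeo c d t).transHomeomorph
    EuclideanSpace.finAddEquivProd.symm.toHomeomorph⟩

/-- The fiber product of manifolds along a submersion. -/
def fiberProd (hf : IsSubmersion f.toFun) : SmoothManifold.{u} where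
  carrier := FiberSet f g
  atlas := {e | ∃ (c : SubmersionChart f.toFun) (d : Chart M') (_ : d ∈ M'.atlas)
    (t : FiberSet f g), e = fiberChart c d t}
  exists_chart x := by
    obtain ⟨c, hc⟩ := hf.exists_chart x.1.1
    obtain ⟨d, hd, hxd⟩ := M'.exists_chart x.1.2
    exact ⟨_, ⟨c, d, hd, x, rfl⟩, hc, hxd⟩
  compatible := by
    rintro _ ⟨c, d, hd, t, rfl⟩ _ ⟨c', d', hd', t', rfl⟩ v ⟨hv, hv'⟩
    refine ContDiffAt.contDiffWithinAt ?_
    have hw : EuclideanSpace.finAddEquivProd v ∈ (fiberHomeo c d t).target := hv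
    have hw' : (fiberHomeo c d t).symm (EuclideanSpace.finAddEquivProd v) ∈
      (fiberHomeo c' d' t').source := hv'
    refine ContDiffAt.comp (g := fun w => EuclideanSpace.finAddEquivProd.symm
      (fiberHomeo c' d' t' ((fiberHomeo c d t).symm w)))
      (f := EuclideanSpace.finAddEquivProd) v ?_ (by fun_prop)
    refine ContDiffAt.comp (g := EuclideanSpace.finAddEquivProd.symm) _
      (ContinuousLinearEquiv.contDiff _).contDiffAt ?_
    obtain ⟨h1, h2⟩ := fiberHomeo_symm_smooth c hd t hw
    refine ContDiffAt.prodMk ?_ ?_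
    · exact SmoothInto.comp_smoothFrom (smoothInto_chart hd' hw'.2) h2
    · exact contDiffAt_snd.comp _
        (SmoothInto.comp_smoothFrom (c'.smoothInto _ hw'.1) h1)

variable {f g} (hf : IsSubmersion f.toFun)

theorem smoothInto_fiberHomeo (c : SubmersionChart f.toFun) {d : Chart M'} (hd : d ∈ M'.atlas)
    (t : FiberSet f g) {x : FiberSet f g} (hx : x ∈ (fiberHomeo c d t).source) :
    SmoothInto (M := fiberProd f g hf) (fiberHomeo c d t) x := by
  have h1 : SmoothInto (M := fiberProd f g hf) (fiberChart c d t).2 x :=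
    smoothInto_chart (M := fiberProd f g hf) ⟨c, d, hd, t, rfl⟩ hx
  refine (ContDiffAt.comp_smoothInto (h := EuclideanSpace.finAddEquivProd)
    (ContinuousLinearEquiv.contDiff _).contDiffAt h1).congr (Eventually.of_forall fun y => ?_)
  exact (EuclideanSpace.finAddEquivProd.apply_symm_apply _).symm

theorem smoothFrom_fiberHomeo_symm (c : SubmersionChart f.toFun) {d : Chart M'}
    (hd : d ∈ M'.atlas) (t : FiberSet f g)
    {w : EuclideanSpace ℝ (Fin d.1) × EuclideanSpace ℝ (Fin c.dim)}
    (hw : w ∈ (fiberHomeo c d t).target) :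
    SmoothFrom (M := fiberProd f g hf) (fiberHomeo c d t).symm w := by
  have h1 : SmoothFrom (M := fiberProd f g hf) (fiberChart c d t).2.symm
      (EuclideanSpace.finAddEquivProd.symm w) := by
    refine smoothFrom_chart_symm (M := fiberProd f g hf) ⟨c, d, hd, t, rfl⟩ ?_
    change EuclideanSpace.finAddEquivProd (EuclideanSpace.finAddEquivProd.symm w) ∈
      (fiberHomeo c d t).target
    rwa [ContinuousLinearEquiv.apply_symm_apply]
  refine (SmoothFrom.comp_contDiffAt h1
    (ContinuousLinearEquiv.contDiff _).contDiffAt).congr (Eventually.of_forall fun y => ?_)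
  exact congrArg (fiberHomeo c d t).symm (EuclideanSpace.finAddEquivProd.apply_symm_apply y).symm

theorem smoothAt_fiberProd_fst_snd (x : FiberSet f g) :
    SmoothAt (M := fiberProd f g hf) (fun p : FiberSet f g => p.1.1) x ∧
      SmoothAt (M := fiberProd f g hf) (fun p : FiberSet f g => p.1.2) x := by
  obtain ⟨c, hc⟩ := hf.exists_chart x.1.1
  obtain ⟨d, hd, hxd⟩ := M'.exists_chart x.1.2
  have hx : x ∈ (fiberHomeo c d x).source := ⟨hc, hxd⟩
  obtain ⟨h1, h2⟩ := fiberHomeo_symm_smooth c hd x ((fiberHomeo c d x).map_source hx)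
  have h3 := smoothInto_fiberHomeo hf c hd x hx
  have hev : ∀ᶠ y in 𝓝 x, (fiberHomeo c d x).symm (fiberHomeo c d x y) = y := by
    filter_upwards [(fiberHomeo c d x).open_source.mem_nhds hx] with y hy
    exact (fiberHomeo c d x).left_inv hy
  constructor
  · refine (SmoothFrom.comp_smoothInto (M := fiberProd f g hf) h1 h3).congr ?_
    filter_upwards [hev] with y hy
    rw [hy]
  · refine (SmoothFrom.comp_smoothInto (M := fiberProd f g hf) h2 h3).congr ?_
    filter_upwards [hev] with y hy
    rw [hy]

/-- The first projection of a fiber product. -/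
def fiberProd.fst : SmoothMap (fiberProd f g hf) M :=
  ⟨fun p => p.1.1, isSmooth_iff_smoothAt.2 fun x => (smoothAt_fiberProd_fst_snd hf x).1⟩

/-- The second projection of a fiber product. -/
def fiberProd.snd : SmoothMap (fiberProd f g hf) M' :=
  ⟨fun p => p.1.2, isSmooth_iff_smoothAt.2 fun x => (smoothAt_fiberProd_fst_snd hf x).2⟩

theorem fiberProd.condition (p : fiberProd f g hf) :
    f (fiberProd.fst hf p) = g (fiberProd.snd hf p) := p.2

/-- The point of a fiber product with given components. -/
def fiberProd.mk (x : M) (y : M') (h : f x = g y) : fiberProd f g hf := ⟨(x, y), h⟩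

theorem fiberProd.ext {p q : fiberProd f g hf} (h1 : fiberProd.fst hf p = fiberProd.fst hf q)
    (h2 : fiberProd.snd hf p = fiberProd.snd hf q) : p = q :=
  Subtype.ext (Prod.ext h1 h2)

/-- The universal property of the fiber product. -/
def fiberProd.lift {W : SmoothManifold.{u}} (a : SmoothMap W M) (b : SmoothMap W M')
    (h : ∀ w, f (a w) = g (b w)) : SmoothMap W (fiberProd f g hf) :=
  ⟨fun w => fiberProd.mk hf (a w) (b w) (h w), by
    refine isSmooth_iff_smoothAt.2 fun w => ⟨?_, ?_⟩
    · exact (Continuous.subtype_mk (a.smooth.continuous.prodMk b.smooth.continuous)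
        h).continuousAt
    · obtain ⟨c, hc⟩ := hf.exists_chart (a w)
      obtain ⟨d, hd, hxd⟩ := M'.exists_chart (b w)
      refine ⟨fiberChart c d ⟨(a w, b w), h w⟩, ⟨c, d, hd, _, rfl⟩, ⟨hc, hxd⟩, ?_⟩
      refine ContDiffAt.comp_smoothInto (h := EuclideanSpace.finAddEquivProd.symm)
        (f := fun w => (d.2 (b w), (c.homeo (a w)).2))
        (ContinuousLinearEquiv.contDiff _).contDiffAt ?_
      refine ((b.smooth.smoothAt w).chart_comp hd hxd).prodMk ?_
      exact ContDiffAt.comp_smoothInto contDiffAt_snd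
        ((c.smoothInto _ hc).comp_smoothAt (a.smooth.smoothAt w))⟩

/-- Submersions are stable under base change: a local lift of `g ∘ a` along `f`, paired with `a`, is
a local lift of `a` to the fiber product. -/
theorem fiberProd.isSubmersion_snd : IsSubmersion (fiberProd.snd (g := g) hf).toFun := by
  refine .of_lift (fiberProd.snd hf).smooth fun m W a w hw => ?_
  obtain ⟨U, σ, hU, hσm, hσ⟩ := hf.exists_lift (g.comp a) w (fiberProd.fst hf m) (by
    rw [fiberProd.condition, SmoothMap.comp_apply]; exact congrArg g.toFun hw)
  refine ⟨U, fiberProd.lift hf σ (a.comp (W.incl U)) hσ, hU, ?_, fun y => rfl⟩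
  exact fiberProd.ext hf hσm hw.symm

end FiberProd

/-! ### Gluing -/

section Glue

variable (E : Type u) {ι : Type*} (V : ι → SmoothManifold.{u}) (c : ∀ i, V i → E)

/-- Data for gluing manifolds along smooth identifications of open subsets. -/
structure GlueData : Prop where
  injective : ∀ i, Function.Injective (c i)
  surjective : ∀ x, ∃ i v, c i v = x
  transition : ∀ i j v v', c i v = c j v' →
    ∃ (U : Opens (V i)) (h : SmoothMap ((V i).restrict U) (V j)), v ∈ U ∧
      ∀ u : U, c j (h.toFun u) = c i u

variable {E V}

/-- The topology on a glued space. -/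
@[reducible]
def glueTopology : TopologicalSpace E := ⨆ i, TopologicalSpace.coinduced (c i) inferInstance

variable {c}

theorem glueTopology_isOpen_iff {s : Set E} :
    IsOpen[glueTopology c] s ↔ ∀ i, IsOpen (c i ⁻¹' s) := by
  rw [glueTopology, isOpen_iSup_iff]
  rfl

variable (G : GlueData E V c)

/-- Openness is tested in each piece. Near a point shared with piece `i`, the transition map is
continuous, and the preimage under it of an open set of piece `i` is a neighborhood with the same
image in `E`. -/
theorem GlueData.isOpenEmbedding (G : GlueData E V c) (i : ι) :
    letI := glueTopology c; Topology.IsOpenEmbedding (c i) := by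
  let _ := glueTopology c
  refine Topology.IsOpenEmbedding.of_continuous_injective_isOpenMap ?_ (G.injective i) ?_
  · exact continuous_def.2 fun s hs => glueTopology_isOpen_iff.1 hs i
  · intro s hs
    refine glueTopology_isOpen_iff.2 fun j => isOpen_iff_mem_nhds.2 ?_
    rintro v ⟨v', hv', hvv⟩
    obtain ⟨U, h, hU, hh⟩ := G.transition j i v v' hvv.symm
    have hv'' : h.toFun ⟨v, hU⟩ = v' := G.injective i ((hh ⟨v, hU⟩).trans hvv.symm)
    have h1 : IsOpen ((SmoothManifold.incl _ U).toFun '' (h.toFun ⁻¹' s)) :=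
      U.2.isOpenMap_subtype_val _ (hs.preimage h.smooth.continuous)
    refine Filter.mem_of_superset (h1.mem_nhds ⟨⟨v, hU⟩, ?_, rfl⟩) ?_
    · change h.toFun ⟨v, hU⟩ ∈ s
      rwa [hv'']
    · rintro _ ⟨u, hu, rfl⟩
      exact ⟨_, hu, hh u⟩

/-- The local homeomorphisms from a glued space to its pieces. -/
def GlueData.homeo (G : GlueData E V c) (i : Σ i, V i) :
    letI := glueTopology c; OpenPartialHomeomorph E (V i.1) :=
  letI := glueTopology c
  -- The index carries a point of its piece, because inverting the embedding requires a nonempty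
  -- domain; empty pieces cover nothing.
  haveI : Nonempty (V i.1) := ⟨i.2⟩
  ((G.isOpenEmbedding i.1).toOpenPartialHomeomorph (c i.1)).symm

theorem GlueData.homeo_apply (G : GlueData E V c) (i : Σ i, V i) (v : V i.1) :
    letI := glueTopology c; G.homeo i (c i.1 v) = v :=
  letI := glueTopology c
  haveI : Nonempty (V i.1) := ⟨i.2⟩
  (G.isOpenEmbedding i.1).toOpenPartialHomeomorph_left_inv

/-- The manifold glued from a family of manifolds. -/
def GlueData.glue (G : GlueData E V c) : SmoothManifold.{u} :=
  letI := glueTopology c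
  SmoothManifold.ofLocalHomeos E (fun i : Σ i, V i => V i.1) G.homeo
    (fun x => by
      obtain ⟨i, v, rfl⟩ := G.surjective x
      exact ⟨⟨i, v⟩, v, trivial, rfl⟩)
    (by
      rintro i j x ⟨v, -, rfl⟩ ⟨v', -, hv'⟩
      have hv : c j.1 v' = c i.1 v := hv'
      obtain ⟨U, h, hU, hh⟩ := G.transition i.1 j.1 v v' hv.symm
      change SmoothAt _ (G.homeo i (c i.1 v))
      rw [G.homeo_apply]
      refine (smoothAt_restrict_iff ⟨v, hU⟩).1 ?_
      have : (fun y : U => G.homeo j ((G.homeo i).symm y)) = h.toFun := by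
        ext u
        change G.homeo j (c i.1 u) = _
        rw [← hh u, G.homeo_apply]
      rw [this]
      exact h.smooth.smoothAt _)

/-- The inclusion of a piece in a glued manifold. -/
def GlueData.piece (G : GlueData E V c) (i : ι) : SmoothMap (V i) G.glue :=
  ⟨c i, isSmooth_iff_smoothAt.2 fun v => by
    let _ := glueTopology c
    exact SmoothManifold.ofLocalHomeos_smoothAt_symm (φ := G.homeo) _ _ ⟨i, v⟩ (y := v)
      (Set.mem_univ v)⟩

/-- The pieces of a glued manifold are open submanifolds. -/
theorem GlueData.exists_inverse (G : GlueData E V c) (i : ι) (v : V i) :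
    ∃ (U : Opens G.glue) (r : SmoothMap (G.glue.restrict U) (V i)) (h : c i v ∈ U),
      r.toFun ⟨c i v, h⟩ = v ∧ ∀ y : U, c i (r.toFun y) = y.1 := by
  let _ := glueTopology c
  let U : Opens G.glue := ⟨(G.homeo ⟨i, v⟩).source, (G.homeo ⟨i, v⟩).open_source⟩
  refine ⟨U, ⟨fun y : U => G.homeo ⟨i, v⟩ y.1, ?_⟩, ⟨v, trivial, rfl⟩, G.homeo_apply ⟨i, v⟩ v, ?_⟩
  · refine isSmooth_iff_smoothAt.2 fun y => (smoothAt_restrict_iff (M := G.glue)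
      (f := G.homeo ⟨i, v⟩) y).2 ?_
    exact SmoothManifold.ofLocalHomeos_smoothAt (φ := G.homeo) _ _ ⟨i, v⟩ y.2
  · intro y
    exact (G.homeo ⟨i, v⟩).left_inv y.2

end Glue

end

section

/-! ### Locality along submersions -/

section Local

open TopologicalSpace

variable {M N W : SmoothManifold.{u}}

theorem SmoothManifold.isSubmersion_incl (U : Opens M) : IsSubmersion (M.incl U).toFun :=
  .of_section (M.incl U).smooth fun m => ⟨U, SmoothMap.id _, m.2, rfl, fun _ => rfl⟩

/-- Smoothness may be checked after composition with submersions. -/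
theorem IsSmooth.of_submersion {f : M → N}
    (h : ∀ x, ∃ (W : SmoothManifold.{u}) (j : SmoothMap W M) (w : W), IsSubmersion j.toFun ∧
      j w = x ∧ IsSmooth (fun w => f (j w))) : IsSmooth f := by
  refine .of_local fun x => ?_
  obtain ⟨W, j, w, hj, rfl, hs⟩ := h x
  obtain ⟨U, σ, hU, -, hσ⟩ := hj.exists_section w
  refine ⟨U, hU, ?_⟩
  have h1 := hs.comp σ.smooth
  have h2 : (fun y : U => f y) = fun y => f (j (σ.toFun y)) :=
    funext fun y => congrArg f (hσ y).symm
  exact h2 ▸ h1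

/-- Local sections of `f ∘ σ` become local sections of `f` after applying `σ`. -/
theorem IsSubmersion.of_comp {f : M → N} (hf : IsSmooth f)
    (h : ∀ m, ∃ (W : SmoothManifold.{u}) (σ : SmoothMap W M) (w : W), σ w = m ∧
      IsSubmersion (fun w => f (σ w))) : IsSubmersion f := by
  refine .of_section hf fun m => ?_
  obtain ⟨W, σ, w, rfl, hs⟩ := h m
  obtain ⟨U, τ, hU, hτ, hτ'⟩ := hs.exists_section w
  exact ⟨U, σ.comp τ, hU, congrArg σ.toFun hτ, hτ'⟩

end Local

/-! ### Algebra of Lie groupoids, actions and torsors -/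

namespace LieGroupoid

variable (Γ : LieGroupoid.{u})

theorem mul_congr {g g' h h' : Γ.Mor} (hg : g = g') (hh : h = h') (w : Γ.tgt g = Γ.src h) :
    Γ.mul g h w = Γ.mul g' h' (hg ▸ hh ▸ w) := by
  subst hg hh; rfl

theorem inv_mul_cancel_left (g h : Γ.Mor) (w : Γ.tgt g = Γ.src h) :
    Γ.mul (Γ.inv g) (Γ.mul g h w) (by rw [Γ.tgt_inv, Γ.src_mul]) = h := by
  rw [← Γ.mul_assoc _ _ _ (Γ.tgt_inv g) w, Γ.mul_congr (Γ.inv_mul g) rfl,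
    Γ.mul_congr (congrArg Γ.one.toFun w) rfl, Γ.one_mul]

theorem mul_inv_cancel_left (g h : Γ.Mor) (w : Γ.src g = Γ.src h) :
    Γ.mul g (Γ.mul (Γ.inv g) h ((Γ.tgt_inv g).trans w)) (by rw [Γ.src_mul, Γ.src_inv]) = h := by
  rw [← Γ.mul_assoc _ _ _ (Γ.src_inv g).symm, Γ.mul_congr (Γ.mul_inv g) rfl,
    Γ.mul_congr (congrArg Γ.one.toFun w) rfl, Γ.one_mul]

theorem mul_left_cancel {g h h' : Γ.Mor} {w : Γ.tgt g = Γ.src h} {w' : Γ.tgt g = Γ.src h'}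
    (e : Γ.mul g h w = Γ.mul g h' w') : h = h' := by
  rw [← Γ.inv_mul_cancel_left g h w, Γ.mul_congr rfl e, Γ.inv_mul_cancel_left g h' w']

variable {Γ} {W : SmoothManifold.{u}}

/-- The product of smooth families of arrows. -/
def mulMap (a b : SmoothMap W Γ.Mor) (w : ∀ p, Γ.tgt (a p) = Γ.src (b p)) : SmoothMap W Γ.Mor :=
  ⟨fun p => Γ.mul (a p) (b p) (w p), Γ.smooth_mul W a b w⟩

end LieGroupoid

namespace RightAction

variable {Γ : LieGroupoid.{u}} {P : SmoothManifold.{u}} (α : RightAction Γ P)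

theorem act_congr {p p' : P} {g g' : Γ.Mor} (hp : p = p') (hg : g = g')
    (w : α.anchor p = Γ.src g) : α.act p g w = α.act p' g' (hp ▸ hg ▸ w) := by
  subst hp hg; rfl

theorem act_inv (p : P) (g : Γ.Mor) (w : α.anchor p = Γ.src g) :
    α.act (α.act p g w) (Γ.inv g) ((α.anchor_act p g w).trans (Γ.src_inv g).symm) = p := by
  rw [← α.act_mul p g (Γ.inv g) w (Γ.src_inv g).symm, α.act_congr rfl (Γ.mul_inv g),
    α.act_congr rfl (congrArg Γ.one.toFun w.symm), α.act_one]

theorem act_one' (p : P) {g : Γ.Mor} {x : Γ.Obj} (hg : g = Γ.one x) (w : α.anchor p = Γ.src g) :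
    α.act p g w = p := by
  subst hg
  rw [Γ.src_one] at w
  subst w
  exact α.act_one p

/-- The action on smooth families. -/
def actMap {W : SmoothManifold.{u}} (a : SmoothMap W P) (b : SmoothMap W Γ.Mor)
    (w : ∀ x, α.anchor (a x) = Γ.src (b x)) : SmoothMap W P :=
  ⟨fun x => α.act (a x) (b x) (w x), α.smooth_act W a b w⟩

@[simp]
theorem actMap_apply {W : SmoothManifold.{u}} (a : SmoothMap W P) (b : SmoothMap W Γ.Mor)
    (w : ∀ x, α.anchor (a x) = Γ.src (b x)) (x : W) :
    α.actMap a b w x = α.act (a x) (b x) (w x) := rfl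

end RightAction

namespace TorsorStructure

variable {Γ : LieGroupoid.{u}} {S P : SmoothManifold.{u}} (t : TorsorStructure Γ S P)

/-- The unique arrow that moves one point of a fiber to another. -/
def div (p p' : P) (h : t.proj p = t.proj p') : Γ.Mor := (t.existsUnique_act p p' h).choose

variable {p p' : P} (h : t.proj p = t.proj p')

theorem src_div : t.anchor p = Γ.src (t.div p p' h) :=
  (t.existsUnique_act p p' h).choose_spec.1.choose

theorem act_div : t.act p (t.div p p' h) (t.src_div h) = p' :=
  (t.existsUnique_act p p' h).choose_spec.1.choose_spec

theorem eq_div {g : Γ.Mor} (w : t.anchor p = Γ.src g) (e : t.act p g w = p') :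
    g = t.div p p' h :=
  (t.existsUnique_act p p' h).choose_spec.2 g ⟨w, e⟩

theorem tgt_div : Γ.tgt (t.div p p' h) = t.anchor p' := by
  rw [← t.anchor_act p _ (t.src_div h), t.act_div]

theorem eq_of_act_eq {g g' : Γ.Mor} {w : t.anchor p = Γ.src g} {w' : t.anchor p = Γ.src g'}
    (e : t.act p g w = t.act p g' w') : g = g' := by
  have h : t.proj p = t.proj (t.act p g' w') := (t.proj_act p g' w').symm
  exact (t.eq_div h w e).trans (t.eq_div h w' rfl).symm

theorem eq_one_of_act_eq {g : Γ.Mor} {w : t.anchor p = Γ.src g} (e : t.act p g w = p) :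
    g = Γ.one (t.anchor p) :=
  t.eq_of_act_eq (e.trans (t.act_one p).symm)

/-- The division map of a torsor is smooth. -/
def SmoothDiv : Prop :=
  ∀ (W : SmoothManifold.{u}) (a b : SmoothMap W P) (h : ∀ w, t.proj (a w) = t.proj (b w)),
    IsSmooth fun w => t.div (a w) (b w) (h w)

/-- The division map on smooth families. -/
def divMap {t : TorsorStructure Γ S P} (ht : t.SmoothDiv) {W : SmoothManifold.{u}}
    (a b : SmoothMap W P) (h : ∀ w, t.proj (a w) = t.proj (b w)) : SmoothMap W Γ.Mor :=
  ⟨fun w => t.div (a w) (b w) (h w), ht W a b h⟩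

end TorsorStructure

/-! ### Morphisms of torsors are cartesian -/

section Cartesian

variable {Γ : LieGroupoid.{u}} {A B : Torsor Γ} (φ : A ⟶ B)

/-- The map of total spaces. -/
abbrev Torsor.homTotal {A B : Torsor Γ} (φ : A ⟶ B) : SmoothMap A.total B.total :=
  Torsor.Hom.total φ

/-- The map of bases. -/
abbrev Torsor.homBase {A B : Torsor Γ} (φ : A ⟶ B) : SmoothMap A.base B.base :=
  Torsor.Hom.base φ

open DiffStack.Torsor

@[simp]
theorem Torsor.homTotal_comp {C : Torsor Γ} (ψ : B ⟶ C) (q : A.total) :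
    homTotal (φ ≫ ψ) q = homTotal ψ (homTotal φ q) := rfl

theorem Torsor.hom_ext {φ ψ : A ⟶ B} (h : ∀ q, homTotal φ q = homTotal ψ q) : φ = ψ := by
  have h1 : homTotal φ = homTotal ψ := SmoothMap.ext (funext h)
  refine Torsor.Hom.ext (SmoothMap.ext (funext fun s => ?_)) h1
  obtain ⟨q, rfl⟩ := A.str.surjective_proj s
  rw [← Torsor.Hom.comm φ, ← Torsor.Hom.comm ψ]
  exact congrArg _ (h q)

/-- The arrow that moves `p` to `p'` also moves one image to the other; when the images coincide,
freeness of the action makes it a unit. -/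
theorem Torsor.hom_injective {p p' : A.total} (h : A.str.proj p = A.str.proj p')
    (e : homTotal φ p = homTotal φ p') : p = p' := by
  have h1 := A.str.act_div h
  have h2 := Torsor.Hom.total_act φ _ _ (A.str.src_div h)
  rw [h1] at h2
  have h3 := B.str.eq_one_of_act_eq (h2.symm.trans e.symm)
  rw [← h1]
  exact (A.str.act_one' p h3 _).symm

/-- Any point of `A` over `s` will do, once corrected by the arrow that moves its image to `b`. -/
theorem Torsor.exists_preimage (s : A.base) (b : B.total) (h : B.str.proj b = homBase φ s) :
    ∃ a, A.str.proj a = s ∧ homTotal φ a = b := by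
  obtain ⟨a, rfl⟩ := A.str.surjective_proj s
  have h1 : B.str.proj (homTotal φ a) = B.str.proj b := (Torsor.Hom.comm φ a).trans h.symm
  have h2 : A.str.anchor a = Γ.src (B.str.div _ _ h1) :=
    (Torsor.Hom.anchor_total φ a).symm.trans (B.str.src_div h1)
  refine ⟨A.str.act a _ h2, A.str.proj_act _ _ _, ?_⟩
  exact (Torsor.Hom.total_act φ _ _ h2).trans (B.str.act_div h1)

/-- Pointwise, the two preceding lemmas already make `A` the pull-back of `B`; what is at stake is
smoothness of the lift. After base change along the projection of `A` there is a tautological smooth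
family of points of `A` over `k`, and smooth division in `B` corrects it to the lift. -/
theorem Torsor.exists_lift (hB : B.str.SmoothDiv) {W : SmoothManifold.{u}} (k : SmoothMap W A.base)
    (σ : SmoothMap W B.total) (h : ∀ w, B.str.proj (σ w) = homBase φ (k w)) :
    ∃ τ : SmoothMap W A.total, (∀ w, A.str.proj (τ w) = k w) ∧ ∀ w, homTotal φ (τ w) = σ w := by
  choose τ h1 h2 using fun w => exists_preimage φ (k w) (σ w) (h w)
  refine ⟨⟨τ, .of_submersion fun w => ?_⟩, h1, h2⟩
  let hp := A.str.submersion_proj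
  have h3 : ∀ x : fiberProd A.str.proj k hp, B.str.proj (((homTotal φ).comp (fiberProd.fst hp)) x) =
      B.str.proj ((σ.comp (fiberProd.snd hp)) x) := fun x => by
    simp only [SmoothMap.comp_apply, h]
    rw [← fiberProd.condition hp x]
    exact Torsor.Hom.comm φ _
  have h4 : ∀ x, A.str.anchor (fiberProd.fst hp x) = Γ.src (TorsorStructure.divMap hB _ _ h3 x) :=
    fun x => (Torsor.Hom.anchor_total φ _).symm.trans (B.str.src_div (h3 x))
  refine ⟨_, fiberProd.snd hp, fiberProd.mk hp (τ w) w (h1 w), fiberProd.isSubmersion_snd hp, rfl,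
    ?_⟩
  convert (A.str.actMap (fiberProd.fst hp) (TorsorStructure.divMap hB _ _ h3) h4).smooth using 2
    with x
  refine hom_injective φ ?_ ?_
  · rw [h1, RightAction.actMap_apply, A.str.proj_act]
    exact (fiberProd.condition hp x).symm
  · rw [h2]
    exact ((Torsor.Hom.total_act φ _ _ (h4 x)).trans (B.str.act_div (h3 x))).symm

/-- A morphism of torsors that is invertible on the bases is an isomorphism. -/
theorem Torsor.isIso_of_base (hB : B.str.SmoothDiv) (r : SmoothMap B.base A.base)
    (h1 : ∀ s, homBase φ (r s) = s) (h2 : ∀ s, r (homBase φ s) = s) : IsIso φ := by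
  obtain ⟨τ, hτ, hτ'⟩ := exists_lift φ hB (r.comp B.str.proj) (SmoothMap.id _)
    (fun w => (h1 _).symm)
  have hanchor : ∀ q, A.str.anchor (τ q) = B.str.anchor q := fun q => by
    rw [← Torsor.Hom.anchor_total φ]
    exact congrArg _ (hτ' q)
  let ψ : B ⟶ A :=
    { base := r
      total := τ
      comm := hτ
      anchor_total := hanchor
      total_act := fun q g w => by
        refine hom_injective φ ?_ ?_
        · rw [hτ, A.str.proj_act, hτ]
          exact congrArg r.toFun (B.str.proj_act _ _ _)
        · rw [hτ']
          refine Eq.trans ?_ (Torsor.Hom.total_act φ _ _ _).symm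
          exact B.str.act_congr (hτ' q).symm rfl _ }
  refine ⟨ψ, hom_ext fun q => ?_, hom_ext fun q => hτ' q⟩
  refine hom_injective φ ?_ (hτ' _)
  change A.str.proj (τ (homTotal φ q)) = A.str.proj q
  rw [hτ]
  exact (congrArg r.toFun (Torsor.Hom.comm φ q)).trans (h2 _)

end Cartesian

end

section

/-! ### Smoothness of division in torsors under second countable groupoids -/

namespace TorsorStructure

open Filter Topology MeasureTheory

variable {Γ : LieGroupoid.{u}} {S P : SmoothManifold.{u}} (t : TorsorStructure Γ S P)

/-- Division is smooth near a pair of points. -/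
def SmoothDivAt (p p' : P) : Prop :=
  ∀ (W : SmoothManifold.{u}) (a b : SmoothMap W P), (∀ w, t.proj (a w) = t.proj (b w)) →
    ∀ w₀, a w₀ = p → b w₀ = p' → ∃ (W' : SmoothManifold.{u}) (j : SmoothMap W' W) (w' : W')
      (d : SmoothMap W' Γ.Mor), IsSubmersion j.toFun ∧ j w' = w₀ ∧
        ∀ u, ∃ w, t.act (a (j u)) (d u) w = b (j u)

variable {t}

/-- Uniqueness of the arrow identifies a local smooth choice with the division map, and smoothness
descends along submersions. -/
theorem SmoothDiv.of_smoothDivAt (h : ∀ p p', t.proj p = t.proj p' → t.SmoothDivAt p p') :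
    t.SmoothDiv := by
  intro W a b hab
  refine .of_submersion fun w₀ => ?_
  obtain ⟨W', j, w', d, hj, hw', hd⟩ := h _ _ (hab w₀) W a b hab w₀ rfl rfl
  refine ⟨W', j, w', hj, hw', ?_⟩
  convert d.smooth using 2 with u
  obtain ⟨w, hu⟩ := hd u
  exact (t.eq_div _ w hu).symm

/-- Since the source map is a submersion, after a submersive base change there are smooth families
k, k' of arrows extending g⁻¹ and g'⁻¹ which move the given pair of families close to (p, p'). If d
divides the moved families, then k·d·k'⁻¹ divides the original ones. -/
theorem SmoothDivAt.act {p p' : P} (h : t.SmoothDivAt p p') (g g' : Γ.Mor)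
    (w : t.anchor p = Γ.src g) (w' : t.anchor p' = Γ.src g') :
    t.SmoothDivAt (t.act p g w) (t.act p' g' w') := by
  intro W a b hab w₀ ha hb
  let hs := Γ.submersion_src
  -- local families of arrows moving `a` to `p` and `b` to `p'`
  let W₁ := fiberProd Γ.src (t.anchor.comp a) hs
  let k := fiberProd.fst (g := t.anchor.comp a) hs
  let j₁ := fiberProd.snd (g := t.anchor.comp a) hs
  let W₂ := fiberProd Γ.src ((t.anchor.comp b).comp j₁) hs
  let k' := fiberProd.fst (g := (t.anchor.comp b).comp j₁) hs
  let j₂ := fiberProd.snd (g := (t.anchor.comp b).comp j₁) hs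
  let a' : SmoothMap W₂ P := t.actMap (a.comp (j₁.comp j₂)) (k.comp j₂)
    (fun x => (fiberProd.condition hs (j₂ x)).symm)
  let b' : SmoothMap W₂ P := t.actMap (b.comp (j₁.comp j₂)) k'
    (fun x => (fiberProd.condition hs x).symm)
  have hab' : ∀ x, t.proj (a' x) = t.proj (b' x) := fun x => by
    refine (t.proj_act _ _ _).trans (Eq.trans ?_ (t.proj_act _ _ _).symm)
    exact hab _
  let x₁ : W₁ := fiberProd.mk hs (Γ.inv g) w₀ (by
    rw [SmoothMap.comp_apply, ha, t.anchor_act, Γ.src_inv])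
  let x₂ : W₂ := fiberProd.mk hs (Γ.inv g') x₁ (by
    change _ = t.anchor (b w₀)
    rw [hb, t.anchor_act, Γ.src_inv])
  obtain ⟨W', j, y, d, hj, hy, hd⟩ := h W₂ a' b' hab' x₂
    ((t.act_congr ha rfl _).trans (t.act_inv p g w))
    ((t.act_congr hb rfl _).trans (t.act_inv p' g' w'))
  have hd1 : ∀ u, Γ.tgt (k (j₂ (j u))) = Γ.src (d u) := fun u => by
    obtain ⟨v, -⟩ := hd u
    rw [← v]
    exact (t.anchor_act _ _ _).symm
  have hd2 : ∀ u, Γ.tgt (d u) = Γ.src (Γ.inv (k' (j u))) := fun u => by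
    obtain ⟨v, hv⟩ := hd u
    rw [← t.anchor_act _ _ v, hv, Γ.src_inv]
    exact t.anchor_act _ _ _
  let d1 := LieGroupoid.mulMap (k.comp (j₂.comp j)) d hd1
  let d2 := LieGroupoid.mulMap d1 (Γ.inv.comp (k'.comp j)) (fun u =>
    (Γ.tgt_mul _ _ _).trans (hd2 u))
  have hsrc : ∀ u, t.anchor (a (j₁ (j₂ (j u)))) = Γ.src (k (j₂ (j u))) := fun u =>
    (fiberProd.condition hs (j₂ (j u))).symm
  refine ⟨W', j₁.comp (j₂.comp j), y, d2, ?_, ?_, fun u => ⟨?_, ?_⟩⟩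
  · exact (fiberProd.isSubmersion_snd hs).comp ((fiberProd.isSubmersion_snd hs).comp hj)
  · change j₁ (j₂ (j y)) = _
    rw [hy]; rfl
  · refine (hsrc u).trans ((Γ.src_mul _ _ _).trans (Γ.src_mul _ _ _)).symm
  · obtain ⟨v, hv⟩ := hd u
    refine (t.act_mul (a (j₁ (j₂ (j u)))) (d1 u) (Γ.inv (k' (j u)))
      ((hsrc u).trans (Γ.src_mul _ _ _).symm) ((Γ.tgt_mul _ _ _).trans (hd2 u))).trans ?_
    have h3 : t.act (a (j₁ (j₂ (j u)))) (d1 u) ((hsrc u).trans (Γ.src_mul _ _ _).symm) =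
      b' (j u) := (t.act_mul _ _ _ (hsrc u) (hd1 u)).trans hv
    refine (t.act_congr h3 rfl _).trans ?_
    exact t.act_inv _ _ _

/-- The map `(γ, p) ↦ (p γ, p)`. -/
def translation (t : TorsorStructure Γ S P) :
    SmoothMap (fiberProd Γ.src t.anchor Γ.submersion_src)
      (fiberProd t.proj t.proj t.submersion_proj) :=
  fiberProd.lift t.submersion_proj
    (t.actMap (fiberProd.snd Γ.submersion_src) (fiberProd.fst Γ.submersion_src)
      fun x => (fiberProd.condition Γ.submersion_src x).symm)
    (fiberProd.snd Γ.submersion_src) fun _ => t.proj_act _ _ _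

/-- A local section of the translation map, evaluated along w ↦ (b w, a w), has the required arrows
as its first component. -/
theorem smoothDivAt_of_submersionChart (c : SubmersionChart t.translation.toFun)
    (m : fiberProd Γ.src t.anchor Γ.submersion_src) (hm : m ∈ c.homeo.source) :
    t.SmoothDivAt (fiberProd.snd _ m) (fiberProd.fst _ (t.translation m)) := by
  intro W a b hab w₀ ha hb
  obtain ⟨U, σ, hU, hσm, hσ⟩ := c.exists_section hm
  let ρ : SmoothMap W (fiberProd t.proj t.proj t.submersion_proj) :=
    fiberProd.lift t.submersion_proj b a fun w => (hab w).symm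
  have hρ : ρ w₀ = t.translation m := fiberProd.ext t.submersion_proj hb ha
  refine ⟨W.restrict (ρ.preimage U), W.incl _, ⟨w₀, SmoothMap.mem_preimage.2 (hρ ▸ hU)⟩,
    (fiberProd.fst _).comp (σ.comp (ρ.restrictPreimage U)),
    SmoothManifold.isSubmersion_incl _, rfl, fun u => ?_⟩
  have h1 : t.translation (σ (ρ.restrictPreimage U u)) = ρ ((W.incl _) u) :=
    hσ (ρ.restrictPreimage U u)
  have h2 : fiberProd.snd _ (σ (ρ.restrictPreimage U u)) = a (W.incl _ u) :=
    congrArg (fiberProd.snd t.submersion_proj).toFun h1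
  have h3 := congrArg (fiberProd.fst t.submersion_proj).toFun h1
  have h4 := (fiberProd.condition Γ.submersion_src (σ (ρ.restrictPreimage U u))).symm
  refine ⟨(congrArg t.anchor.toFun h2.symm).trans h4, ?_⟩
  exact (t.act_congr h2 rfl h4).symm.trans h3

end TorsorStructure

end

section

/-! ### The measure argument: smooth division at some pair over every point. -/

namespace TorsorStructure

open Filter Topology MeasureTheory

variable {Γ : LieGroupoid.{u}} {S P : SmoothManifold.{u}} (t : TorsorStructure Γ S P)

theorem translation_injective : Function.Injective t.translation.toFun := by
  intro m m' h
  have h1 : fiberProd.snd Γ.submersion_src m = fiberProd.snd Γ.submersion_src m' :=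
    congrArg (fiberProd.snd t.submersion_proj).toFun h
  refine fiberProd.ext _ ?_ h1
  have h2 : t.act (fiberProd.snd Γ.submersion_src m) (fiberProd.fst Γ.submersion_src m) _ =
    t.act (fiberProd.snd Γ.submersion_src m') (fiberProd.fst Γ.submersion_src m') _ :=
    congrArg (fiberProd.fst t.submersion_proj).toFun h
  refine t.eq_of_act_eq (p := fiberProd.snd Γ.submersion_src m)
    (w' := (fiberProd.condition _ m').symm ▸ congrArg _ h1) (h2.trans ?_)
  exact t.act_congr h1.symm rfl _

/-- The map is block triangular with an identity block, so only the other diagonal block matters. -/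
theorem surjective_of_fst_snd {E F G : Type*} [NormedAddCommGroup E] [NormedSpace ℝ E]
    [NormedAddCommGroup F] [NormedSpace ℝ F] [NormedAddCommGroup G] [NormedSpace ℝ G]
    (L : E × F →L[ℝ] E × G) (h1 : ∀ v, (L v).1 = v.1)
    (h2 : Function.Surjective fun v : F => (L (0, v)).2) : Function.Surjective L := by
  rintro ⟨a, b⟩
  obtain ⟨v, hv⟩ := h2 (b - (L (a, 0)).2)
  refine ⟨(a, v), Prod.ext (h1 _) ?_⟩
  have : ((a, v) : E × F) = (a, 0) + (0, v) := by simp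
  rw [this, map_add, Prod.snd_add]
  simp only at hv
  rw [hv]
  simp

/-- Otherwise the orbit map of `p` has a nowhere surjective derivative in charts. Its images of
countably many charts are then null sets, yet by transitivity they cover a nonempty open set of
fiber coordinates. -/
theorem exists_smoothDivAt [SecondCountableTopology Γ.Mor] (p : P) :
    ∃ p', t.proj p = t.proj p' ∧ t.SmoothDivAt p p' := by
  by_contra! hcon
  let hs := Γ.submersion_src
  let hπ := t.submersion_proj
  obtain ⟨d, hd, hpd⟩ := P.exists_chart p
  obtain ⟨cπ, hcπ⟩ := hπ.exists_chart p
  choose cs hcs using hs.exists_chart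
  let t₀ : FiberSet Γ.src t.anchor := ⟨(Γ.one (t.anchor p), p), Γ.src_one _⟩
  -- Both `Ψ γ` and `Θ` use the chart `d` for the factor `P` that the translation map preserves. Its
  -- expression `G γ` is therefore the identity on that coordinate.
  let Ψ := fun γ => fiberHomeo (cs γ) d t₀
  let Θ := fiberHomeo (f := t.proj) (g := t.proj) cπ d ⟨(p, p), rfl⟩
  let G := fun γ w => Θ (t.translation ((Ψ γ).symm w))
  let Dt := fun γ => (Ψ γ).target ∩ (Ψ γ).symm ⁻¹' (t.translation.toFun ⁻¹' Θ.source)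
  have hDt : ∀ γ, IsOpen (Dt γ) := fun γ => (Ψ γ).isOpen_inter_preimage_symm
    (Θ.open_source.preimage t.translation.smooth.continuous)
  have hG : ∀ γ, ∀ w ∈ Dt γ, ContDiffAt ℝ ∞ (G γ) w := by
    intro γ w hw
    have h1 := smoothFrom_fiberHomeo_symm hs (cs γ) hd t₀ hw.1
    have h2 := (t.translation.smooth.smoothAt _).comp_smoothFrom h1
    exact SmoothInto.comp_smoothFrom (M := fiberProd t.proj t.proj hπ) (f := Θ)
      (smoothInto_fiberHomeo hπ cπ hd _ hw.2) h2
  have hG1 : ∀ γ, ∀ w ∈ Dt γ, (G γ w).1 = w.1 := by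
    intro γ w hw
    change (Ψ γ ((Ψ γ).symm w)).1 = w.1
    rw [(Ψ γ).right_inv hw.1]
  -- Freezing the coordinate of `P` at `p` leaves `h γ`, the orbit map of `p`, from coordinates on
  -- the source fiber to coordinates on the fiber of the torsor.
  let D := fun γ => (fun ξ => (d.2 p, ξ)) ⁻¹' Dt γ
  have hD : ∀ γ, IsOpen (D γ) := fun γ => (hDt γ).preimage (by fun_prop)
  let h := fun γ ξ => (G γ (d.2 p, ξ)).2
  have hh : ∀ γ, ∀ ξ ∈ D γ, ContDiffAt ℝ ∞ (h γ) ξ := by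
    intro γ ξ hξ
    exact contDiffAt_snd.comp ξ ((hG γ _ hξ).comp ξ (by fun_prop))
  have hinj : ∀ γ, Set.InjOn (h γ) (D γ) := by
    intro γ ξ hξ ξ' hξ' he
    have h1 : G γ (d.2 p, ξ) = G γ (d.2 p, ξ') :=
      Prod.ext ((hG1 γ _ hξ).trans (hG1 γ _ hξ').symm) he
    have h2 := t.translation_injective (Θ.injOn hξ.2 hξ'.2 h1)
    exact congrArg Prod.snd ((Ψ γ).symm.injOn hξ.1 hξ'.1 h2)
  -- A surjective derivative of the orbit map would, by the block form of `G γ`, make the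
  -- translation map a submersion at the corresponding point, and its sections would contradict
  -- `hcon`.
  have hns : ∀ γ, ∀ ξ ∈ D γ, ¬ Function.Surjective (fderiv ℝ (h γ) ξ) := by
    intro γ ξ hξ hsurj
    let m : fiberProd Γ.src t.anchor hs := (Ψ γ).symm (d.2 p, ξ)
    have hm : m ∈ (Ψ γ).source := (Ψ γ).map_target hξ.1
    have hΨm : Ψ γ m = (d.2 p, ξ) := (Ψ γ).right_inv hξ.1
    have hmp : fiberProd.snd hs m = p := d.2.injOn hm.2 hpd (congrArg Prod.fst hΨm)
    have hGd : HasFDerivAt (G γ) (fderiv ℝ (G γ) (d.2 p, ξ)) (d.2 p, ξ) := ((hG γ _ hξ).differentiableAt (by simp)).hasFDerivAt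
    have hfst : ∀ v, (fderiv ℝ (G γ) (d.2 p, ξ) v).1 = v.1 := by
      intro v
      have h1 : HasFDerivAt (fun w => (G γ w).1)
          (ContinuousLinearMap.fst ℝ (EuclideanSpace ℝ (Fin d.1))
            (EuclideanSpace ℝ (Fin (cs γ).dim))) (d.2 p, ξ) := by
        refine (hasFDerivAt_fst (𝕜 := ℝ)).congr_of_eventuallyEq ?_
        filter_upwards [(hDt γ).mem_nhds hξ] with w hw
        exact hG1 γ w hw
      exact DFunLike.congr_fun (hGd.fst.unique h1) v
    have hsnd : ∀ v, fderiv ℝ (h γ) ξ v = (fderiv ℝ (G γ) (d.2 p, ξ) (0, v)).2 := by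
      intro v
      have h1 := (HasFDerivAt.comp (f := fun ξ => (d.2 p, ξ)) ξ hGd
        (hasFDerivAt_prodMk_right _ _)).snd
      exact DFunLike.congr_fun h1.fderiv v
    have hGs := surjective_of_fst_snd _ hfst (by
      intro v
      obtain ⟨u, hu⟩ := hsurj v
      exact ⟨u, (hsnd u).symm.trans hu⟩)
    obtain ⟨c, hc⟩ := SubmersionChart.exists_of_surjective t.translation.smooth (m := m)
      (e := fiberChart (cs γ) d t₀) ⟨cs γ, d, hd, t₀, rfl⟩
      (e' := fiberChart cπ d ⟨(p, p), rfl⟩) ⟨cπ, d, hd, _, rfl⟩ hm hξ.2 (by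
        have hval : EuclideanSpace.finAddEquivProd ((fiberChart (cs γ) d t₀).2 m) =
            (d.2 p, ξ) :=
          (EuclideanSpace.finAddEquivProd.apply_symm_apply _).trans hΨm
        rw [← hval] at hGd
        have h1 := HasFDerivAt.comp ((fiberChart (cs γ) d t₀).2 m)
          (ContinuousLinearEquiv.hasFDerivAt
            (EuclideanSpace.finAddEquivProd (𝕜 := ℝ) (n := d.1) (m := cπ.dim)).symm)
          (hGd.comp _ (ContinuousLinearEquiv.hasFDerivAt
            (EuclideanSpace.finAddEquivProd (𝕜 := ℝ) (n := d.1) (m := (cs γ).dim))))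
        have h2 := h1.fderiv
        rw [hval] at h2
        refine (congrArg (fun L => Function.Surjective (DFunLike.coe L)) h2).mpr ?_
        exact (EuclideanSpace.finAddEquivProd (𝕜 := ℝ) (n := d.1) (m := cπ.dim)).symm.surjective.comp
          (hGs.comp (EuclideanSpace.finAddEquivProd (𝕜 := ℝ) (n := d.1)
            (m := (cs γ).dim)).surjective))
    refine hcon (fiberProd.fst hπ (t.translation m)) ?_ ?_
    · refine Eq.trans ?_ (fiberProd.condition hπ (t.translation m)).symm
      exact congrArg t.proj.toFun hmp.symm
    · have h3 := smoothDivAt_of_submersionChart c m hc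
      rwa [show fiberProd.snd _ m = p from hmp] at h3
  -- countably many of these coordinate domains cover the fiber of the source map
  obtain ⟨C, hCA, hC, hcover⟩ := TopologicalSpace.countable_cover_nhdsWithin
    (s := {γ | Γ.src γ = t.anchor p}) (f := fun γ => (cs γ).homeo.source)
    (fun γ _ => mem_nhdsWithin_of_mem_nhds ((cs γ).homeo.open_source.mem_nhds (hcs γ)))
  -- The fiber coordinates of the points of the fiber through `p` that lie in the domain of `cπ`.
  -- Each such point is obtained from `p` by an arrow lying in one of the countably many charts.
  let O : Set (EuclideanSpace ℝ (Fin cπ.dim)) :=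
    {v | (cπ.chart.2 (t.proj p), v) ∈ cπ.homeo.target}
  have hO : IsOpen O := cπ.homeo.open_target.preimage (by fun_prop)
  have hOne : O.Nonempty := by
    refine ⟨(cπ.homeo p).2, ?_⟩
    change (cπ.chart.2 (t.proj p), (cπ.homeo p).2) ∈ cπ.homeo.target
    rw [← cπ.homeo_fst p hcπ]
    exact cπ.homeo.map_source hcπ
  have hnull : volume (⋃ γ ∈ C, h γ '' D γ) = 0 :=
    (measure_biUnion_null_iff hC).2 fun γ _ =>
      volume_image_eq_zero_of_injOn (hD γ) (hh γ) (hinj γ) (hns γ)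
  refine (hO.measure_pos volume hOne).ne' (measure_mono_null ?_ hnull)
  intro v hv
  let b := cπ.homeo.symm (cπ.chart.2 (t.proj p), v)
  have hb : t.proj p = t.proj b := (cπ.apply_symm (cπ.mem_source p hcπ) hv).symm
  have hbs : b ∈ cπ.homeo.source := cπ.homeo.map_target hv
  let g := t.div p b hb
  have hg := t.src_div hb
  obtain ⟨γ, hγ, hgγ⟩ := Set.mem_iUnion₂.1 (hcover hg.symm)
  let m : FiberSet Γ.src t.anchor := ⟨(g, p), hg.symm⟩
  have hm : m ∈ (Ψ γ).source := ⟨hgγ, hpd⟩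
  have hm' : (Ψ γ).symm (d.2 p, ((cs γ).homeo g).2) = m := (Ψ γ).left_inv hm
  have hFm : fiberProd.fst hπ (t.translation m) = b := t.act_div hb
  refine Set.mem_iUnion₂.2 ⟨γ, hγ, ((cs γ).homeo g).2, ⟨(Ψ γ).map_source hm, ?_⟩, ?_⟩
  · change t.translation ((Ψ γ).symm (d.2 p, ((cs γ).homeo g).2)) ∈ Θ.source
    rw [hm']
    refine ⟨?_, hpd⟩
    change fiberProd.fst hπ (t.translation m) ∈ _
    rwa [hFm]
  · change (Θ (t.translation ((Ψ γ).symm (d.2 p, ((cs γ).homeo g).2)))).2 = v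
    rw [hm']
    change (cπ.homeo (fiberProd.fst hπ (t.translation m))).2 = v
    rw [hFm, cπ.homeo.right_inv hv]

/-- Division is smooth in a torsor under a second countable Lie groupoid. -/
theorem smoothDiv [SecondCountableTopology Γ.Mor] : t.SmoothDiv := by
  refine .of_smoothDivAt fun p p' h => ?_
  obtain ⟨q, hq, hd⟩ := t.exists_smoothDivAt p
  -- The first point stays fixed and the second is moved from `q` to the arbitrary `p'`.
  have h1 := hd.act (Γ.one (t.anchor p)) (t.div q p' (hq.symm.trans h)) (Γ.src_one _).symm
    (t.src_div _)
  rwa [t.act_one, t.act_div] at h1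

end TorsorStructure

end

/-! ### Quotients of fiber products by diagonal actions -/

section Assoc

theorem IsSmooth.congr {M N : SmoothManifold.{u}} {f g : M → N} (hf : IsSmooth f)
    (h : ∀ x, g x = f x) : IsSmooth g :=
  (funext h : g = f) ▸ hf

variable {Γ : LieGroupoid.{u}} {S P Q : SmoothManifold.{u}}

/-- A manifold `E` that is the quotient of the fiber product of `P` and `Q` over the anchor maps by
the diagonal action of `Γ`. -/
structure AssocQuotient (α : RightAction Γ P) (β : RightAction Γ Q) (E : SmoothManifold.{u}) where
  pair : ∀ p q, α.anchor p = β.anchor q → E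
  smooth_pair : ∀ (W : SmoothManifold.{u}) (a : SmoothMap W P) (b : SmoothMap W Q)
    (h : ∀ w, α.anchor (a w) = β.anchor (b w)), IsSmooth fun w => pair (a w) (b w) (h w)
  pair_act : ∀ p q h g (w : α.anchor p = Γ.src g) (w' : β.anchor q = Γ.src g),
    pair (α.act p g w) (β.act q g w') ((α.anchor_act p g w).trans (β.anchor_act q g w').symm) =
      pair p q h
  exists_of_pair_eq : ∀ {p q h p' q' h'}, pair p q h = pair p' q' h' →
    ∃ (g : Γ.Mor) (w : α.anchor p = Γ.src g) (w' : β.anchor q = Γ.src g),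
      α.act p g w = p' ∧ β.act q g w' = q'
  exists_lift : ∀ e, ∃ (W : SmoothManifold.{u}) (j : SmoothMap W E) (w : W) (a : SmoothMap W P)
    (b : SmoothMap W Q) (h : ∀ w, α.anchor (a w) = β.anchor (b w)),
    IsSubmersion j.toFun ∧ j w = e ∧ ∀ w, pair (a w) (b w) (h w) = j w

namespace AssocQuotient

variable {α : RightAction Γ P} {β : RightAction Γ Q} {E : SmoothManifold.{u}}

/-- The roles of the two factors may be exchanged. -/
def swap (A : AssocQuotient α β E) : AssocQuotient β α E where
  pair q p h := A.pair p q h.symm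
  smooth_pair W b a h := A.smooth_pair W a b fun w => (h w).symm
  pair_act q p h g w w' := A.pair_act p q h.symm g w' w
  exists_of_pair_eq e := by
    obtain ⟨g, w, w', h1, h2⟩ := A.exists_of_pair_eq e
    exact ⟨g, w', w, h2, h1⟩
  exists_lift e := by
    obtain ⟨W, j, w, a, b, h, hj, hw, hm⟩ := A.exists_lift e
    exact ⟨W, j, w, b, a, fun w => (h w).symm, hj, hw, hm⟩

variable (A : AssocQuotient α β E)

theorem pair_congr {p p' : P} {q q' : Q} (hp : p = p') (hq : q = q') (h : α.anchor p = β.anchor q) :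
    A.pair p q h = A.pair p' q' (hp ▸ hq ▸ h) := by
  subst hp hq; rfl

theorem exists_pair (e : E) : ∃ p q h, A.pair p q h = e := by
  obtain ⟨W, j, w, a, b, h, -, rfl, hm⟩ := A.exists_lift e
  exact ⟨a w, b w, h w, hm w⟩

theorem exists_lift_family {W : SmoothManifold.{u}} (e : SmoothMap W E) (w : W) :
    ∃ (W' : SmoothManifold.{u}) (j : SmoothMap W' W) (w' : W') (a : SmoothMap W' P)
      (b : SmoothMap W' Q) (h : ∀ x, α.anchor (a x) = β.anchor (b x)),
      IsSubmersion j.toFun ∧ j w' = w ∧ ∀ x, A.pair (a x) (b x) (h x) = e (j x) := by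
  obtain ⟨W', j, w', a, b, h, hj, hw, hm⟩ := A.exists_lift (e w)
  refine ⟨fiberProd j e hj, fiberProd.snd hj, fiberProd.mk hj w' w hw, a.comp (fiberProd.fst hj),
    b.comp (fiberProd.fst hj), fun x => h _, fiberProd.isSubmersion_snd hj, rfl, fun x => ?_⟩
  exact (hm _).trans (fiberProd.condition hj x)

/-- Representatives exist smoothly after a submersive base change, so smooth families of pairs
detect smoothness on the quotient. -/
theorem isSmooth_of_pair {N : SmoothManifold.{u}} {F : E → N}
    (hF : ∀ (W : SmoothManifold.{u}) (a : SmoothMap W P) (b : SmoothMap W Q)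
      (h : ∀ w, α.anchor (a w) = β.anchor (b w)), IsSmooth fun w => F (A.pair (a w) (b w) (h w))) :
    IsSmooth F := by
  refine .of_submersion fun e => ?_
  obtain ⟨W, j, w, a, b, h, hj, hw, hm⟩ := A.exists_lift e
  refine ⟨W, j, w, hj, hw, ?_⟩
  have := hF W a b h
  simpa only [hm] using this

/-- The first component of a representative. -/
def repFst (e : E) : P := (A.exists_pair e).choose

/-- The second component of a representative. -/
def repSnd (e : E) : Q := (A.exists_pair e).choose_spec.choose

theorem rep_anchor (e : E) : α.anchor (A.repFst e) = β.anchor (A.repSnd e) :=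
  (A.exists_pair e).choose_spec.choose_spec.choose

theorem pair_rep (e : E) : A.pair (A.repFst e) (A.repSnd e) (A.rep_anchor e) = e :=
  (A.exists_pair e).choose_spec.choose_spec.choose_spec

theorem exists_rep_pair (p : P) (q : Q) (h : α.anchor p = β.anchor q) :
    ∃ (g : Γ.Mor) (w : α.anchor (A.repFst (A.pair p q h)) = Γ.src g)
      (w' : β.anchor (A.repSnd (A.pair p q h)) = Γ.src g),
      α.act _ g w = p ∧ β.act _ g w' = q :=
  A.exists_of_pair_eq (A.pair_rep _)

end AssocQuotient

/-! #### Existence -/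

variable (t : TorsorStructure Γ S P) (β : RightAction Γ Q)

/-- The orbit relation of the diagonal action. -/
def assocSetoid (α : RightAction Γ P) (β : RightAction Γ Q) : Setoid (FiberSet α.anchor β.anchor) where
  r x y := ∃ (g : Γ.Mor) (w : α.anchor x.1.1 = Γ.src g) (w' : β.anchor x.1.2 = Γ.src g),
    α.act x.1.1 g w = y.1.1 ∧ β.act x.1.2 g w' = y.1.2
  iseqv := by
    refine ⟨fun x => ?_, ?_, ?_⟩
    · refine ⟨Γ.one (α.anchor x.1.1), (Γ.src_one _).symm, x.2.symm.trans (Γ.src_one _).symm,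
        α.act_one _, β.act_one' _ rfl _⟩
    · rintro x ⟨⟨p, q⟩, h⟩ ⟨g, w, w', h1, h2⟩
      simp only at h1 h2 h
      subst h1 h2
      exact ⟨Γ.inv g, _, _, α.act_inv _ g w, β.act_inv _ g w'⟩
    · rintro x ⟨⟨p, q⟩, h⟩ ⟨⟨p', q'⟩, h'⟩ ⟨g, w, w', h1, h2⟩ ⟨g', v, v', h3, h4⟩
      simp only at h1 h2 h h3 h4 h' v v'
      subst h1 h2 h3 h4
      have e : Γ.tgt g = Γ.src g' := (α.anchor_act _ _ _).symm.trans v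
      exact ⟨Γ.mul g g' e, w.trans (Γ.src_mul _ _ _).symm, w'.trans (Γ.src_mul _ _ _).symm,
        α.act_mul _ _ _ w e, β.act_mul _ _ _ w' e⟩

/-- Local sections of the projection of a torsor. -/
structure TorsorStructure.LocalSection where
  domain : TopologicalSpace.Opens S
  map : SmoothMap (S.restrict domain) P
  proj_map : ∀ u : domain, t.proj (map.toFun u) = u

theorem TorsorStructure.LocalSection.proj_apply {t : TorsorStructure Γ S P} (i : t.LocalSection)
    (u : S.restrict i.domain) : t.proj (i.map u) = S.incl i.domain u := i.proj_map u

theorem TorsorStructure.exists_localSection (p : P) :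
    ∃ (i : t.LocalSection) (h : t.proj p ∈ i.domain), i.map.toFun ⟨t.proj p, h⟩ = p := by
  obtain ⟨U, σ, hU, h1, h2⟩ := t.submersion_proj.exists_section p
  exact ⟨⟨U, σ, h2⟩, hU, h1⟩

variable {t β}

/-- The class of a pair of points. -/
def assocMk (α : RightAction Γ P) (β : RightAction Γ Q) (p : P) (q : Q)
    (h : α.anchor p = β.anchor q) : Quotient (assocSetoid α β) := Quotient.mk _ ⟨(p, q), h⟩

theorem assocMk_act (α : RightAction Γ P) (β : RightAction Γ Q) (p : P) (q : Q)
    (h : α.anchor p = β.anchor q) (g : Γ.Mor) (w : α.anchor p = Γ.src g)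
    (w' : β.anchor q = Γ.src g) (h') : assocMk α β (α.act p g w) (β.act q g w') h' =
      assocMk α β p q h :=
  (Quotient.sound (s := assocSetoid α β) ⟨g, w, w', rfl, rfl⟩).symm

theorem assocMk_congr (α : RightAction Γ P) (β : RightAction Γ Q) {p p' : P} {q q' : Q}
    (hp : p = p') (hq : q = q') (h : α.anchor p = β.anchor q) :
    assocMk α β p q h = assocMk α β p' q' (hp ▸ hq ▸ h) := by
  subst hp hq; rfl

/-- The pieces of the quotient: over the domain of a local section of the torsor `P`, it is a
pull-back of `Q`. -/
abbrev assocPiece (hβ : IsSubmersion β.anchor.toFun) (i : t.LocalSection) : SmoothManifold.{u} :=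
  fiberProd β.anchor (t.anchor.comp i.map) hβ

/-- The inclusions of the pieces. -/
def assocPieceMap (hβ : IsSubmersion β.anchor.toFun) (i : t.LocalSection) (v : assocPiece hβ i) :
    Quotient (assocSetoid t.toRightAction β) :=
  assocMk _ _ (i.map (fiberProd.snd hβ v)) (fiberProd.fst hβ v) (fiberProd.condition hβ v).symm

/-- Over the domain of a local section σ, each orbit has exactly one representative with first
component on σ, so the quotient there is a pull-back of `Q`. Passing to another section acts on `Q`
by the arrows between the two sections; their smoothness is the smoothness of division. -/
theorem assoc_glueData (ht : t.SmoothDiv) (hβ : IsSubmersion β.anchor.toFun) :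
    GlueData (Quotient (assocSetoid t.toRightAction β)) (assocPiece hβ) (assocPieceMap hβ) where
  injective i v v' h := by
    obtain ⟨g, w, w', h1, h2⟩ := Quotient.exact h
    simp only at h1 h2
    have h3 : fiberProd.snd hβ v = fiberProd.snd hβ v' := by
      refine Subtype.ext ((i.proj_map _).symm.trans (Eq.trans ?_ (i.proj_map _)))
      exact (t.proj_act _ _ w).symm.trans (congrArg t.proj.toFun h1)
    have h4 := t.eq_one_of_act_eq (h1.trans (congrArg i.map.toFun h3.symm))
    exact fiberProd.ext hβ ((β.act_one' _ h4 w').symm.trans h2) h3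
  surjective x := by
    obtain ⟨⟨⟨p, q⟩, h⟩, rfl⟩ := Quotient.exists_rep x
    obtain ⟨i, hi, hp⟩ := t.exists_localSection p
    refine ⟨i, fiberProd.mk hβ q ⟨t.proj p, hi⟩ ?_, ?_⟩
    · exact h.symm.trans (congrArg t.anchor.toFun hp.symm)
    · exact assocMk_congr _ _ hp rfl _
  transition i j v v' h := by
    obtain ⟨g, w, w', h1, h2⟩ := Quotient.exact h
    simp only at h1 h2
    let ρ := (S.incl i.domain).comp (fiberProd.snd (g := t.anchor.comp i.map) hβ)
    let O := ρ.preimage j.domain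
    let q := (fiberProd.fst hβ).comp ((assocPiece hβ i).incl O)
    let u := (fiberProd.snd hβ).comp ((assocPiece hβ i).incl O)
    let u' : SmoothMap ((assocPiece hβ i).restrict O) (S.restrict j.domain) := ρ.restrictPreimage _
    have hu : ∀ x, t.proj ((i.map.comp u) x) = t.proj ((j.map.comp u') x) := fun x =>
      (i.proj_apply _).trans (j.proj_apply (u' x)).symm
    let d := TorsorStructure.divMap ht (i.map.comp u) (j.map.comp u') hu
    have hqd : ∀ x, β.anchor (q x) = Γ.src (d x) := fun x =>
      (fiberProd.condition hβ _).trans (t.src_div (hu x))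
    refine ⟨O, fiberProd.lift hβ (β.actMap q d hqd) u' (fun x =>
      (β.anchor_act _ _ _).trans (t.tgt_div (hu x))), ?_, fun x => ?_⟩
    · have h3 : ρ v = S.incl j.domain (fiberProd.snd hβ v') := by
        refine ((i.proj_apply _).symm.trans (Eq.trans ?_ (j.proj_apply _)))
        exact (t.proj_act _ _ w).symm.trans (congrArg t.proj.toFun h1)
      change ρ v ∈ j.domain
      rw [h3]
      exact (fiberProd.snd hβ v').2
    · refine Eq.trans ?_ (assocMk_act _ _ (i.map (u x)) (q x)
        (fiberProd.condition hβ ((assocPiece hβ i).incl O x)).symm (d x)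
        (t.src_div (hu x)) (hqd x)
        ((t.anchor_act _ _ _).trans (β.anchor_act _ _ _).symm))
      exact assocMk_congr _ _ (t.act_div (hu x)).symm rfl _

/-- The quotient of the fiber product of a torsor and a manifold with an action exists. -/
theorem exists_assocQuotient (t : TorsorStructure Γ S P) (ht : t.SmoothDiv) (β : RightAction Γ Q)
    (hβ : IsSubmersion β.anchor.toFun) :
    ∃ E : SmoothManifold.{u}, Nonempty (AssocQuotient t.toRightAction β E) := by
  let G := assoc_glueData (β := β) ht hβ
  refine ⟨G.glue, ⟨⟨assocMk _ _, ?_, ?_, ?_, ?_⟩⟩⟩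
  · intro W a b h
    refine .of_submersion fun w₀ => ?_
    obtain ⟨i, hi, -⟩ := t.exists_localSection (a w₀)
    let ρ := t.proj.comp a
    let O := ρ.preimage i.domain
    let u : SmoothMap (W.restrict O) (S.restrict i.domain) := ρ.restrictPreimage _
    have hu : ∀ x, t.proj ((a.comp (W.incl O)) x) = t.proj ((i.map.comp u) x) := fun x =>
      (i.proj_apply (u x)).symm
    -- The family of pairs (a, b) is replaced by the equivalent family (a·d, b·d), whose first
    -- component is on the local section, so that it factors through one piece.
    let d := TorsorStructure.divMap ht _ _ hu
    have hbd : ∀ x, β.anchor ((b.comp (W.incl O)) x) = Γ.src (d x) := fun x =>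
      (h _).symm.trans (t.src_div (hu x))
    let τ : SmoothMap (W.restrict O) (assocPiece hβ i) :=
      fiberProd.lift hβ (β.actMap (b.comp (W.incl O)) d hbd) u (fun x =>
        (β.anchor_act _ _ _).trans (t.tgt_div (hu x)))
    refine ⟨W.restrict O, W.incl O, ⟨w₀, hi⟩, SmoothManifold.isSubmersion_incl _, rfl, ?_⟩
    refine ((G.piece i).comp τ).smooth.congr fun x => ?_
    refine (assocMk_act _ _ _ _ (h _) (d x) (t.src_div (hu x)) (hbd x)
        ((t.anchor_act _ _ _).trans (β.anchor_act _ _ _).symm)).symm.trans ?_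
    exact assocMk_congr _ _ (t.act_div (hu x)) rfl _
  · intro p q h g w w'
    exact assocMk_act _ _ p q h g w w' _
  · intro p q h p' q' h' e
    exact Quotient.exact e
  · intro e
    obtain ⟨i, v, rfl⟩ := G.surjective e
    obtain ⟨U, r, hU, -, hr⟩ := G.exists_inverse i v
    exact ⟨G.glue.restrict U, G.glue.incl U, ⟨_, hU⟩, i.map.comp ((fiberProd.snd hβ).comp r),
      (fiberProd.fst hβ).comp r, fun x => (fiberProd.condition hβ (r x)).symm,
      SmoothManifold.isSubmersion_incl _, rfl, fun x => hr x⟩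

end Assoc

/-! ### Bitorsors -/

namespace Bitorsor

variable {X Y : LieGroupoid.{u}} (B : Bitorsor X Y)

/-- The opposite bitorsor. -/
def op : Bitorsor Y X where
  Q := B.Q
  f := B.g
  g := B.f
  left := B.right
  right := B.left
  left_anchor := B.right_anchor
  left_proj := B.right_proj
  right_anchor := B.left_anchor
  right_proj := B.left_proj
  commute q y x hy hx := by
    obtain ⟨h1, h2, h3⟩ := B.commute q x y hx hy
    exact ⟨h2, h1, h3.symm⟩

theorem left_anchor_eq (q : B.Q) : B.left.anchor q = B.right.proj q := by
  rw [B.left_anchor, B.right_proj]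

theorem right_anchor_eq (q : B.Q) : B.right.anchor q = B.left.proj q := by
  rw [B.right_anchor, B.left_proj]

theorem right_anchor_left_act (q : B.Q) (x : X.Mor) (w : B.left.anchor q = X.src x) :
    B.right.anchor (B.left.act q x w) = B.right.anchor q := by
  rw [right_anchor_eq, right_anchor_eq, B.left.proj_act]

theorem left_anchor_right_act (q : B.Q) (y : Y.Mor) (w : B.right.anchor q = Y.src y) :
    B.left.anchor (B.right.act q y w) = B.left.anchor q := by
  rw [left_anchor_eq, left_anchor_eq, B.right.proj_act]

theorem act_comm (q : B.Q) (x : X.Mor) (y : Y.Mor) (hx : B.left.anchor q = X.src x)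
    (hy : B.right.anchor q = Y.src y) (hy' : B.right.anchor (B.left.act q x hx) = Y.src y)
    (hx' : B.left.anchor (B.right.act q y hy) = X.src x) :
    B.right.act (B.left.act q x hx) y hy' = B.left.act (B.right.act q y hy) x hx' := by
  obtain ⟨_, _, h⟩ := B.commute q x y hx hy
  exact h

theorem isSubmersion_left_anchor : IsSubmersion B.left.anchor.toFun := by
  rw [B.left_anchor, ← B.right_proj]
  exact B.right.submersion_proj

end Bitorsor

/-! ### The torsor associated to a torsor and a bitorsor -/

namespace AssocQuotient

variable {Γ Y : LieGroupoid.{u}} {S P E : SmoothManifold.{u}} {t : TorsorStructure Γ S P}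
  {B : Bitorsor Γ Y} (A : AssocQuotient t.toRightAction B.left.toRightAction E)

/-- The anchor map of the associated torsor. -/
def anchorFun (e : E) : Y.Obj := B.right.anchor (A.repSnd e)

/-- The projection of the associated torsor. -/
def projFun (e : E) : S := t.proj (A.repFst e)

variable {p : P} {q : B.Q} (h : t.anchor p = B.left.anchor q)

/-- The anchor for `Y` is the projection of the `Γ`-torsor, so it does not see the choice of
representative. -/
theorem anchorFun_pair : A.anchorFun (A.pair p q h) = B.right.anchor q := by
  obtain ⟨g, w, w', h1, h2⟩ := A.exists_rep_pair p q h
  rw [anchorFun, ← B.right_anchor_left_act _ g w']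
  exact congrArg _ h2

/-- The anchor map of the associated torsor, as a smooth map. -/
def anchorMap : SmoothMap E Y.Obj :=
  ⟨A.anchorFun, A.isSmooth_of_pair fun _ _ b h =>
    (B.right.anchor.comp b).smooth.congr fun w => A.anchorFun_pair (h w)⟩

/-- The action on the associated torsor. -/
def actFun (e : E) (y : Y.Mor) (w : A.anchorMap e = Y.src y) : E :=
  A.pair (A.repFst e) (B.right.act (A.repSnd e) y w)
    ((A.rep_anchor e).trans (B.left_anchor_right_act _ _ _).symm)

theorem projFun_pair : A.projFun (A.pair p q h) = t.proj p := by
  obtain ⟨g, w, w', h1, h2⟩ := A.exists_rep_pair p q h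
  rw [projFun, ← t.proj_act _ g w]
  exact congrArg _ h1

/-- Independence of the representative is where the commutation of the two actions on the bitorsor
enters. -/
theorem actFun_pair {y : Y.Mor} (w : A.anchorMap (A.pair p q h) = Y.src y) :
    A.actFun (A.pair p q h) y w = A.pair p (B.right.act q y ((A.anchorFun_pair h).symm.trans w))
      (h.trans (B.left_anchor_right_act _ _ _).symm) := by
  obtain ⟨g, v, v', h1, h2⟩ := A.exists_rep_pair p q h
  have v'' := v'.symm.trans (B.left_anchor_right_act _ y w).symm
  refine (A.pair_act _ _ ((A.rep_anchor _).trans (B.left_anchor_right_act _ _ _).symm)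
    g v v''.symm).symm.trans ?_
  refine A.pair_congr h1 ?_ _
  rw [← B.act_comm _ g y v' w ((B.right_anchor_left_act _ _ _).trans w)]
  exact B.right.act_congr h2 rfl _

theorem actFun_congr {e e' : E} (he : e = e') {y : Y.Mor} (w : A.anchorMap e = Y.src y) :
    A.actFun e y w = A.actFun e' y (he ▸ w) := by
  subst he; rfl

/-- The projection of the associated torsor, as a smooth map. -/
def projMap : SmoothMap E S :=
  ⟨A.projFun, A.isSmooth_of_pair fun _ a _ h =>
    (t.proj.comp a).smooth.congr fun w => A.projFun_pair (h w)⟩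

/-- The pairing on smooth families. -/
def pairMap {α : RightAction Γ P} {Q : SmoothManifold.{u}} {β : RightAction Γ Q}
    (A : AssocQuotient α β E) {W : SmoothManifold.{u}} (a : SmoothMap W P) (b : SmoothMap W Q)
    (h : ∀ w, α.anchor (a w) = β.anchor (b w)) : SmoothMap W E :=
  ⟨fun w => A.pair (a w) (b w) (h w), A.smooth_pair W a b h⟩

/-- On pairs, the projection is the composite of the base change of `B.left.anchor` with the
projection of `t`, both submersions. -/
theorem isSubmersion_projMap : IsSubmersion A.projMap.toFun := by
  refine .of_comp A.projMap.smooth fun e => ?_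
  obtain ⟨p, q, h, rfl⟩ := A.exists_pair e
  let hβ := B.isSubmersion_left_anchor
  refine ⟨fiberProd B.left.anchor t.anchor hβ, A.pairMap (fiberProd.snd hβ) (fiberProd.fst hβ)
    (fun x => (fiberProd.condition hβ x).symm), fiberProd.mk hβ q p h.symm, rfl, ?_⟩
  have h1 := t.submersion_proj.comp (fiberProd.isSubmersion_snd (g := t.anchor) hβ)
  have h2 : (fun x => A.projMap (A.pairMap (fiberProd.snd hβ) (fiberProd.fst hβ)
      (fun x => (fiberProd.condition hβ x).symm) x)) =
      fun x => t.proj ((fiberProd.snd (g := t.anchor) hβ) x) :=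
    funext fun x => A.projFun_pair _
  exact h2 ▸ h1

/-- The torsor associated to a torsor and a bitorsor. -/
def torsor : TorsorStructure Y S E where
  anchor := A.anchorMap
  act := A.actFun
  anchor_act e y w := by
    obtain ⟨p, q, h, rfl⟩ := A.exists_pair e
    rw [A.actFun_pair h w]
    exact (A.anchorFun_pair _).trans (B.right.anchor_act _ _ _)
  act_one e := by
    obtain ⟨p, q, h, rfl⟩ := A.exists_pair e
    rw [A.actFun_pair h]
    exact A.pair_congr rfl (B.right.act_one' _ rfl _) _
  act_mul e y z w w' := by
    obtain ⟨p, q, h, rfl⟩ := A.exists_pair e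
    rw [A.actFun_pair h, A.actFun_congr (A.actFun_pair h w), A.actFun_pair]
    exact A.pair_congr rfl (B.right.act_mul _ _ _ _ _) _
  smooth_act W a b w := by
    refine .of_submersion fun w₀ => ?_
    obtain ⟨W', j, w', p, q, h, hj, hw, hm⟩ := A.exists_lift_family a w₀
    have hy : ∀ x, B.right.anchor (q x) = Y.src ((b.comp j) x) := fun x => by
      rw [← A.anchorFun_pair (h x), hm x]
      exact w (j x)
    refine ⟨W', j, w', hj, hw, (A.pairMap p (B.right.actMap q (b.comp j) hy)
      (fun x => (h x).trans (B.left_anchor_right_act _ _ _).symm)).smooth.congr fun x => ?_⟩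
    rw [A.actFun_congr (hm x).symm, A.actFun_pair]
    rfl
  proj := A.projMap
  surjective_proj s := by
    obtain ⟨p, rfl⟩ := t.surjective_proj s
    obtain ⟨q, hq⟩ := B.right.surjective_proj (t.anchor p)
    exact ⟨A.pair p q (hq.symm.trans (B.left_anchor_eq q).symm), A.projFun_pair _⟩
  submersion_proj := A.isSubmersion_projMap
  proj_act e y w := by
    obtain ⟨p, q, h, rfl⟩ := A.exists_pair e
    rw [A.actFun_pair h w]
    exact (A.projFun_pair _).trans (A.projFun_pair h).symm
  existsUnique_act e e' he := by
    obtain ⟨p, q, h, rfl⟩ := A.exists_pair e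
    obtain ⟨p', q', h', rfl⟩ := A.exists_pair e'
    have hp : t.proj p' = t.proj p :=
      (A.projFun_pair h').symm.trans (he.symm.trans (A.projFun_pair h))
    -- move the second representative to `p`
    have hx := t.src_div hp
    have hx' := h'.symm.trans hx
    rw [← A.pair_act p' q' h' _ hx hx']
    have hq : B.right.proj q = B.right.proj (B.left.act q' _ hx') := by
      rw [← B.left_anchor_eq, ← B.left_anchor_eq, B.left.anchor_act, t.tgt_div, h]
    refine ⟨B.right.div _ _ hq, ⟨(A.anchorFun_pair h).trans (B.right.src_div hq), ?_⟩, ?_⟩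
    · refine (A.actFun_pair h _).trans ?_
      exact A.pair_congr (t.act_div hp).symm (B.right.act_div hq) _
    · rintro y ⟨w, hy⟩
      rw [A.actFun_pair h] at hy
      obtain ⟨g, v, v', h1, h2⟩ := A.exists_of_pair_eq hy
      refine B.right.eq_div hq ((A.anchorFun_pair h).symm.trans w) ?_
      have h3 := t.eq_one_of_act_eq (h1.trans (t.act_div hp))
      exact (B.left.act_one' _ h3 _).symm.trans h2

@[simp]
theorem torsor_anchor_pair : A.torsor.anchor (A.pair p q h) = B.right.anchor q :=
  A.anchorFun_pair h

@[simp]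
theorem torsor_proj_pair : A.torsor.proj (A.pair p q h) = t.proj p :=
  A.projFun_pair h

theorem torsor_act_pair {y : Y.Mor} (w : A.torsor.anchor (A.pair p q h) = Y.src y) :
    A.torsor.act (A.pair p q h) y w =
      A.pair p (B.right.act q y ((A.anchorFun_pair h).symm.trans w))
        (h.trans (B.left_anchor_right_act _ _ _).symm) :=
  A.actFun_pair h w

end AssocQuotient

/-- The composition of bitorsors. -/
theorem Bitorsor.nonempty_comp {X Y Z : LieGroupoid.{u}} (B : Bitorsor X Z) (C : Bitorsor Z Y)
    (hB : B.right.SmoothDiv) : Nonempty (Bitorsor X Y) := by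
  obtain ⟨E, ⟨A⟩⟩ := exists_assocQuotient B.right hB C.left.toRightAction
    C.isSubmersion_left_anchor
  -- The same quotient, read from the other side, is the torsor associated to `C.left` and the
  -- opposite of `B`. The two readings give the two torsor structures on `E`, and division is needed
  -- only for `B.right`.
  let A' : AssocQuotient C.left.toRightAction B.op.left.toRightAction E := A.swap
  have h1 : ∀ e, A.torsor.anchor e = A'.torsor.proj e := fun e => by
    obtain ⟨p, q, h, rfl⟩ := A.exists_pair e
    exact (A.torsor_anchor_pair h).trans ((C.right_anchor_eq q).trans
      (A'.torsor_proj_pair h.symm).symm)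
  have h2 : ∀ e, A.torsor.proj e = A'.torsor.anchor e := fun e => by
    obtain ⟨p, q, h, rfl⟩ := A.exists_pair e
    exact (A.torsor_proj_pair h).trans ((B.left_anchor_eq p).symm.trans
      (A'.torsor_anchor_pair h.symm).symm)
  refine ⟨⟨E, A'.torsor.anchor, A'.torsor.proj, A'.torsor, A.torsor, rfl, rfl,
    SmoothMap.ext (funext h1), SmoothMap.ext (funext h2), fun e x y hx hy => ?_⟩⟩
  refine ⟨(h1 _).trans ((A'.torsor.proj_act _ _ _).trans ((h1 e).symm.trans hy)),
    (h2 _).symm.trans ((A.torsor.proj_act _ _ _).trans ((h2 e).trans hx)), ?_⟩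
  obtain ⟨p, q, h, rfl⟩ := A.exists_pair e
  have e1 := A'.torsor_act_pair h.symm hx
  have e2 := A.torsor_act_pair h hy
  refine (A.torsor.act_congr e1 rfl _).trans (Eq.trans ?_ (A'.torsor.act_congr e2 rfl _).symm)
  exact (A.torsor_act_pair _ _).trans (A'.torsor_act_pair
    (p := C.right.act q y _) (q := p) ((C.left_anchor_right_act q y _).trans h.symm) _).symm

/-! ### Pull-backs of the unit torsor -/

section PullUnit

variable {Γ : LieGroupoid.{u}} {W : SmoothManifold.{u}} (a : SmoothMap W Γ.Obj)

/-- The total space of the pull-back of the unit torsor along `a`. -/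
abbrev unitTotal : SmoothManifold.{u} := fiberProd Γ.src a Γ.submersion_src

/-- The arrow of a point of a pull-back of the unit torsor. -/
abbrev unitArrow : SmoothMap (unitTotal a) Γ.Mor := fiberProd.fst Γ.submersion_src

/-- The base point of a point of a pull-back of the unit torsor. -/
abbrev unitPoint : SmoothMap (unitTotal a) W := fiberProd.snd Γ.submersion_src

variable {a} in
/-- The point of a pull-back of the unit torsor given by an arrow and a base point. -/
abbrev unitMk (g : Γ.Mor) (w : W) (h : Γ.src g = a w) : unitTotal a :=
  fiberProd.mk Γ.submersion_src g w h

/-- The torsor structure on the pull-back of the unit torsor. -/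
def unitTorsor : TorsorStructure Γ W (unitTotal a) where
  anchor := Γ.tgt.comp (unitArrow a)
  act p g w := unitMk (Γ.mul (unitArrow a p) g w) (unitPoint a p)
    ((Γ.src_mul _ _ _).trans (fiberProd.condition _ p))
  anchor_act p g w := Γ.tgt_mul _ _ _
  act_one p := fiberProd.ext _ (Γ.mul_one _) rfl
  act_mul p g h w w' := fiberProd.ext _ (Γ.mul_assoc _ _ _ w w').symm rfl
  smooth_act V p g w := (fiberProd.lift Γ.submersion_src
    (LieGroupoid.mulMap ((unitArrow a).comp p) g w) ((unitPoint a).comp p)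
    fun x => (Γ.src_mul _ _ _).trans (fiberProd.condition _ (p x))).smooth
  proj := unitPoint a
  surjective_proj w := ⟨unitMk (Γ.one (a w)) w (Γ.src_one _), rfl⟩
  submersion_proj := fiberProd.isSubmersion_snd _
  proj_act p g w := rfl
  existsUnique_act p p' h := by
    have h1 : Γ.src (unitArrow a p) = Γ.src (unitArrow a p') := by
      rw [fiberProd.condition _ p, fiberProd.condition _ p']
      exact congrArg a.toFun h
    refine ⟨Γ.mul (Γ.inv (unitArrow a p)) (unitArrow a p') ((Γ.tgt_inv _).trans h1),
      ⟨(Γ.src_inv _).symm.trans (Γ.src_mul _ _ _).symm, ?_⟩, ?_⟩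
    · exact fiberProd.ext _ (Γ.mul_inv_cancel_left _ _ h1) h
    · rintro g ⟨w, hg⟩
      have h2 : Γ.mul (unitArrow a p) g w = unitArrow a p' :=
        congrArg (unitArrow a).toFun hg
      exact Γ.mul_left_cancel (h2.trans (Γ.mul_inv_cancel_left _ _ h1).symm)

end PullUnit

/-- The one-point manifold. -/
def point : SmoothManifold.{u} where
  carrier := PUnit
  topology := ⊥
  atlas := {⟨0, Homeomorph.toOpenPartialHomeomorph
    { toFun := fun _ => 0
      invFun := fun _ => PUnit.unit
      left_inv := fun _ => rfl
      right_inv := fun _ => Subsingleton.elim _ _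
      continuous_toFun := continuous_const
      continuous_invFun := continuous_const }⟩}
  exists_chart x := ⟨_, rfl, Set.mem_univ x⟩
  compatible := by
    rintro e - e' -
    exact contDiffOn_const.congr fun x _ => (rfl : _ = e'.2 PUnit.unit)

/-- The constant map from the one-point manifold. -/
def SmoothMap.ofPoint {M : SmoothManifold.{u}} (m : M) : SmoothMap point M :=
  ⟨fun _ => m, isSmooth_const m⟩

theorem fiberProd.isSubmersion_fst {M M' N : SmoothManifold.{u}} {f : SmoothMap M N}
    {g : SmoothMap M' N} (hf : IsSubmersion f.toFun) (hg : IsSubmersion g.toFun) :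
    IsSubmersion (fiberProd.fst (g := g) hf).toFun := by
  refine .of_comp (fiberProd.fst hf).smooth fun m => ?_
  refine ⟨fiberProd g f hg, fiberProd.lift hf (fiberProd.snd hg) (fiberProd.fst hg)
    fun x => (fiberProd.condition hg x).symm,
    fiberProd.mk hg (fiberProd.snd hf m) (fiberProd.fst hf m) (fiberProd.condition hf m).symm, ?_,
    fiberProd.isSubmersion_snd hg⟩
  exact fiberProd.ext hf rfl rfl

/-! ### Cancellation rules in a groupoid. -/

namespace LieGroupoid

variable (X : LieGroupoid.{u})

theorem mul_inv_mul_cancel (g h : X.Mor) (w : X.tgt g = X.tgt h) :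
    X.mul (X.mul g (X.inv h) (w.trans (X.src_inv h).symm)) h
      ((X.tgt_mul _ _ _).trans (X.tgt_inv h)) = g := by
  rw [X.mul_assoc _ _ _ _ (X.tgt_inv h), X.mul_congr rfl (X.inv_mul h),
    X.mul_congr rfl (congrArg X.one.toFun w.symm), X.mul_one]

theorem mul_mul_inv_cancel (g h : X.Mor) (w : X.tgt g = X.src h) :
    X.mul (X.mul g h w) (X.inv h) ((X.tgt_mul _ _ _).trans (X.src_inv h).symm) = g := by
  rw [X.mul_assoc _ _ _ _ (X.src_inv h).symm, X.mul_congr rfl (X.mul_inv h),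
    X.mul_congr rfl (congrArg X.one.toFun w.symm), X.mul_one]

theorem mul_right_cancel {g g' h : X.Mor} {w : X.tgt g = X.src h} {w' : X.tgt g' = X.src h}
    (e : X.mul g h w = X.mul g' h w') : g = g' := by
  rw [← X.mul_mul_inv_cancel g h w, X.mul_congr e rfl, X.mul_mul_inv_cancel g' h w']

theorem inv_one (x : X.Obj) : X.inv (X.one x) = X.one x := by
  have h : X.tgt (X.inv (X.one x)) = x := (X.tgt_inv _).trans (X.src_one x)
  have h1 := X.mul_one (X.inv (X.one x))
  rw [X.mul_congr rfl (congrArg X.one.toFun h)] at h1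
  rw [← h1, X.inv_mul, X.tgt_one]

theorem inv_mul_rev_mul (g h x : X.Mor) (w : X.tgt g = X.src h) (w' : X.src g = X.src x) :
    X.mul (X.inv (X.mul g h w)) x ((X.tgt_inv _).trans ((X.src_mul _ _ _).trans w')) =
      X.mul (X.inv h) (X.mul (X.inv g) x ((X.tgt_inv g).trans w'))
        ((X.tgt_inv h).trans (w.symm.trans ((X.src_inv g).symm.trans (X.src_mul _ _ _).symm))) := by
  have e : X.src h = X.src (X.mul (X.inv g) x ((X.tgt_inv g).trans w')) :=
    w.symm.trans ((X.src_inv g).symm.trans (X.src_mul _ _ _).symm)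
  refine X.mul_left_cancel (g := X.mul g h w)
    (w := ((X.src_inv _).symm).trans (X.src_mul _ _ _).symm)
    (w' := (X.tgt_mul _ _ _).trans ((X.src_inv h).symm.trans (X.src_mul _ _ _).symm)) ?_
  have e' : X.tgt h = X.src (X.mul (X.inv h) _ ((X.tgt_inv h).trans e)) :=
    (X.src_inv h).symm.trans (X.src_mul _ _ _).symm
  rw [X.mul_inv_cancel_left _ _ ((X.src_mul _ _ _).trans w'), X.mul_assoc _ _ _ w e',
    X.mul_congr rfl (X.mul_inv_cancel_left _ _ e), X.mul_inv_cancel_left _ _ w']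

end LieGroupoid

/-! ### The bitorsor of a Morita morphism -/

namespace LieGroupoid.Hom

variable {Z X : LieGroupoid.{u}} (φ : Z.Hom X)


variable {φ}

/-- The cartesian square, tested on the one-point manifold, is cartesian on points. -/
theorem IsMorita.exists_arrow (hφ : φ.IsMorita) (a b : Z.Obj) (x : X.Mor)
    (hs : X.src x = φ.obj a) (ht : X.tgt x = φ.obj b) :
    ∃ z, Z.src z = a ∧ Z.tgt z = b ∧ φ.mor z = x := by
  obtain ⟨d, ⟨h1, h2, h3⟩, -⟩ := hφ.cartesian point (.ofPoint a) (.ofPoint b) (.ofPoint x)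
    (fun _ => hs) (fun _ => ht)
  exact ⟨d PUnit.unit, h1 _, h2 _, h3 _⟩

theorem IsMorita.arrow_ext (hφ : φ.IsMorita) {z z' : Z.Mor} (hs : Z.src z = Z.src z')
    (ht : Z.tgt z = Z.tgt z') (h : φ.mor z = φ.mor z') : z = z' := by
  obtain ⟨d, -, hd⟩ := hφ.cartesian point (.ofPoint (Z.src z)) (.ofPoint (Z.tgt z))
    (.ofPoint (φ.mor z)) (fun _ => φ.src_mor z) (fun _ => φ.tgt_mor z)
  have h1 := hd (.ofPoint z) ⟨fun _ => rfl, fun _ => rfl, fun _ => rfl⟩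
  have h2 := hd (.ofPoint z') ⟨fun _ => hs.symm, fun _ => ht.symm, fun _ => h.symm⟩
  exact congrArg (fun f : SmoothMap point Z.Mor => f PUnit.unit) (h1.trans h2.symm)

theorem inv_mor_composable (p : unitTotal φ.obj) (z : Z.Mor) (w : unitPoint φ.obj p = Z.src z) :
    X.tgt (X.inv (φ.mor z)) = X.src (unitArrow φ.obj p) := by
  rw [X.tgt_inv, φ.src_mor, fiberProd.condition _ p]
  exact congrArg φ.obj.toFun w.symm

variable (φ) in
/-- The right action of the source of a morphism of Lie groupoids on the pull-back of the unit
torsor of the target. -/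
def pullAction : RightAction Z (unitTotal φ.obj) where
  anchor := unitPoint φ.obj
  act p z w := unitMk (X.mul (X.inv (φ.mor z)) (unitArrow φ.obj p) (inv_mor_composable p z w))
    (Z.tgt z) ((X.src_mul _ _ _).trans ((X.src_inv _).trans (φ.tgt_mor z)))
  anchor_act p z w := rfl
  act_one p := by
    refine fiberProd.ext _ ?_ (Z.tgt_one _)
    have h1 : X.inv (φ.mor (Z.one (unitPoint φ.obj p))) = X.one (X.src (unitArrow φ.obj p)) := by
      rw [φ.mor_one, X.inv_one, fiberProd.condition _ p]
    exact (X.mul_congr h1 rfl _).trans (X.one_mul _)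
  act_mul p z z' w w' := by
    refine fiberProd.ext _ ?_ (Z.tgt_mul _ _ _)
    refine (X.mul_congr (congrArg X.inv.toFun (φ.mor_mul z z' w')) rfl _).trans ?_
    refine X.inv_mul_rev_mul _ _ _ _ ?_
    rw [← X.tgt_inv]
    exact inv_mor_composable p z w
  smooth_act W p z w := (fiberProd.lift X.submersion_src
    (LieGroupoid.mulMap ((X.inv.comp φ.mor).comp z) ((unitArrow φ.obj).comp p)
      fun x => inv_mor_composable _ _ (w x)) (Z.tgt.comp z)
    fun x => (X.src_mul _ _ _).trans ((X.src_inv _).trans (φ.tgt_mor _))).smooth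

/-- The action takes (x, a) to (φ(z)⁻¹x, tgt z). Solving for φ(z) turns division into a lifting
problem for the square of a Morita morphism. -/
theorem pullAction_act_eq_iff {p p' : unitTotal φ.obj} {z : Z.Mor}
    (h : X.tgt (unitArrow φ.obj p) = X.tgt (unitArrow φ.obj p'))
    (w : unitPoint φ.obj p = Z.src z) : (pullAction φ).act p z w = p' ↔
      Z.tgt z = unitPoint φ.obj p' ∧ φ.mor z = X.mul (unitArrow φ.obj p)
        (X.inv (unitArrow φ.obj p')) (h.trans (X.src_inv _).symm) := by
  have hs : X.src (φ.mor z) = X.src (unitArrow φ.obj p) :=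
    (X.tgt_inv _).symm.trans (inv_mor_composable p z w)
  constructor
  · rintro rfl
    refine ⟨rfl, ?_⟩
    have e := X.mul_inv_cancel_left _ _ hs
    exact X.mul_right_cancel (e.trans (X.mul_inv_mul_cancel _ _ h).symm)
  · rintro ⟨h1, h2⟩
    refine fiberProd.ext _ ?_ h1
    have h3 : X.tgt (φ.mor z) = X.src (unitArrow φ.obj p') := by
      rw [φ.tgt_mor, h1]
      exact (fiberProd.condition _ p').symm
    have h4 : X.mul (φ.mor z) (unitArrow φ.obj p') h3 = unitArrow φ.obj p :=
      (X.mul_congr h2 rfl _).trans (X.mul_inv_mul_cancel _ _ h)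
    refine X.mul_left_cancel (w := (X.src_inv _).symm.trans (X.src_mul _ _ _).symm) (w' := h3) ?_
    exact (X.mul_inv_cancel_left _ _ hs).trans h4.symm

/-- The torsor over the objects of the target given by a Morita morphism. -/
def pullTorsor (hφ : φ.IsMorita) : TorsorStructure Z X.Obj (unitTotal φ.obj) where
  toRightAction := pullAction φ
  proj := X.tgt.comp (unitArrow φ.obj)
  surjective_proj x := by
    obtain ⟨z, rfl⟩ := hφ.surjective_obj x
    exact ⟨unitMk (X.one (φ.obj z)) z (X.src_one _), X.tgt_one _⟩
  submersion_proj := X.submersion_tgt.comp (fiberProd.isSubmersion_fst _ hφ.submersion_obj)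
  proj_act p z w := X.tgt_mul _ _ _
  existsUnique_act p p' h := by
    obtain ⟨z, h1, h2, h3⟩ := hφ.exists_arrow (unitPoint φ.obj p) (unitPoint φ.obj p')
      (X.mul (unitArrow φ.obj p) (X.inv (unitArrow φ.obj p'))
        (Eq.trans h (X.src_inv _).symm))
      ((X.src_mul _ _ _).trans (fiberProd.condition _ p))
      ((X.tgt_mul _ _ _).trans ((X.tgt_inv _).trans (fiberProd.condition _ p')))
    refine ⟨z, ⟨h1.symm, (pullAction_act_eq_iff h h1.symm).2 ⟨h2, h3⟩⟩, ?_⟩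
    rintro z' ⟨w, hz⟩
    obtain ⟨h4, h5⟩ := (pullAction_act_eq_iff h w).1 hz
    exact hφ.arrow_ext (w.symm.trans h1.symm) (h4.trans h2.symm) (h5.trans h3.symm)

/-- The universal property of the cartesian square produces the dividing arrows as a smooth map,
without any countability of `Z`. -/
theorem smoothDiv_pullTorsor (hφ : φ.IsMorita) : (pullTorsor hφ).SmoothDiv := by
  intro W a b h
  obtain ⟨d, ⟨h1, h2, h3⟩, -⟩ := hφ.cartesian W ((unitPoint φ.obj).comp a)
    ((unitPoint φ.obj).comp b) (LieGroupoid.mulMap ((unitArrow φ.obj).comp a)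
      ((X.inv.comp (unitArrow φ.obj)).comp b) fun x => Eq.trans (h x) (X.src_inv _).symm)
    (fun x => (X.src_mul _ _ _).trans (fiberProd.condition _ (a x)))
    (fun x => (X.tgt_mul _ _ _).trans ((X.tgt_inv _).trans (fiberProd.condition _ (b x))))
  refine d.smooth.congr fun x => ((pullTorsor hφ).eq_div (h x) (h1 x).symm ?_).symm
  exact (pullAction_act_eq_iff (h x) (h1 x).symm).2 ⟨h2 x, h3 x⟩

/-- The bitorsor of a Morita morphism. -/
def bitorsor (hφ : φ.IsMorita) : Bitorsor X Z where
  Q := unitTotal φ.obj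
  f := X.tgt.comp (unitArrow φ.obj)
  g := unitPoint φ.obj
  left := unitTorsor φ.obj
  right := pullTorsor hφ
  left_anchor := rfl
  left_proj := rfl
  right_anchor := rfl
  right_proj := rfl
  commute _ _ _ hx hz := ⟨hz, (X.tgt_mul _ _ _).trans hx,
    fiberProd.ext _ (X.mul_assoc _ _ _ _ hx).symm rfl⟩

end LieGroupoid.Hom

/-- Morita equivalent Lie groupoids have a bitorsor. -/
theorem MoritaEquivalent.nonempty_bitorsor {X Y : LieGroupoid.{u}} (h : MoritaEquivalent X Y) :
    Nonempty (Bitorsor X Y) := by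
  obtain ⟨Z, φ, ψ, hφ, hψ⟩ := h
  exact (LieGroupoid.Hom.bitorsor hφ).nonempty_comp (LieGroupoid.Hom.bitorsor hψ).op
    (LieGroupoid.Hom.smoothDiv_pullTorsor hφ)

/-! ### The pull-back of a Lie groupoid along a submersion -/

section PullGroupoid

variable {X : LieGroupoid.{u}} {M : SmoothManifold.{u}} {a : SmoothMap M X.Obj}
  (ha : IsSubmersion a.toFun)

/-- The manifold of arrows of `X` together with lifts of their source and target to `M`. -/
abbrev pullMor : SmoothManifold.{u} := fiberProd a (X.tgt.comp (unitArrow a)) ha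

/-- The lift of the source. -/
abbrev pullSrc : SmoothMap (pullMor ha) M := (unitPoint a).comp (fiberProd.snd ha)

/-- The lift of the target. -/
abbrev pullTgt : SmoothMap (pullMor ha) M := fiberProd.fst ha

/-- The underlying arrow. -/
abbrev pullArrow : SmoothMap (pullMor ha) X.Mor := (unitArrow a).comp (fiberProd.snd ha)

theorem src_pullArrow (m : pullMor ha) : X.src (pullArrow ha m) = a (pullSrc ha m) :=
  fiberProd.condition X.submersion_src (fiberProd.snd ha m)

theorem tgt_pullArrow (m : pullMor ha) : X.tgt (pullArrow ha m) = a (pullTgt ha m) :=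
  (fiberProd.condition ha m).symm

variable {ha} in
theorem pullMor_ext {m m' : pullMor ha} (h1 : pullSrc ha m = pullSrc ha m')
    (h2 : pullTgt ha m = pullTgt ha m') (h3 : pullArrow ha m = pullArrow ha m') : m = m' :=
  fiberProd.ext ha h2 (fiberProd.ext X.submersion_src h3 h1)

/-- Smooth maps into the manifold of arrows of the pull-back. -/
def pullLift {W : SmoothManifold.{u}} (p q : SmoothMap W M) (x : SmoothMap W X.Mor)
    (h : ∀ w, X.src (x w) = a (p w)) (h' : ∀ w, X.tgt (x w) = a (q w)) : SmoothMap W (pullMor ha) :=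
  fiberProd.lift ha q (fiberProd.lift X.submersion_src x p h) fun w => (h' w).symm

/-- The point of the manifold of arrows of the pull-back given by an arrow and lifts of its source
and target. -/
abbrev pullMk (p q : M) (x : X.Mor) (h : X.src x = a p) (h' : X.tgt x = a q) : pullMor ha :=
  fiberProd.mk ha q (unitMk x p h) h'.symm

theorem pull_composable {m n : pullMor ha} (w : pullTgt ha m = pullSrc ha n) :
    X.tgt (pullArrow ha m) = X.src (pullArrow ha n) :=
  (tgt_pullArrow ha m).trans ((congrArg a.toFun w).trans (src_pullArrow ha n).symm)

/-- The pull-back of a Lie groupoid along a submersion to its manifold of objects. -/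
def pullGroupoid : LieGroupoid.{u} where
  Obj := M
  Mor := pullMor ha
  src := pullSrc ha
  tgt := pullTgt ha
  one := pullLift ha (.id M) (.id M) (X.one.comp a) (fun _ => X.src_one _) (fun _ => X.tgt_one _)
  inv := pullLift ha (pullTgt ha) (pullSrc ha) (X.inv.comp (pullArrow ha))
    (fun m => (X.src_inv _).trans (tgt_pullArrow ha m))
    (fun m => (X.tgt_inv _).trans (src_pullArrow ha m))
  mul m n w := pullMk ha (pullSrc ha m) (pullTgt ha n)
    (X.mul (pullArrow ha m) (pullArrow ha n) (pull_composable ha w))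
    ((X.src_mul _ _ _).trans (src_pullArrow ha m)) ((X.tgt_mul _ _ _).trans (tgt_pullArrow ha n))
  submersion_src := (fiberProd.isSubmersion_snd _).comp (fiberProd.isSubmersion_snd ha)
  submersion_tgt := fiberProd.isSubmersion_fst ha
    (X.submersion_tgt.comp (fiberProd.isSubmersion_fst X.submersion_src ha))
  src_one _ := rfl
  tgt_one _ := rfl
  src_inv _ := rfl
  tgt_inv _ := rfl
  src_mul _ _ _ := rfl
  tgt_mul _ _ _ := rfl
  one_mul m := pullMor_ext rfl rfl
    ((X.mul_congr (congrArg X.one.toFun (src_pullArrow ha m).symm) rfl _).trans (X.one_mul _))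
  mul_one m := pullMor_ext rfl rfl
    ((X.mul_congr rfl (congrArg X.one.toFun (tgt_pullArrow ha m).symm) _).trans (X.mul_one _))
  mul_inv m := pullMor_ext rfl rfl
    ((X.mul_inv _).trans (congrArg X.one.toFun (src_pullArrow ha m)))
  inv_mul m := pullMor_ext rfl rfl
    ((X.inv_mul _).trans (congrArg X.one.toFun (tgt_pullArrow ha m)))
  mul_assoc _ _ _ w w' := pullMor_ext rfl rfl
    (X.mul_assoc _ _ _ (pull_composable ha w) (pull_composable ha w'))
  smooth_mul _ m n w := (pullLift ha ((pullSrc ha).comp m) ((pullTgt ha).comp n)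
    (LieGroupoid.mulMap ((pullArrow ha).comp m) ((pullArrow ha).comp n)
      fun p => pull_composable ha (w p))
    (fun p => (X.src_mul _ _ _).trans (src_pullArrow ha (m p)))
    (fun p => (X.tgt_mul _ _ _).trans (tgt_pullArrow ha (n p)))).smooth

/-- The projection from the pull-back of a Lie groupoid. -/
def pullHom : (pullGroupoid ha).Hom X where
  obj := a
  mor := pullArrow ha
  src_mor := src_pullArrow ha
  tgt_mor := tgt_pullArrow ha
  mor_one _ := rfl
  mor_mul _ _ _ := rfl

theorem isMorita_pullHom (hs : Function.Surjective a.toFun) : (pullHom ha).IsMorita where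
  surjective_obj := hs
  submersion_obj := ha
  cartesian W p q x h h' := by
    refine ⟨pullLift ha p q x h h', ⟨fun _ => rfl, fun _ => rfl, fun _ => rfl⟩, ?_⟩
    rintro d ⟨h1, h2, h3⟩
    exact SmoothMap.ext (funext fun w => pullMor_ext (h1 w) (h2 w) (h3 w))

end PullGroupoid

/-! ### The Morita equivalence of a bitorsor -/

namespace Bitorsor

variable {X Y : LieGroupoid.{u}} (B : Bitorsor X Y)

theorem surjective_left_anchor : Function.Surjective B.left.anchor.toFun := by
  rw [B.left_anchor, ← B.right_proj]
  exact B.right.surjective_proj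

/-- Translation of the source of an arrow of the pull-back groupoid along the left anchor. -/
def translate : SmoothMap (pullMor B.isSubmersion_left_anchor) B.Q :=
  B.left.actMap (pullSrc _) (pullArrow _) fun m => (src_pullArrow _ m).symm

theorem right_proj_translate (m : pullMor B.isSubmersion_left_anchor) :
    B.right.proj (B.translate m) = B.right.proj (pullTgt _ m) := by
  rw [← B.left_anchor_eq, ← B.left_anchor_eq, translate, RightAction.actMap_apply,
    B.left.anchor_act, tgt_pullArrow]

theorem right_anchor_translate (m : pullMor B.isSubmersion_left_anchor) :
    B.right.anchor (B.translate m) = B.right.anchor (pullSrc _ m) :=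
  B.right_anchor_left_act _ _ _

theorem right_act_translate (m : pullMor B.isSubmersion_left_anchor) (y : Y.Mor)
    (w : B.right.anchor (pullSrc _ m) = Y.src y)
    (w' : B.left.anchor (B.right.act (pullSrc _ m) y w) = X.src (pullArrow _ m)) :
    B.right.act (B.translate m) y ((B.right_anchor_translate m).trans w) =
      B.left.act (B.right.act (pullSrc _ m) y w) (pullArrow _ m) w' :=
  B.act_comm _ _ _ (src_pullArrow _ m).symm w _ _

variable {B}

/-- The morphism from the pull-back groupoid along the left anchor of a bitorsor to the right
groupoid. -/
def pullHomRight (hB : B.right.SmoothDiv) : (pullGroupoid B.isSubmersion_left_anchor).Hom Y where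
  obj := B.right.anchor
  -- An arrow (q, x, q') goes to the unique y with (q·x)·y = q'.
  mor := TorsorStructure.divMap hB B.translate (pullTgt _) B.right_proj_translate
  src_mor m := (B.right.src_div (B.right_proj_translate m)).symm.trans (B.right_anchor_translate m)
  tgt_mor m := B.right.tgt_div (B.right_proj_translate m)
  mor_one q := by
    have h1 : B.translate ((pullGroupoid B.isSubmersion_left_anchor).one q) = q :=
      B.left.act_one q
    refine (B.right.eq_div (B.right_proj_translate _)
      ((congrArg _ h1).trans (Y.src_one _).symm) ?_).symm
    exact (B.right.act_one' _ rfl _).trans h1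
  mor_mul m n w := by
    have hm := B.right_proj_translate m
    have hn := B.right_proj_translate n
    have w1 : B.right.anchor (B.translate ((pullGroupoid _).mul m n w)) =
        Y.src (B.right.div _ _ hm) :=
      (B.right_anchor_translate _).trans
        ((B.right_anchor_translate m).symm.trans (B.right.src_div hm))
    have w2 : Y.tgt (B.right.div _ _ hm) = Y.src (B.right.div _ _ hn) :=
      (B.right.tgt_div hm).trans ((congrArg _ w).trans
        ((B.right_anchor_translate n).symm.trans (B.right.src_div hn)))
    have w3 : B.left.anchor (B.translate m) = X.src (pullArrow _ n) :=
      (B.left.anchor_act _ _ _).trans (pull_composable _ w)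
    have w4 : B.left.anchor (B.right.act (B.translate m) _ (B.right.src_div hm)) =
        X.src (pullArrow _ n) := (B.left_anchor_right_act _ _ _).trans w3
    refine (B.right.eq_div (B.right_proj_translate _)
      (w1.trans (Y.src_mul _ _ w2).symm) ?_).symm
    have h1 : B.translate ((pullGroupoid _).mul m n w) = B.left.act (B.translate m) _ w3 :=
      B.left.act_mul _ _ _ _ (pull_composable _ w)
    -- For m = (q, x, q') and n = (q', x', q''), commutation gives q·x·x'·y = (q·x·y)·x' = q'·x',
    -- where y is the image of m.
    have h2 : B.right.act (B.translate ((pullGroupoid _).mul m n w)) _ w1 = B.translate n := by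
      rw [B.right.act_congr h1 rfl, B.act_comm _ _ _ w3 (B.right.src_div hm) _ w4]
      exact B.left.act_congr ((B.right.act_div hm).trans w) rfl _
    rw [B.right.act_mul _ _ _ w1 w2, B.right.act_congr h2 rfl, B.right.act_div hn]
    rfl

/-- The bitorsor is symmetric: (p·x)·y = q exactly when (p·y)·x = q. Given p, q and y, the arrow x
is therefore the quotient of p·y and q in the torsor under `X`. -/
theorem existsUnique_pullHomRight (hB : B.right.SmoothDiv) (hB' : B.left.SmoothDiv)
    {W : SmoothManifold.{u}} (p q : SmoothMap W B.Q) (y : SmoothMap W Y.Mor)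
    (h : ∀ w, Y.src (y w) = B.right.anchor (p w)) (h' : ∀ w, Y.tgt (y w) = B.right.anchor (q w)) :
    ∃! d : SmoothMap W (pullMor B.isSubmersion_left_anchor), (∀ w, pullSrc _ (d w) = p w) ∧
      (∀ w, pullTgt _ (d w) = q w) ∧ ∀ w, (pullHomRight hB).mor (d w) = y w := by
  let py : SmoothMap W B.Q := B.right.actMap p y fun w => (h w).symm
  have h1 : ∀ w, B.left.proj (py w) = B.left.proj (q w) := fun w => by
    rw [← B.right_anchor_eq, ← B.right_anchor_eq]
    exact (B.right.anchor_act _ _ _).trans (h' w)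
  let x := TorsorStructure.divMap hB' py q h1
  have h2 : ∀ w, X.src (x w) = B.left.anchor (p w) := fun w =>
    (B.left.src_div (h1 w)).symm.trans (B.left_anchor_right_act _ _ _)
  have h3 : ∀ w, X.tgt (x w) = B.left.anchor (q w) := fun w => B.left.tgt_div (h1 w)
  refine ⟨pullLift B.isSubmersion_left_anchor p q x h2 h3,
    ⟨fun _ => rfl, fun _ => rfl, fun w => ?_⟩, ?_⟩
  · let m := pullLift B.isSubmersion_left_anchor p q x h2 h3 w
    refine (B.right.eq_div (B.right_proj_translate m)
      ((B.right_anchor_translate m).trans (h w).symm) ?_).symm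
    refine (B.right_act_translate m _ (h w).symm (B.left.src_div (h1 w))).trans ?_
    exact B.left.act_div (h1 w)
  · rintro d ⟨e1, e2, e3⟩
    refine SmoothMap.ext (funext fun w => pullMor_ext (e1 w) (e2 w) ?_)
    have w1 : B.right.anchor (pullSrc _ (d w)) = Y.src (y w) :=
      (congrArg _ (e1 w)).trans (h w).symm
    have w2 : B.left.anchor (B.right.act _ _ w1) = X.src (pullArrow _ (d w)) :=
      (B.left_anchor_right_act _ _ _).trans (src_pullArrow _ (d w)).symm
    have e4 : B.right.act (pullSrc _ (d w)) (y w) w1 = py w := B.right.act_congr (e1 w) rfl _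
    refine B.left.eq_div (h1 w) ((congrArg _ e4).symm.trans w2) ?_
    rw [← B.left.act_congr e4 rfl w2, ← B.right_act_translate (d w) (y w) w1 w2]
    refine (B.right.act_congr rfl (e3 w).symm _).trans ?_
    exact (B.right.act_div (B.right_proj_translate (d w))).trans (e2 w)

theorem isMorita_pullHomRight (hB : B.right.SmoothDiv) (hB' : B.left.SmoothDiv) :
    (pullHomRight hB).IsMorita where
  surjective_obj := B.op.surjective_left_anchor
  submersion_obj := B.op.isSubmersion_left_anchor
  cartesian _ p q y h h' := existsUnique_pullHomRight hB hB' p q y h h'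

theorem moritaEquivalent (hB : B.right.SmoothDiv) (hB' : B.left.SmoothDiv) :
    MoritaEquivalent X Y :=
  ⟨_, _, _, isMorita_pullHom B.isSubmersion_left_anchor B.surjective_left_anchor,
    isMorita_pullHomRight hB hB'⟩

end Bitorsor

/-! ### The functor of a bitorsor -/

namespace AssocQuotient

variable {X Y : LieGroupoid.{u}} {B : Bitorsor X Y} {P P' : Torsor X} {E E' : SmoothManifold.{u}}
  (A : AssocQuotient P.str.toRightAction B.left.toRightAction E)
  (A' : AssocQuotient P'.str.toRightAction B.left.toRightAction E') (φ : P ⟶ P')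

/-- The map of associated torsors induced by a morphism of torsors. -/
def mapFun (e : E) : E' :=
  A'.pair (Torsor.homTotal φ (A.repFst e)) (A.repSnd e)
    ((Torsor.Hom.anchor_total φ _).trans (A.rep_anchor e))

theorem mapFun_pair {p : P.total} {q : B.Q} (h : P.str.anchor p = B.left.anchor q) :
    A.mapFun A' φ (A.pair p q h) =
      A'.pair (Torsor.homTotal φ p) q ((Torsor.Hom.anchor_total φ _).trans h) := by
  obtain ⟨g, w, w', h1, h2⟩ := A.exists_rep_pair p q h
  have v : P'.str.anchor (Torsor.homTotal φ (A.repFst (A.pair p q h))) = X.src g :=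
    (Torsor.Hom.anchor_total φ _).trans w
  refine (A'.pair_act _ _ ((Torsor.Hom.anchor_total φ _).trans (A.rep_anchor _)) g v
    w').symm.trans ?_
  refine A'.pair_congr ?_ h2 _
  exact (Torsor.Hom.total_act φ _ _ w).symm.trans (congrArg (Torsor.homTotal φ).toFun h1)

/-- The morphism of associated torsors induced by a morphism of torsors. -/
def torsorMap : Torsor.Hom ⟨P.base, E, A.torsor⟩ ⟨P'.base, E', A'.torsor⟩ where
  base := Torsor.homBase (A := P) (B := P') φ
  total := ⟨A.mapFun A' φ, A.isSmooth_of_pair fun _ a b h =>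
    (A'.pairMap ((Torsor.homTotal φ).comp a) b fun w =>
      (Torsor.Hom.anchor_total φ _).trans (h w)).smooth.congr fun w => A.mapFun_pair A' φ (h w)⟩
  comm e := by
    obtain ⟨p, q, h, rfl⟩ := A.exists_pair e
    refine (congrArg _ (A.mapFun_pair A' φ h)).trans ((A'.torsor_proj_pair _).trans ?_)
    exact (Torsor.Hom.comm φ p).trans (congrArg _ (A.torsor_proj_pair h).symm)
  anchor_total e := by
    obtain ⟨p, q, h, rfl⟩ := A.exists_pair e
    refine (congrArg _ (A.mapFun_pair A' φ h)).trans ((A'.torsor_anchor_pair _).trans ?_)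
    exact (A.torsor_anchor_pair h).symm
  total_act e y w := by
    obtain ⟨p, q, h, rfl⟩ := A.exists_pair e
    refine (congrArg (A.mapFun A' φ) (A.torsor_act_pair h w)).trans ?_
    refine (A.mapFun_pair A' φ _).trans ?_
    have w' := (A'.torsor_anchor_pair ((Torsor.Hom.anchor_total φ p).trans h)).trans
      ((A.torsor_anchor_pair h).symm.trans w)
    exact (A'.torsor_act_pair _ w').symm.trans
      (A'.torsor.act_congr (A.mapFun_pair A' φ h).symm rfl w')

end AssocQuotient

namespace Bitorsor

variable {X Y : LieGroupoid.{u}} (B : Bitorsor X Y) (hX : ∀ P : Torsor X, P.str.SmoothDiv)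

/-- The total space of the torsor associated to a torsor and a bitorsor. -/
def assocTotal (P : Torsor X) : SmoothManifold.{u} :=
  (exists_assocQuotient P.str (hX P) B.left.toRightAction B.isSubmersion_left_anchor).choose

/-- The associated torsor as a quotient. -/
def assocQuotient (P : Torsor X) :
    AssocQuotient P.str.toRightAction B.left.toRightAction (B.assocTotal hX P) :=
  (exists_assocQuotient P.str (hX P) B.left.toRightAction
    B.isSubmersion_left_anchor).choose_spec.some

/-- The torsor associated to a torsor and a bitorsor. -/
def assocObj (P : Torsor X) : Torsor Y := ⟨P.base, B.assocTotal hX P, (B.assocQuotient hX P).torsor⟩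

/-- The morphism of associated torsors. -/
def assocMap {P P' : Torsor X} (φ : P ⟶ P') : B.assocObj hX P ⟶ B.assocObj hX P' :=
  (B.assocQuotient hX P).torsorMap (B.assocQuotient hX P') φ

theorem assocMap_pair {P P' : Torsor X} (φ : P ⟶ P') {p : P.total} {q : B.Q}
    (h : P.str.anchor p = B.left.anchor q) :
    Torsor.homTotal (B.assocMap hX φ) ((B.assocQuotient hX P).pair p q h) =
      (B.assocQuotient hX P').pair (Torsor.homTotal φ p) q
        ((Torsor.Hom.anchor_total φ _).trans h) :=
  AssocQuotient.mapFun_pair _ _ φ h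

/-- The functor of stacks given by a bitorsor. -/
def assocFunctor : BasedFunctor (torsorStack X) (torsorStack Y) where
  obj := B.assocObj hX
  map := B.assocMap hX
  map_id P := by
    refine Torsor.hom_ext fun e => ?_
    obtain ⟨p, q, h, rfl⟩ := (B.assocQuotient hX P).exists_pair e
    exact B.assocMap_pair hX _ h
  map_comp φ ψ := by
    refine Torsor.hom_ext fun e => ?_
    obtain ⟨p, q, h, rfl⟩ := (B.assocQuotient hX _).exists_pair e
    refine (B.assocMap_pair hX _ h).trans ?_
    refine ((congrArg _ (B.assocMap_pair hX φ h)).trans (B.assocMap_pair hX ψ _)).symm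
  w := CategoryTheory.Functor.ext (fun _ => rfl) fun _ _ _ => rfl

variable (hY : ∀ P : Torsor Y, P.str.SmoothDiv) (P : Torsor X)

/-- The class of a point in the double associated torsor. -/
def doublePair (p : P.total) (q : B.Q) (h : P.str.anchor p = B.left.anchor q) :
    (B.op.assocObj hY (B.assocObj hX P)).total :=
  (B.op.assocQuotient hY (B.assocObj hX P)).pair ((B.assocQuotient hX P).pair p q h) q
    ((B.assocQuotient hX P).torsor_anchor_pair h)

theorem doublePair_congr {p p' : P.total} {q q' : B.Q} (hp : p = p') (hq : q = q')
    (h : P.str.anchor p = B.left.anchor q) :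
    B.doublePair hX hY P p q h = B.doublePair hX hY P p' q' (hp ▸ hq ▸ h) := by
  subst hp hq; rfl

/-- Writing q' = q·y, one has [[p, q], q] = [[p, q]·y, q·y] = [[p, q'], q']. -/
theorem doublePair_eq (p : P.total) (q q' : B.Q) (h : P.str.anchor p = B.left.anchor q)
    (h' : P.str.anchor p = B.left.anchor q') :
    B.doublePair hX hY P p q h = B.doublePair hX hY P p q' h' := by
  have hq : B.right.proj q = B.right.proj q' := by
    rw [← B.left_anchor_eq, ← B.left_anchor_eq, ← h, h']
  have w := B.right.src_div hq
  refine Eq.trans ?_ (B.doublePair_congr hX hY P rfl (B.right.act_div hq)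
    (h.trans (B.left_anchor_right_act _ _ _).symm))
  have w' := ((B.assocQuotient hX P).torsor_anchor_pair h).trans w
  refine ((B.op.assocQuotient hY (B.assocObj hX P)).pair_act _ _ _ _ w' w).symm.trans ?_
  refine AssocQuotient.pair_congr _ ?_ rfl _
  exact (B.assocQuotient hX P).torsor_act_pair h w'

theorem exists_left_anchor_eq (p : P.total) : ∃ q, P.str.anchor p = B.left.anchor q := by
  obtain ⟨q, hq⟩ := B.surjective_left_anchor (P.str.anchor p)
  exact ⟨q, hq.symm⟩

/-- The map to the double associated torsor. -/
def unitFun (p : P.total) : (B.op.assocObj hY (B.assocObj hX P)).total :=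
  B.doublePair hX hY P p _ (B.exists_left_anchor_eq P p).choose_spec

theorem unitFun_eq {p : P.total} {q : B.Q} (h : P.str.anchor p = B.left.anchor q) :
    B.unitFun hX hY P p = B.doublePair hX hY P p q h :=
  B.doublePair_eq hX hY P p _ _ _ _

/-- The auxiliary point q is chosen pointwise, but after base change along the submersion
`B.left.anchor` it becomes a tautological smooth family, and the choice does not matter. -/
theorem isSmooth_unitFun : IsSmooth (B.unitFun hX hY P) := by
  refine .of_submersion fun p => ?_
  let hβ := B.isSubmersion_left_anchor
  obtain ⟨q, h⟩ := B.exists_left_anchor_eq P p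
  refine ⟨fiberProd B.left.anchor P.str.anchor hβ, fiberProd.snd hβ, fiberProd.mk hβ q p h.symm,
    fiberProd.isSubmersion_snd hβ, rfl, ?_⟩
  have h1 : ∀ x, P.str.anchor (fiberProd.snd hβ x) = B.left.anchor (fiberProd.fst hβ x) :=
    fun x => (fiberProd.condition hβ x).symm
  exact ((B.op.assocQuotient hY (B.assocObj hX P)).pairMap
    ((B.assocQuotient hX P).pairMap (fiberProd.snd hβ) (fiberProd.fst hβ) h1) (fiberProd.fst hβ)
    fun x => (B.assocQuotient hX P).torsor_anchor_pair (h1 x)).smooth.congr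
    fun x => B.unitFun_eq hX hY P (h1 x)

/-- The unit: the morphism to the double associated torsor. -/
def unitMap : P ⟶ B.op.assocObj hY (B.assocObj hX P) where
  base := .id _
  total := ⟨B.unitFun hX hY P, B.isSmooth_unitFun hX hY P⟩
  comm p := by
    obtain ⟨q, h⟩ := B.exists_left_anchor_eq P p
    refine (congrArg _ (B.unitFun_eq hX hY P h)).trans ?_
    refine (AssocQuotient.torsor_proj_pair (B := B.op) _ _).trans ?_
    exact (B.assocQuotient hX P).torsor_proj_pair h
  anchor_total p := by
    obtain ⟨q, h⟩ := B.exists_left_anchor_eq P p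
    refine (congrArg _ (B.unitFun_eq hX hY P h)).trans ?_
    exact (AssocQuotient.torsor_anchor_pair (B := B.op) _ _).trans h.symm
  total_act p x w := by
    obtain ⟨q, h⟩ := B.exists_left_anchor_eq P p
    have w' := h.symm.trans w
    have h' : P.str.anchor (P.str.act p x w) = B.left.anchor (B.left.act q x w') :=
      (P.str.anchor_act _ _ _).trans (B.left.anchor_act _ _ _).symm
    refine (B.unitFun_eq hX hY P h').trans ?_
    have e := B.unitFun_eq hX hY P h
    refine Eq.trans ?_ (RightAction.act_congr _ e.symm rfl
      (((AssocQuotient.torsor_anchor_pair (B := B.op) _ _).trans h.symm).trans w))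
    refine Eq.trans ?_ (AssocQuotient.torsor_act_pair (B := B.op) _ _ _).symm
    refine AssocQuotient.pair_congr _ ?_ rfl _
    exact (B.assocQuotient hX P).pair_act p q h x w w'

instance isIso_unitMap : IsIso (B.unitMap hX hY P) :=
  Torsor.isIso_of_base _ (hX _) (.id _) (fun _ => rfl) (fun _ => rfl)

theorem unitMap_naturality {P P' : Torsor X} (φ : P ⟶ P') :
    φ ≫ B.unitMap hX hY P' =
      B.unitMap hX hY P ≫ B.op.assocMap hY (B.assocMap hX φ) := by
  refine Torsor.hom_ext fun p => ?_
  obtain ⟨q, h⟩ := B.exists_left_anchor_eq P p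
  refine (B.unitFun_eq hX hY P' (((Torsor.Hom.anchor_total φ p)).trans h)).trans ?_
  refine Eq.trans ?_ (congrArg
    (Torsor.homTotal (B.op.assocMap hY (B.assocMap hX φ))).toFun (B.unitFun_eq hX hY P h)).symm
  refine Eq.trans ?_ (B.op.assocMap_pair hY (B.assocMap hX φ) _).symm
  exact AssocQuotient.pair_congr _ (B.assocMap_pair hX φ h).symm rfl _

/-- The identity is isomorphic to the composition of the functors of a bitorsor and its opposite. -/
def assocUnit : BasedFunctor.id (torsorStack X) ≅
    BasedFunctor.comp (B.assocFunctor hX) (B.op.assocFunctor hY) :=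
  BasedNatIso.mkNatIso
    (NatIso.ofComponents (fun P : Torsor X => @asIso (Torsor X) _ _ _ (B.unitMap hX hY P) (B.isIso_unitMap hX hY P))
      fun φ => B.unitMap_naturality hX hY φ)
    fun P => IsHomLift.map (torsorStack X).p (B.unitMap hX hY P)

/-- Lie groupoids with a bitorsor have isomorphic stacks of torsors. -/
theorem stackIsomorphic {X Y : LieGroupoid.{u}} (B : Bitorsor X Y)
    (hX : ∀ P : Torsor X, P.str.SmoothDiv) (hY : ∀ P : Torsor Y, P.str.SmoothDiv) :
    StackIsomorphic (torsorStack X) (torsorStack Y) :=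
  -- The opposite of the opposite bitorsor is definitionally the original, so the unit of `B.op`
  -- handles the other composite.
  ⟨B.assocFunctor hX, B.op.assocFunctor hY, ⟨(B.op.assocUnit hY hX).symm⟩,
    ⟨(B.assocUnit hX hY).symm⟩⟩

end Bitorsor

/-! ### Morphisms out of pull-backs of the unit torsor -/

section UnitPull

variable {Γ : LieGroupoid.{u}} {W : SmoothManifold.{u}}

/-- The pull-back of the unit torsor along `a`. -/
abbrev unitPull (a : SmoothMap W Γ.Obj) : Torsor Γ := ⟨W, unitTotal a, unitTorsor a⟩

/-- The unit section of a pull-back of the unit torsor. -/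
def unitSection (a : SmoothMap W Γ.Obj) : SmoothMap W (unitTotal a) :=
  fiberProd.lift Γ.submersion_src (Γ.one.comp a) (.id W) fun _ => Γ.src_one _

theorem unitTorsor_anchor_unitSection (a : SmoothMap W Γ.Obj) (w : W) :
    (unitTorsor a).anchor (unitSection a w) = a w := Γ.tgt_one _

theorem unitTorsor_eq_act (a : SmoothMap W Γ.Obj) (p : unitTotal a) :
    p = (unitTorsor a).act (unitSection a (unitPoint a p)) (unitArrow a p)
      ((unitTorsor_anchor_unitSection a _).trans (fiberProd.condition _ p).symm) := by
  refine fiberProd.ext _ ?_ rfl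
  refine (Γ.one_mul _).symm.trans (Γ.mul_congr ?_ rfl _)
  exact congrArg Γ.one.toFun (fiberProd.condition _ p)

variable {P P' : Torsor Γ} {a : SmoothMap W Γ.Obj}

/-- Every point is a translate of a unit. With `orbitHom`, this is the Yoneda-type statement that
morphisms from a pull-back of the unit torsor are maps `W` → `P` with anchor `a`. -/
theorem unitPull_hom_ext {φ ψ : unitPull a ⟶ P}
    (h : ∀ w, Torsor.homTotal φ (unitSection a w) = Torsor.homTotal ψ (unitSection a w)) :
    φ = ψ := by
  refine Torsor.hom_ext fun p => ?_
  have w := (unitTorsor_anchor_unitSection a (unitPoint a p)).trans (fiberProd.condition _ p).symm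
  have h1 := congrArg (Torsor.homTotal φ).toFun (unitTorsor_eq_act a p)
  have h2 := congrArg (Torsor.homTotal ψ).toFun (unitTorsor_eq_act a p)
  refine h1.trans (Eq.trans ?_ h2.symm)
  refine (Torsor.Hom.total_act φ _ _ w).trans (Eq.trans ?_ (Torsor.Hom.total_act ψ _ _ w).symm)
  exact P.str.act_congr (h _) rfl _

/-- The morphism from a pull-back of the unit torsor given by the images of the units. -/
def orbitHom (P : Torsor Γ) (a : SmoothMap W Γ.Obj) (ν : SmoothMap W P.total)
    (h : ∀ w, P.str.anchor (ν w) = a w) : unitPull a ⟶ P where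
  base := P.str.proj.comp ν
  total := P.str.actMap (ν.comp (unitPoint a)) (unitArrow a)
    fun p => (h _).trans (fiberProd.condition _ p).symm
  comm _ := P.str.proj_act _ _ _
  anchor_total _ := P.str.anchor_act _ _ _
  total_act p _ w := P.str.act_mul _ _ _ ((h _).trans (fiberProd.condition _ p).symm) w

theorem orbitHom_unitSection (ν : SmoothMap W P.total) (h : ∀ w, P.str.anchor (ν w) = a w)
    (w : W) : Torsor.homTotal (orbitHom P a ν h) (unitSection a w) = ν w :=
  P.str.act_one' _ rfl _

/-- The canonical morphism to the unit torsor. -/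
def unitCan (a : SmoothMap W Γ.Obj) : unitPull a ⟶ unitPull (.id Γ.Obj) :=
  orbitHom (unitPull (.id Γ.Obj)) a ((unitSection (.id _)).comp a)
    fun _ => unitTorsor_anchor_unitSection _ _

theorem unitCan_unitSection (w : W) :
    Torsor.homTotal (unitCan a) (unitSection a w) = unitSection (.id _) (a w) :=
  orbitHom_unitSection _ _ w

theorem anchor_hom_unitSection (φ : unitPull a ⟶ P) (w : W) :
    P.str.anchor (Torsor.homTotal φ (unitSection a w)) = a w :=
  (Torsor.Hom.anchor_total φ _).trans (unitTorsor_anchor_unitSection a w)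

theorem proj_hom_unitSection (φ : unitPull a ⟶ P) (w : W) :
    P.str.proj (Torsor.homTotal φ (unitSection a w)) = Torsor.homBase φ w :=
  Torsor.Hom.comm φ _

end UnitPull

/-! ### Transport of torsor structures -/

/-- Transport of a torsor structure along a diffeomorphism. -/
def TorsorStructure.transport {Γ : LieGroupoid.{u}} {S P P' : SmoothManifold.{u}}
    (t : TorsorStructure Γ S P') (θ : SmoothMap P P') (σ : SmoothMap P' P)
    (hσ : ∀ p, σ (θ p) = p) (hθ : ∀ p, θ (σ p) = p) : TorsorStructure Γ S P where
  anchor := t.anchor.comp θ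
  act p g w := σ (t.act (θ p) g w)
  anchor_act p g w := (congrArg t.anchor.toFun (hθ _)).trans (t.anchor_act _ _ _)
  act_one p := (congrArg σ.toFun (t.act_one _)).trans (hσ p)
  act_mul p g h w w' := (congrArg σ.toFun (t.act_mul _ _ _ w w')).trans
    (congrArg σ.toFun (t.act_congr (hθ _).symm rfl _))
  smooth_act _ a b w := (σ.comp (t.actMap (θ.comp a) b w)).smooth
  proj := t.proj.comp θ
  surjective_proj s := by
    obtain ⟨p, rfl⟩ := t.surjective_proj s
    exact ⟨σ p, congrArg t.proj.toFun (hθ p)⟩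
  submersion_proj := .of_comp (t.proj.comp θ).smooth fun m => ⟨P', σ, θ m, hσ m, by
    have h : (fun p => (t.proj.comp θ) (σ p)) = t.proj.toFun :=
      funext fun p => congrArg t.proj.toFun (hθ p)
    exact h ▸ t.submersion_proj⟩
  proj_act p g w := (congrArg t.proj.toFun (hθ _)).trans (t.proj_act _ _ _)
  existsUnique_act p p' h := by
    obtain ⟨g, ⟨w, hg⟩, hu⟩ := t.existsUnique_act (θ p) (θ p') h
    refine ⟨g, ⟨w, (congrArg σ.toFun hg).trans (hσ p')⟩, ?_⟩
    rintro g' ⟨w', hg'⟩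
    exact hu g' ⟨w', (hθ _).symm.trans (congrArg θ.toFun hg')⟩

/-! ### The bitorsor of an equivalence of stacks of torsors -/

/-- A fully faithful functor of stacks of torsors that preserves the bases strictly. -/
structure TorsorFunctor (X Y : LieGroupoid.{u}) where
  total : Torsor X → SmoothManifold.{u}
  str : ∀ P : Torsor X, TorsorStructure Y P.base (total P)
  map : ∀ {P P' : Torsor X}, (P ⟶ P') →
    ((⟨P.base, total P, str P⟩ : Torsor Y) ⟶ ⟨P'.base, total P', str P'⟩)
  base_map : ∀ {P P' : Torsor X} (φ : P ⟶ P') (s : P.base),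
    Torsor.homBase (map φ) s = Torsor.homBase φ s
  map_comp : ∀ {P P' P'' : Torsor X} (φ : P ⟶ P') (ψ : P' ⟶ P''),
    map (φ ≫ ψ) = map φ ≫ map ψ
  map_injective : ∀ {P P' : Torsor X} {φ ψ : P ⟶ P'}, map φ = map ψ → φ = ψ
  map_surjective : ∀ {P P' : Torsor X}
    (ψ : (⟨P.base, total P, str P⟩ : Torsor Y) ⟶ ⟨P'.base, total P', str P'⟩), ∃ φ, map φ = ψ

namespace TorsorFunctor

variable {X Y : LieGroupoid.{u}} (F : TorsorFunctor X Y)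

/-- The value of the functor at a torsor. -/
abbrev obj (P : Torsor X) : Torsor Y := ⟨P.base, F.total P, F.str P⟩

theorem map_comp_apply {P P' P'' : Torsor X} (φ : P ⟶ P') (ψ : P' ⟶ P'') (t : F.total P) :
    Torsor.homTotal (F.map (φ ≫ ψ)) t = Torsor.homTotal (F.map ψ) (Torsor.homTotal (F.map φ) t) :=
  congrArg (fun χ => (Torsor.homTotal χ).toFun t) (F.map_comp φ ψ)

theorem proj_map {P P' : Torsor X} (φ : P ⟶ P') (t : F.total P) :
    (F.str P').proj (Torsor.homTotal (F.map φ) t) = Torsor.homBase φ ((F.str P).proj t) :=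
  (Torsor.Hom.comm (F.map φ) t).trans (F.base_map φ _)

variable {F} {Q : SmoothManifold.{u}} {r : TorsorStructure X Y.Obj Q}
  (η : F.obj ⟨Y.Obj, Q, r⟩ ≅ unitPull (.id Y.Obj))

/-- The torsor corresponding to the unit torsor. -/
abbrev unitPreimage (_η : F.obj ⟨Y.Obj, Q, r⟩ ≅ unitPull (.id Y.Obj)) : Torsor X := ⟨Y.Obj, Q, r⟩

/-- The morphism of torsors given by the action of the unit torsor. -/
def actHom : unitPull r.anchor ⟶ unitPreimage η :=
  orbitHom (unitPreimage η) r.anchor (.id Q) fun _ => rfl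

theorem actHom_unitSection (q : Q) :
    Torsor.homTotal (actHom η) (unitSection r.anchor q) = q :=
  orbitHom_unitSection (P := unitPreimage η) _ _ q

/-- The morphism to the unit torsor corresponding to a morphism. -/
def toUnit {P : Torsor X} (n : P ⟶ unitPreimage η) : F.obj P ⟶ unitPull (.id Y.Obj) :=
  F.map n ≫ η.hom

theorem toUnit_comp {P P' : Torsor X} (j : P' ⟶ P) (n : P ⟶ unitPreimage η) (t : F.total P') :
    Torsor.homTotal (toUnit η (j ≫ n)) t = Torsor.homTotal (toUnit η n)
      (Torsor.homTotal (F.map j) t) :=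
  congrArg (Torsor.homTotal η.hom).toFun (F.map_comp_apply j n t)

theorem toUnit_injective {P : Torsor X} {n n' : P ⟶ unitPreimage η}
    (h : toUnit η n = toUnit η n') : n = n' :=
  F.map_injective ((cancel_mono η.hom).1 h)

theorem toUnit_surjective {P : Torsor X} (ψ : F.obj P ⟶ unitPull (.id Y.Obj)) :
    ∃ n, toUnit η n = ψ := by
  obtain ⟨n, hn⟩ := F.map_surjective (ψ ≫ η.inv)
  exact ⟨n, by rw [toUnit, hn, Category.assoc, η.inv_hom_id, Category.comp_id]⟩

variable {η}

theorem homBase_toUnit (hη : ∀ y, Torsor.homBase η.hom y = y) {P : Torsor X}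
    (n : P ⟶ unitPreimage η) (s : P.base) :
    Torsor.homBase (toUnit η n) s = Torsor.homBase n s :=
  (hη _).trans (F.base_map n s)

variable (η) in
/-- The property that characterizes the comparison map from the torsor corresponding to the unit
torsor to the value at the unit torsor. -/
def IsComparison (θ : SmoothMap Q (F.total (unitPull (.id X.Obj)))) : Prop :=
  ∀ (W : SmoothManifold.{u}) (a : SmoothMap W X.Obj) (n : unitPull a ⟶ unitPreimage η) (w : W)
    (t : F.total (unitPull a)), (F.str _).proj t = w →
    (Torsor.homTotal (toUnit η n) t = unitSection (.id _)
      (r.proj (Torsor.homTotal n (unitSection a w))) ↔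
    Torsor.homTotal (F.map (unitCan a)) t = θ (Torsor.homTotal n (unitSection a w)))

/-- The map is defined in the universal case, where `W` is `Q` itself and the morphism is `actHom`:
τ is the section that this morphism sends to units, and θ is its image in the value at the unit
torsor. Any other n factors as j followed by `actHom`; both conditions on t then say that F(j) sends
t to the value of τ at the image of the unit over w, since torsor morphisms are injective on fibers.
-/
theorem exists_isComparison (hY : ∀ P : Torsor Y, P.str.SmoothDiv)
    (hη : ∀ y, Torsor.homBase η.hom y = y) : ∃ θ, IsComparison η θ := by
  obtain ⟨τ, h1, h2⟩ := Torsor.exists_lift (toUnit η (actHom η)) (hY _) (.id Q)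
    ((unitSection (.id Y.Obj)).comp r.proj) fun q => (homBase_toUnit hη (actHom η) q).symm
  refine ⟨(Torsor.homTotal (F.map (unitCan r.anchor))).comp τ, ?_⟩
  rintro W a n w t rfl
  set w := (F.str _).proj t with hw
  have h3 : ∀ w, r.anchor (Torsor.homTotal n (unitSection a w)) = a w :=
    anchor_hom_unitSection n
  let j : unitPull a ⟶ unitPull r.anchor := orbitHom (unitPull r.anchor) a
    ((unitSection r.anchor).comp ((Torsor.homTotal n).comp (unitSection a)))
    fun w => (unitTorsor_anchor_unitSection _ _).trans (h3 w)
  have hj : ∀ w, Torsor.homTotal j (unitSection a w) =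
      unitSection r.anchor (Torsor.homTotal n (unitSection a w)) :=
    orbitHom_unitSection (P := unitPull r.anchor) _ _
  have e1 : j ≫ actHom η = n := unitPull_hom_ext fun w =>
    (congrArg (Torsor.homTotal (actHom η)).toFun (hj w)).trans (actHom_unitSection η _)
  have e2 : j ≫ unitCan r.anchor = unitCan a := unitPull_hom_ext fun w =>
    (congrArg (Torsor.homTotal (unitCan r.anchor)).toFun (hj w)).trans
      ((unitCan_unitSection _).trans ((congrArg (unitSection (.id X.Obj)).toFun (h3 w)).trans
        (unitCan_unitSection w).symm))
  have h4 : (F.str _).proj (Torsor.homTotal (F.map j) t) =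
      (F.str _).proj (τ (Torsor.homTotal n (unitSection a w))) :=
    (F.proj_map j t).trans (h1 _).symm
  have h5 : Torsor.homTotal (toUnit η n) t =
      Torsor.homTotal (toUnit η (actHom η)) (Torsor.homTotal (F.map j) t) := by
    rw [← toUnit_comp, e1]
  have h6 : Torsor.homTotal (F.map (unitCan a)) t =
      Torsor.homTotal (F.map (unitCan r.anchor)) (Torsor.homTotal (F.map j) t) := by
    rw [← map_comp_apply, e2]
  rw [h5, h6]
  constructor
  · intro h
    exact congrArg _ (Torsor.hom_injective _ h4 (h.trans (h2 _).symm))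
  · intro h
    refine (congrArg _ (Torsor.hom_injective (F.map (unitCan r.anchor)) h4 h)).trans (h2 _)

namespace IsComparison

variable {θ : SmoothMap Q (F.total (unitPull (.id X.Obj)))} (hθ : IsComparison η θ)

theorem proj_anchor (hη : ∀ y, Torsor.homBase η.hom y = y) (hθ : IsComparison η θ) (q : Q) :
    (F.str _).proj (θ q) = r.anchor q ∧ (F.str _).anchor (θ q) = r.proj q := by
  obtain ⟨t, h1, h2⟩ := Torsor.exists_preimage (toUnit η (actHom η)) q
    (unitSection (.id Y.Obj) (r.proj q)) (homBase_toUnit hη (actHom η) q).symm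
  have h3 := (hθ _ _ (actHom η) q t h1).1
  rw [actHom_unitSection] at h3
  have h4 := h3 h2
  rw [← h4]
  refine ⟨(F.proj_map _ t).trans ?_, ?_⟩
  · exact congrArg (Torsor.homBase (unitCan r.anchor)).toFun h1
  · refine (Torsor.Hom.anchor_total (F.map (unitCan r.anchor)) t).trans ?_
    refine (Torsor.Hom.anchor_total (toUnit η (actHom η)) t).symm.trans ?_
    exact (congrArg _ h2).trans (unitTorsor_anchor_unitSection _ _)

end IsComparison

end TorsorFunctor

theorem Torsor.hom_eq_of_subsingleton {Γ : LieGroupoid.{u}} {A B : Torsor Γ} {φ ψ : A ⟶ B}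
    (t : A.total) (hA : ∀ p, A.str.proj t = A.str.proj p)
    (h : Torsor.homTotal φ t = Torsor.homTotal ψ t) : φ = ψ := by
  refine Torsor.hom_ext fun p => ?_
  rw [← A.str.act_div (hA p)]
  refine (Torsor.Hom.total_act φ _ _ (A.str.src_div (hA p))).trans (Eq.trans ?_
    (Torsor.Hom.total_act ψ _ _ (A.str.src_div (hA p))).symm)
  exact B.str.act_congr h rfl _

namespace TorsorFunctor.IsComparison

variable {X Y : LieGroupoid.{u}} {F : TorsorFunctor X Y} {Q : SmoothManifold.{u}}
  {r : TorsorStructure X Y.Obj Q} {η : F.obj ⟨Y.Obj, Q, r⟩ ≅ unitPull (.id Y.Obj)}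
  {θ : SmoothMap Q (F.total (unitPull (.id X.Obj)))}

/-- Over `W` = F(U_X), with `a` its projection to X₀, the torsor F(a^*U_X) has a tautological
section s. It trivializes this torsor, so some morphism to U_Y sends s to units; by fullness that
morphism comes from n : a^*U_X → Q, and the map `W` → `Q` classified by n is the section. -/
theorem exists_section (hY : ∀ P : Torsor Y, P.str.SmoothDiv)
    (hη : ∀ y, Torsor.homBase η.hom y = y) (hθ : IsComparison η θ) :
    ∃ σ : SmoothMap (F.total (unitPull (.id X.Obj))) Q, ∀ p, θ (σ p) = p := by
  let a := (F.str (unitPull (.id X.Obj))).proj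
  let b := (F.str (unitPull (.id X.Obj))).anchor
  obtain ⟨s, h1, h2⟩ := Torsor.exists_lift (F.map (unitCan a)) (hY _) (.id _) (.id _)
    fun p => (F.base_map (unitCan a) p).symm
  have h3 : ∀ p, (F.str (unitPull a)).anchor (s p) = b p := fun p =>
    (Torsor.Hom.anchor_total (F.map (unitCan a)) _).symm.trans (congrArg b.toFun (h2 p))
  let l : unitPull b ⟶ F.obj (unitPull a) := orbitHom (F.obj (unitPull a)) b s h3
  have hl : ∀ p, Torsor.homTotal l (unitSection b p) = s p :=
    orbitHom_unitSection (P := F.obj (unitPull a)) _ _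
  have : IsIso l := Torsor.isIso_of_base l (hY _) (.id _) h1 h1
  obtain ⟨n, hn⟩ := toUnit_surjective η (inv l ≫ unitCan b)
  have h4 : ∀ p, Torsor.homTotal (toUnit η n) (s p) = unitSection (.id _) (b p) := fun p => by
    rw [hn, Torsor.homTotal_comp, ← hl, ← Torsor.homTotal_comp l (inv l), IsIso.hom_inv_id]
    exact unitCan_unitSection p
  have h5 : ∀ p, r.proj (Torsor.homTotal n (unitSection a p)) = b p := fun p => by
    refine (proj_hom_unitSection n p).trans ((homBase_toUnit hη n p).symm.trans ?_)
    refine (congrArg (Torsor.homBase (toUnit η n)).toFun (h1 p)).symm.trans ?_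
    exact (Torsor.Hom.comm (toUnit η n) (s p)).symm.trans (congrArg _ (h4 p))
  refine ⟨(Torsor.homTotal n).comp (unitSection a), fun p => ?_⟩
  refine ((hθ _ a n p (s p) (h1 p)).1 ((h4 p).trans ?_)).symm.trans (h2 p)
  exact congrArg _ (h5 p).symm

theorem exists_preimage (hη : ∀ y, Torsor.homBase η.hom y = y) (hθ : IsComparison η θ)
    {q : Q} {x : X.Obj} (h : r.anchor q = x) :
    ∃ t, Torsor.homTotal (F.map (unitCan (.ofPoint x))) t = θ q := by
  obtain ⟨t, -, ht⟩ := Torsor.exists_preimage (F.map (unitCan (.ofPoint x))) PUnit.unit (θ q) (by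
    rw [(hθ.proj_anchor hη q).1, h]
    exact (F.base_map (unitCan (.ofPoint x)) PUnit.unit).symm)
  exact ⟨t, ht⟩

/-- Points with equal image share anchor and projection. The morphisms over the one-point manifold
that classify them agree at one point after applying the functor, hence everywhere, and faithfulness
concludes. -/
theorem injective (hη : ∀ y, Torsor.homBase η.hom y = y) (hθ : IsComparison η θ) :
    Function.Injective θ.toFun := by
  intro q q' h
  have h1 : r.anchor q' = r.anchor q := by
    rw [← (hθ.proj_anchor hη q).1, ← (hθ.proj_anchor hη q').1]
    exact congrArg _ h.symm
  have h2 : r.proj q' = r.proj q := by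
    rw [← (hθ.proj_anchor hη q).2, ← (hθ.proj_anchor hη q').2]
    exact congrArg _ h.symm
  let a : SmoothMap point X.Obj := .ofPoint (r.anchor q)
  let n : unitPull a ⟶ unitPreimage η := orbitHom (unitPreimage η) a (.ofPoint q) fun _ => rfl
  let n' : unitPull a ⟶ unitPreimage η := orbitHom (unitPreimage η) a (.ofPoint q') fun _ => h1
  have hn : Torsor.homTotal n (unitSection a PUnit.unit) = q :=
    orbitHom_unitSection (P := unitPreimage η) _ _ _
  have hn' : Torsor.homTotal n' (unitSection a PUnit.unit) = q' :=
    orbitHom_unitSection (P := unitPreimage η) _ _ _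
  obtain ⟨t, ht⟩ := hθ.exists_preimage hη (rfl : r.anchor q = r.anchor q)
  have h3 := (hθ _ a n PUnit.unit t rfl).2 (by rw [hn]; exact ht)
  have h4 := (hθ _ a n' PUnit.unit t rfl).2 (by rw [hn']; exact ht.trans h)
  rw [hn] at h3
  rw [hn', h2] at h4
  have h5 : n = n' := toUnit_injective η
    (Torsor.hom_eq_of_subsingleton t (fun _ => rfl) (h3.trans h4.symm))
  rw [← hn, ← hn', h5]

/-- Left translation of pull-backs of the unit torsor to a point. -/
def leftTranslation (x : X.Mor) :
    unitPull (Γ := X) (.ofPoint (X.tgt x)) ⟶ unitPull (Γ := X) (.ofPoint (X.src x)) :=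
  orbitHom (unitPull (.ofPoint (X.src x))) _ (.ofPoint (unitMk x PUnit.unit rfl)) fun _ => rfl

/-- Acting by x on q is precomposing the morphism that classifies q with left translation by x. -/
theorem comparison_act_iff (hθ : IsComparison η θ) {q : Q} {x : X.Mor} (hx : r.anchor q = X.src x)
    (t : F.total (unitPull (.ofPoint (X.tgt x)))) :
    Torsor.homTotal (F.map (unitCan (.ofPoint (X.tgt x)))) t = θ (r.act q x hx) ↔
      Torsor.homTotal (F.map (unitCan (.ofPoint (X.src x))))
        (Torsor.homTotal (F.map (leftTranslation x)) t) = θ q := by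
  let n : unitPull (.ofPoint (X.src x)) ⟶ unitPreimage η :=
    orbitHom (unitPreimage η) _ (.ofPoint q) fun _ => hx
  have hn : Torsor.homTotal n (unitSection _ PUnit.unit) = q :=
    orbitHom_unitSection (P := unitPreimage η) _ _ _
  have hn' : Torsor.homTotal (leftTranslation x ≫ n) (unitSection (.ofPoint _) PUnit.unit) =
      r.act q x hx :=
    congrArg (Torsor.homTotal n).toFun (orbitHom_unitSection (W := point)
      (P := unitPull (.ofPoint (X.src x))) (.ofPoint (unitMk x PUnit.unit rfl)) (fun _ => rfl) _)
  have h1 := hθ _ _ (leftTranslation x ≫ n) PUnit.unit t rfl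
  have h2 := hθ _ _ n PUnit.unit (Torsor.homTotal (F.map (leftTranslation x)) t) rfl
  rw [hn', r.proj_act, toUnit_comp] at h1
  rw [hn] at h2
  exact h1.symm.trans h2

/-- This becomes the commutation of the two actions once the action of `Y` is transported to `Q`.
Through θ, the action of x is described by the image under the functor of left translation, a
morphism of `Y`-torsors and hence equivariant. -/
theorem act_eq (hη : ∀ y, Torsor.homBase η.hom y = y) (hθ : IsComparison η θ) {q q' : Q}
    {x : X.Mor} {y : Y.Mor} (hx : r.anchor q = X.src x) (hx' : r.anchor q' = X.src x)
    (hy : (F.str _).anchor (θ q) = Y.src y) (h : θ q' = (F.str _).act (θ q) y hy)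
    (hy' : (F.str _).anchor (θ (r.act q x hx)) = Y.src y) :
    θ (r.act q' x hx') = (F.str _).act (θ (r.act q x hx)) y hy' := by
  obtain ⟨t, ht⟩ := hθ.exists_preimage hη (r.anchor_act q x hx)
  have ht' := (hθ.comparison_act_iff hx t).1 ht
  have w : (F.str _).anchor t = Y.src y :=
    ((Torsor.Hom.anchor_total (F.map (unitCan _)) t).symm.trans (congrArg _ ht)).trans hy'
  have w' := (Torsor.Hom.anchor_total (F.map (leftTranslation x)) t).trans w
  have h1 : Torsor.homTotal (F.map (unitCan (.ofPoint (X.tgt x)))) ((F.str _).act t y w) =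
      (F.str _).act (θ (r.act q x hx)) y hy' :=
    (Torsor.Hom.total_act (F.map (unitCan _)) t y w).trans ((F.str _).act_congr ht rfl _)
  rw [← h1]
  refine ((hθ.comparison_act_iff hx' _).2 ?_).symm
  refine (congrArg _ (Torsor.Hom.total_act (F.map (leftTranslation x)) t y w)).trans ?_
  refine (Torsor.Hom.total_act (F.map (unitCan _)) _ y w').trans ?_
  exact ((F.str _).act_congr ht' rfl _).trans h.symm

end TorsorFunctor.IsComparison

/-- A fully faithful functor of stacks of torsors whose image contains the unit torsor gives a
bitorsor. -/
theorem TorsorFunctor.nonempty_bitorsor {X Y : LieGroupoid.{u}} (F : TorsorFunctor X Y)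
    (hY : ∀ P : Torsor Y, P.str.SmoothDiv) {Q : SmoothManifold.{u}}
    {r : TorsorStructure X Y.Obj Q} (η : F.obj ⟨Y.Obj, Q, r⟩ ≅ unitPull (.id Y.Obj))
    (hη : ∀ y, Torsor.homBase η.hom y = y) : Nonempty (Bitorsor X Y) := by
  obtain ⟨θ, hθ⟩ := exists_isComparison hY hη
  obtain ⟨σ, hσ⟩ := hθ.exists_section hY hη
  have hσ' : ∀ q, σ (θ q) = q := fun q => hθ.injective hη (hσ _)
  have h1 : ∀ q, (F.str _).anchor (θ q) = r.proj q := fun q => (hθ.proj_anchor hη q).2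
  have h2 : ∀ q, (F.str _).proj (θ q) = r.anchor q := fun q => (hθ.proj_anchor hη q).1
  refine ⟨⟨Q, r.anchor, r.proj, r, (F.str (unitPull (.id X.Obj))).transport θ σ hσ' hσ, rfl, rfl,
    SmoothMap.ext (funext h1), SmoothMap.ext (funext h2), fun q x y hx hy => ?_⟩⟩
  have hy' : (F.str _).anchor (θ (r.act q x hx)) = Y.src y := by
    rw [h1, r.proj_act, ← h1]
    exact hy
  have hx' : r.anchor (σ ((F.str _).act (θ q) y hy)) = X.src x :=
    (h2 _).symm.trans ((congrArg _ (hσ _)).trans (((F.str _).proj_act _ _ _).trans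
      ((h2 q).trans hx)))
  refine ⟨hy', hx', ?_⟩
  change σ ((F.str _).act (θ (r.act q x hx)) y hy') = r.act (σ ((F.str _).act (θ q) y hy)) x hx'
  rw [← hθ.act_eq hη hx hx' hy (hσ _) hy', hσ']

/-! ### The bitorsor of an isomorphism of stacks -/

theorem eqToHom_conj {C : Type*} [Category* C] {A A' B B' : C} (f : A ⟶ B) (h1 : A = A')
    (h2 : A' = A) (h3 : B = B') (h4 : B' = B) :
    eqToHom h1 ≫ (eqToHom h2 ≫ f ≫ eqToHom h3) ≫ eqToHom h4 = f := by
  subst h1 h3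
  simp

/-- The functor that sends a torsor to its base. -/
abbrev baseFunctor (Γ : LieGroupoid.{u}) : Torsor Γ ⥤ SmoothManifold.{u} := (torsorStack Γ).p

namespace Torsor

variable {Γ : LieGroupoid.{u}}

/-- Replacement of the base of a torsor by an equal manifold. -/
abbrev rebase (T : Torsor Γ) {S : SmoothManifold.{u}} (h : T.base = S) : Torsor Γ :=
  ⟨S, T.total, h ▸ T.str⟩

/-- A torsor is isomorphic to the torsor over an equal base. -/
def rebaseIso (T : Torsor Γ) {S : SmoothManifold.{u}} (h : T.base = S) : T.rebase h ≅ T := by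
  subst h
  exact Iso.refl T

theorem base_rebaseIso_hom (T : Torsor Γ) {S : SmoothManifold.{u}} (h : T.base = S) :
    (baseFunctor Γ).map (T.rebaseIso h).hom = eqToHom h.symm := by
  subst h
  rfl

theorem base_rebaseIso_inv (T : Torsor Γ) {S : SmoothManifold.{u}} (h : T.base = S) :
    (baseFunctor Γ).map (T.rebaseIso h).inv = eqToHom h := by
  subst h
  rfl

theorem exists_eq_mk (T : Torsor Γ) {S : SmoothManifold.{u}} (h : T.base = S) :
    ∃ (P : SmoothManifold.{u}) (r : TorsorStructure Γ S P), T = ⟨S, P, r⟩ := by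
  subst h
  exact ⟨_, _, rfl⟩

end Torsor

variable {X Y : LieGroupoid.{u}} {F : Torsor X ⥤ Torsor Y}

theorem base_obj (hF : F ⋙ baseFunctor Y = baseFunctor X) (P : Torsor X) : (F.obj P).base = P.base := Functor.congr_obj hF P

variable (hF : F ⋙ baseFunctor Y = baseFunctor X)

/-- The comparison of the values of a functor with their rebased versions. -/
def baseIso (P : Torsor X) : (F.obj P).rebase (base_obj hF P) ≅ F.obj P :=
  (F.obj P).rebaseIso (base_obj hF P)

/-- A functor over the base preserves bases only up to equality of objects; conjugation by the
rebasing isomorphisms cancels the resulting transports. -/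
theorem base_baseIso_conj {P P' : Torsor X} (φ : P ⟶ P') :
    (baseFunctor Y).map ((baseIso hF P).hom ≫ F.map φ ≫ (baseIso hF P').inv) =
      (baseFunctor X).map φ := by
  have h : (baseFunctor Y).map (F.map φ) = _ := Functor.congr_hom hF φ
  rw [Functor.map_comp, Functor.map_comp, h]
  erw [Torsor.base_rebaseIso_hom, Torsor.base_rebaseIso_inv]
  exact eqToHom_conj _ _ _ _ _

/-- The strict functor isomorphic to a fully faithful functor of stacks. -/
def strictify [F.Full] [F.Faithful] : TorsorFunctor X Y where
  total P := (F.obj P).total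
  str P := base_obj hF P ▸ (F.obj P).str
  map {P P'} φ := (baseIso hF P).hom ≫ F.map φ ≫ (baseIso hF P').inv
  base_map φ s := congrArg (fun f : SmoothMap _ _ => f s) (base_baseIso_conj hF φ)
  map_comp φ ψ := by
    rw [F.map_comp]
    simp only [Category.assoc, Iso.inv_hom_id_assoc]
  map_injective {P P' φ ψ} h := by
    refine F.map_injective ?_
    exact (cancel_mono (baseIso hF P').inv).1 ((cancel_epi (baseIso hF P).hom).1 h)
  map_surjective {P P'} ψ := by
    obtain ⟨φ, hφ⟩ := F.map_surjective ((baseIso hF P).inv ≫ ψ ≫ (baseIso hF P').hom)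
    refine ⟨φ, ?_⟩
    rw [hφ]
    simp only [Category.assoc, Iso.hom_inv_id_assoc, Iso.hom_inv_id]
    exact Category.comp_id ψ

theorem nonempty_bitorsor_of_functor [F.Full] [F.Faithful]
    (hF : F ⋙ baseFunctor Y = baseFunctor X) (hY : ∀ P : Torsor Y, P.str.SmoothDiv)
    {R : Torsor X} (hR : R.base = Y.Obj) (η : F.obj R ≅ unitPull (.id Y.Obj))
    (hη : (baseFunctor Y).IsHomLift (𝟙 Y.Obj) η.hom) : Nonempty (Bitorsor X Y) := by
  obtain ⟨Q, r, rfl⟩ := R.exists_eq_mk hR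
  have h1 : (baseFunctor Y).map ((baseIso hF ⟨Y.Obj, Q, r⟩ ≪≫ η).hom) = 𝟙 Y.Obj := by
    have h := IsHomLift.fac' (baseFunctor Y) (𝟙 Y.Obj) η.hom
    rw [Iso.trans_hom, Functor.map_comp, h]
    erw [Torsor.base_rebaseIso_hom, Category.id_comp]
    exact (congrArg _ (eqToHom_trans _ _)).trans (eqToHom_trans _ _)
  exact (strictify hF).nonempty_bitorsor hY (baseIso hF ⟨Y.Obj, Q, r⟩ ≪≫ η)
    fun y => congrArg (fun f : SmoothMap _ _ => f y) h1

/-- Lie groupoids with isomorphic stacks of torsors have a bitorsor. -/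
theorem StackIsomorphic.nonempty_bitorsor {X Y : LieGroupoid.{u}}
    (hY : ∀ P : Torsor Y, P.str.SmoothDiv)
    (h : StackIsomorphic (torsorStack X) (torsorStack Y)) : Nonempty (Bitorsor X Y) := by
  obtain ⟨F, G, ⟨ε⟩, ⟨ι⟩⟩ := h
  let F' : Torsor X ⥤ Torsor Y := F.toFunctor
  let G' : Torsor Y ⥤ Torsor X := G.toFunctor
  let ε' : G' ⋙ F' ≅ 𝟭 (Torsor Y) := (BasedNatTrans.forgetful _ _).mapIso ε
  let ι' : F' ⋙ G' ≅ 𝟭 (Torsor X) := (BasedNatTrans.forgetful _ _).mapIso ι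
  -- Forgetting the base leaves an ordinary equivalence, from which fullness and faithfulness are
  -- read off.
  let e : Torsor X ≌ Torsor Y := CategoryTheory.Equivalence.mk F' G' ι'.symm ε'
  have h1 : F'.Full := inferInstanceAs e.functor.Full
  have h2 : F'.Faithful := inferInstanceAs e.functor.Faithful
  let T : Torsor Y := unitPull (.id Y.Obj)
  exact nonempty_bitorsor_of_functor (F := F') F.w hY (base_obj (F := G') G.w T) (ε'.app T)
    (ε.hom.isHomLift' T)

end

end DiffStack

/-- For second countable Lie groupoids `X` and `Y`, the following are equivalent: the stacks of
`X`-torsors and of `Y`-torsors are isomorphic; `X` and `Y` are Morita equivalent; there is an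
`X`-`Y`-bitorsor. (The object manifolds are second countable too, as open quotients of the arrow
manifolds.) -/
theorem mainTheorem6 (X Y : DiffStack.LieGroupoid.{u})
    (hX : SecondCountableTopology X.Mor) (hY : SecondCountableTopology Y.Mor) :
    List.TFAE
      [DiffStack.StackIsomorphic (DiffStack.torsorStack X) (DiffStack.torsorStack Y),
        DiffStack.MoritaEquivalent X Y,
        Nonempty (DiffStack.Bitorsor X Y)] := by
  -- Second countability of the arrow manifolds enters only through smooth division; the implication
  -- from 2 to 3 does without it.
  have hX' : ∀ P : DiffStack.Torsor X, P.str.SmoothDiv := fun P => P.str.smoothDiv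
  have hY' : ∀ P : DiffStack.Torsor Y, P.str.SmoothDiv := fun P => P.str.smoothDiv
  tfae_have 1 → 3 := fun h => h.nonempty_bitorsor hY'
  tfae_have 3 → 2 := fun ⟨B⟩ => DiffStack.Bitorsor.moritaEquivalent (hY' ⟨_, _, B.right⟩)
    (hX' ⟨_, _, B.left⟩)
  tfae_have 2 → 3 := fun h => h.nonempty_bitorsor
  tfae_have 3 → 1 := fun ⟨B⟩ => B.stackIsomorphic hX' hY'
  tfae_finish
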